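/- **Setting.** Let $L$ be an even lattice of signature $(b_+,b_-)$, i.e. a full lattice in a finite-dimensional real vector space $L_{\mathbb R}$ with a non-degenerate symmetric bilinear form $(\cdot,\cdot)$ such that $\lambda^2:=(\lambda,\lambda)\in 2\mathbb{Z}$ for all $\lambda\in L$. Let $L^*\supseteq L$ be the dual lattice, $D_L=L^*/L$ the (finite) discriminant group, and $\{\mathfrak e_\gamma\}_{\gamma\in D_L}$ the natural basis of $\mathbb{C}[D_L]$. Let $M\subseteq L$ be a primitive non-degenerate sub-lattice of signature $(c_+,c_-)$, with $M^*\subseteq M_{\mathbb R}$, $D_M=M^*/M$, and let $\{\mathfrak e_\delta^*\}_{\delta\in D_M}$ be the basis of $\mathbb{C}[D_{M(-1)}]=\mathbb{C}[D_M]^*$ dual to the natural basis of $\mathbb{C}[D_M]$. Write $\lambda\mapsto\lambda_{M_{\mathbb R}^\perp}$ for the orthogonal projection from $L_{\mathbb R}$ to $M_{\mathbb R}^\perp$; on $L^*$ it factors through $L^*/M$. The orthogonal projection to $M_{\mathbb R}$ maps $L^*$ to $M^*$ and induces $\pi_M:L^*/M\to D_M$. Let $\operatorname{Mp}_2(\mathbb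 Z)$ be the group of pairs $(A,\phi)$ with $A=\binom{a\ b}{c\ d}\in\operatorname{SL}_2(\mathbb Z)$ and $\phi:\mathcal H\to\mathbb C$ holomorphic with $\phi(\tau)^2=c\tau+d$, and product $(A,\phi)(B,\psi)=(AB,(\phi\circ B)\psi)$. It is generated by $T=(\binom{1\ 1}{0\ 1},1)$ and $S=(\binom{0\ -1}{1\ \ \ 0},\sqrt\tau)$ (principal branch). With $\mathbf e(w)=e^{2\pi i w}$, the Weil representation $\rho_L$ on $\mathbb C[D_L]$ is the representation of $\operatorname{Mp}_2(\mathbb Z)$ satisfying $$\rho_L(T)\mathfrak e_\gamma=\mathbf e\big(\tfrac{\gamma^2}{2}\big)\mathfrak e_\gamma,\qquad \rho_L(S)\mathfrak e_\gamma=\frac{\mathbf e\big(\frac{b_--b_+}{8}\big)}{\sqrt{|D_L|}}\sum_{\delta\in D_L}\mathbf e\big(-(\gamma,\delta)\big)\mathfrak e_\delta ,$$ $\rho_M$ is defined likewise with $(c_+,c_-)$, and $\rho_M^*$ is the dual representation of $\rho_M$. Let $u^\perp$ be an orthogonal decomposition $M_{\mathbb R}^\perp=u^\perp_+\oplus u^\perp_-$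 with $u^\perp_+$ positive definite and $u^\perp_-$ negative definite, and for $w\in M_{\mathbb R}^\perp$ let $w_{u^\perp_\pm}$ be its components. Let $0\le n_\pm\le m_\pm$ be integers and let $p$ be a complex-valued polynomial on $M_{\mathbb R}^\perp$ that is homogeneous of degree $(m_+-n_+,m_--n_-)$ with respect to $u^\perp$, i.e. $p(sw_{u^\perp_+}+tw_{u^\perp_-})=s^{m_+-n_+}t^{m_--n_-}p(w)$ for all $w\in M_{\mathbb R}^\perp$ and $s,t\in\mathbb R$. Let $\Delta_{u^\perp}$ be the Laplacian of the positive definite form $(w_{u^\perp_+},w'_{u^\perp_+})-(w_{u^\perp_-},w'_{u^\perp_-})$ on $M_{\mathbb R}^\perp$, and $e^{c\Delta_{u^\perp}}=\sum_{j\ge0}\frac{c^j}{j!}\Delta_{u^\perp}^j$. For $\tau=x+iy\in\mathcal H$ and $\xi,\eta\in M_{\mathbb R}^\perp$ define $$\Theta_{L,M}\big(\tau;\tbinom{\xi}{\eta};u^\perp,p\big)=y^{\frac{b_--c_-}{2}+m_--n_-}\sum_{\delta\in D_M}\ \sum_{\substack{\lambda\in L^*/M\\ \pi_M(\lambda)=\delta}}\vartheta_\lambda\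 \mathfrak e_{\lambda+L}\otimes\mathfrak e_\delta^*\ \in\ \mathbb C[D_L]\otimes\mathbb C[D_{M(-1)}],$$ $$\vartheta_\lambda=\Big(e^{-\frac{\Delta_{u^\perp}}{8\pi y}}p\Big)\big(\lambda_{M_{\mathbb R}^\perp}+\eta\big)\;\mathbf e\bigg(\tau\frac{(\lambda_{M_{\mathbb R}^\perp}+\eta)_{u^\perp_+}^2}{2}+\overline\tau\,\frac{(\lambda_{M_{\mathbb R}^\perp}+\eta)_{u^\perp_-}^2}{2}-\big(\lambda_{M_{\mathbb R}^\perp}+\tfrac{\eta}{2},\xi\big)\bigg).$$ **Theorem.** The Weil representations $\rho_L$ and $\rho_M$ (representations of $\operatorname{Mp}_2(\mathbb Z)$ given by the above formulae on $T$ and $S$) exist, and the series defining $\Theta_{L,M}$ converges absolutely. For every $\tau\in\mathcal H$, $\xi,\eta\in M_{\mathbb R}^\perp$ and $(A,\phi)\in\operatorname{Mp}_2(\mathbb Z)$, $A=\binom{a\ b}{c\ d}$, with $A\binom{\xi}{\eta}=\binom{a\xi+b\eta}{c\xi+d\eta}$, we have $$\Theta_{L,M}\big(A\tau;A\tbinom{\xi}{\eta};u^\perp,p\big)=\phi(\tau)^{b_+-c_+-b_-+c_-+2m_+-2n_+-2m_-+2n_-}\,(\rho_L\otimes\rho_M^*)\big((A,\phi)\big)\,\Theta_{L,M}\big(\tau;\tbinom{\xi}{\eta};u^\perp,p\big).$$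 -/

import Mathlib

open scoped TensorProduct UpperHalfPlane MatrixGroups Manifold

namespace ModifiedTheta

/-! ### The metaplectic group -/

/-- The metaplectic group `Mp₂(ℤ)`: pairs `(A, φ)` with `A ∈ SL₂(ℤ)` and `φ` a holomorphic function
on the upper half-plane such that `φ(τ)² = cτ + d`. -/
@[ext]
structure Mp2Z where
  mat : SL(2, ℤ)
  phi : ℍ → ℂ
  holo : MDifferentiable 𝓘(ℂ) 𝓘(ℂ) phi
  sq : ∀ τ : ℍ, phi τ ^ 2 = (mat 1 0 : ℂ) * (τ : ℂ) + (mat 1 1 : ℂ)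

namespace Mp2Z

theorem sq_denom (g : Mp2Z) (τ : ℍ) :
    g.phi τ ^ 2 = UpperHalfPlane.denom (g.mat : GL (Fin 2) ℝ) τ := by
  rw [g.sq]
  simp [UpperHalfPlane.denom]

theorem phi_ne_zero (g : Mp2Z) (τ : ℍ) : g.phi τ ≠ 0 := by
  intro h
  have h2 := g.sq_denom τ
  rw [h] at h2
  exact UpperHalfPlane.denom_ne_zero _ τ (by rw [← h2]; simp)

theorem denom_eq (A : SL(2, ℤ)) (τ : ℍ) :
    UpperHalfPlane.denom (A : GL (Fin 2) ℝ) τ = (A 1 0 : ℂ) * (τ : ℂ) + (A 1 1 : ℂ) := by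
  simp [UpperHalfPlane.denom]

theorem denom_mul (A B : SL(2, ℤ)) (τ : ℍ) :
    UpperHalfPlane.denom ((A * B : SL(2, ℤ)) : GL (Fin 2) ℝ) τ =
      UpperHalfPlane.denom (A : GL (Fin 2) ℝ) (B • τ : ℍ) *
        UpperHalfPlane.denom (B : GL (Fin 2) ℝ) τ := by
  have h := UpperHalfPlane.denom_cocycle_σ (A : GL (Fin 2) ℝ) (B : GL (Fin 2) ℝ) τ
  have hs : UpperHalfPlane.σ (B : GL (Fin 2) ℝ) = ContinuousAlgEquiv.refl ℝ ℂ := by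
    simp [UpperHalfPlane.σ]
  rw [hs] at h
  rw [show ((A * B : SL(2, ℤ)) : GL (Fin 2) ℝ) = (A : GL (Fin 2) ℝ) * (B : GL (Fin 2) ℝ) by
    simp [map_mul]]
  exact h

theorem mdifferentiable_act (A : SL(2, ℤ)) :
    MDifferentiable 𝓘(ℂ) 𝓘(ℂ) (fun τ : ℍ => A • τ) := by
  have : 0 < ((A : GL (Fin 2) ℝ)).det.val := by simp
  exact UpperHalfPlane.mdifferentiable_smul this

/-- The product `(A, φ) (B, ψ) = (A B, (φ ∘ B) ψ)`. -/
noncomputable instance : Mul Mp2Z where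
  mul g h :=
    { mat := g.mat * h.mat
      phi := fun τ => g.phi (h.mat • τ) * h.phi τ
      holo := (g.holo.comp (mdifferentiable_act h.mat)).mul h.holo
      sq := fun τ => by
        rw [mul_pow, sq_denom, sq_denom, ← denom_eq, denom_mul] }

instance : One Mp2Z where
  one :=
    { mat := 1
      phi := fun _ => 1
      holo := mdifferentiable_const
      sq := fun τ => by simp }

noncomputable instance : Inv Mp2Z where
  inv g :=
    { mat := g.mat⁻¹
      phi := fun τ => (g.phi (g.mat⁻¹ • τ))⁻¹
      holo := fun τ => by
        have h := (g.holo.comp (mdifferentiable_act g.mat⁻¹)) τ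
        rw [UpperHalfPlane.mdifferentiableAt_iff] at h ⊢
        exact h.inv (g.phi_ne_zero _)
      sq := fun τ => by
        have h := denom_mul g.mat g.mat⁻¹ τ
        rw [mul_inv_cancel] at h
        rw [inv_pow, sq_denom, ← denom_eq]
        refine inv_eq_of_mul_eq_one_right ?_
        rw [← h]
        simp }

theorem mul_mat (g h : Mp2Z) : (g * h).mat = g.mat * h.mat := rfl

theorem mul_phi (g h : Mp2Z) (τ : ℍ) : (g * h).phi τ = g.phi (h.mat • τ) * h.phi τ := rfl

theorem one_mat : (1 : Mp2Z).mat = 1 := rfl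

theorem one_phi (τ : ℍ) : (1 : Mp2Z).phi τ = 1 := rfl

theorem inv_mat (g : Mp2Z) : (g⁻¹).mat = g.mat⁻¹ := rfl

theorem inv_phi (g : Mp2Z) (τ : ℍ) : (g⁻¹).phi τ = (g.phi (g.mat⁻¹ • τ))⁻¹ := rfl

noncomputable instance : Group Mp2Z where
  mul_assoc a b c := by
    ext1
    · simp only [mul_mat, mul_assoc]
    · funext τ
      simp only [mul_mat, mul_phi, mul_smul, mul_assoc]
  one_mul a := by
    ext1
    · simp only [mul_mat, one_mat, one_mul]
    · funext τ
      simp only [mul_phi, one_phi, one_mul]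
  mul_one a := by
    ext1
    · simp only [mul_mat, one_mat, mul_one]
    · funext τ
      simp only [mul_phi, one_mat, one_phi, one_smul, mul_one]
  inv_mul_cancel a := by
    ext1
    · simp only [mul_mat, inv_mat, one_mat, inv_mul_cancel]
    · funext τ
      simp only [mul_phi, inv_phi, one_phi, inv_smul_smul]
      exact inv_mul_cancel₀ (a.phi_ne_zero τ)

/-- The generator `T = ((1 1; 0 1), 1)`. -/
def T : Mp2Z where
  mat := ModularGroup.T
  phi := fun _ => 1
  holo := mdifferentiable_const
  sq := fun τ => by simp [ModularGroup.T]

/-- The generator `S = ((0 -1; 1 0), √τ)`, with the principal branch of the square root. -/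
noncomputable def S : Mp2Z where
  mat := ModularGroup.S
  phi := fun τ => (τ : ℂ) ^ (1 / 2 : ℂ)
  holo := by
    rw [UpperHalfPlane.mdifferentiable_iff]
    have h : DifferentiableOn ℂ (fun z : ℂ => z ^ (1 / 2 : ℂ)) {z | 0 < z.im} := fun z hz =>
      (DifferentiableAt.cpow_const differentiableAt_id
        (Or.inr (ne_of_gt hz))).differentiableWithinAt
    refine h.congr fun z hz => ?_
    simp [UpperHalfPlane.ofComplex_apply_of_im_pos hz]
  sq := fun τ => by
    rw [← Complex.cpow_nat_mul]
    simp [ModularGroup.S]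

end Mp2Z

/-- `𝐞(w) = exp(2πi w)`. -/
noncomputable def e (w : ℂ) : ℂ := Complex.exp (2 * Real.pi * Complex.I * w)

/-! ### Lattices in real quadratic spaces

A lattice is a subgroup of a real vector space `V` with a symmetric bilinear form `B`, where
`(x, y) = B x y` and `x² = B x x`. -/

section Lattices

variable {V : Type*} [AddCommGroup V] [Module ℝ V]

/-- `N_ℝ`, the real subspace spanned by `N`. -/
def realSpan (N : Submodule ℤ V) : Submodule ℝ V := Submodule.span ℝ (N : Set V)

/-- `N_ℝ^⊥`, the orthogonal complement of `N_ℝ` in `V`. -/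
def realPerp (B : LinearMap.BilinForm ℝ V) (N : Submodule ℤ V) : Submodule ℝ V :=
  B.orthogonal (realSpan N)

/-- `L` is an even (non-degenerate) lattice with `L_ℝ = V`. -/
structure IsEvenLattice (B : LinearMap.BilinForm ℝ V) (L : Submodule ℤ V) : Prop where
  symm : B.IsSymm
  nondegenerate : B.Nondegenerate
  exists_basis : ∃ b : Module.Basis (Fin (Module.finrank ℝ V)) ℝ V,
    L = Submodule.span ℤ (Set.range b)
  even : ∀ x ∈ L, ∃ k : ℤ, B x x = 2 * k

/-- `M` is a primitive non-degenerate sub-lattice of `L`. -/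
structure IsPrimitiveSublattice (B : LinearMap.BilinForm ℝ V) (L M : Submodule ℤ V) : Prop where
  le : M ≤ L
  primitive : ∀ x ∈ L, ∀ k : ℤ, k ≠ 0 → k • x ∈ M → x ∈ M
  nondegenerate : (B.restrict (realSpan M)).Nondegenerate

/-- The signature of the restriction of the quadratic form to `N_ℝ` is `(p, q)`. -/
def HasSignature (B : LinearMap.BilinForm ℝ V) (N : Submodule ℤ V) (p q : ℕ) : Prop :=
  sigPos (B.restrict (realSpan N)).toQuadraticMap = p ∧
    sigNeg (B.restrict (realSpan N)).toQuadraticMap = q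

/-- The dual lattice `N* = {x ∈ N_ℝ | (x, N) ⊆ ℤ}`. -/
noncomputable def dualLattice (B : LinearMap.BilinForm ℝ V) (N : Submodule ℤ V) : Submodule ℤ V :=
  B.dualSubmodule N ⊓ (realSpan N).restrictScalars ℤ

/-- The discriminant group `D_N = N* / N`. -/
abbrev DiscGroup (B : LinearMap.BilinForm ℝ V) (N : Submodule ℤ V) : Type _ :=
  ↥(dualLattice B N) ⧸ N.submoduleOf (dualLattice B N)

/-- The class `x + N ∈ D_N` of `x ∈ N*`. -/
noncomputable def discMk (B : LinearMap.BilinForm ℝ V) (N : Submodule ℤ V) (x : dualLattice B N) :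
    DiscGroup B N :=
  Submodule.Quotient.mk x

/-- The vector space `ℂ[D_N]`. -/
abbrev DiscSpace (B : LinearMap.BilinForm ℝ V) (N : Submodule ℤ V) : Type _ :=
  DiscGroup B N →₀ ℂ

/-- The basis vector `𝔢_γ` of `ℂ[D_N]`. -/
noncomputable def basisVec {B : LinearMap.BilinForm ℝ V} {N : Submodule ℤ V}
    (γ : DiscGroup B N) : DiscSpace B N :=
  Finsupp.single γ 1

/-- The vector `𝔢_γ^*` of the dual space `ℂ[D_{N(-1)}] = ℂ[D_N]^*`, dual to the natural basis. -/
noncomputable def dualVec {B : LinearMap.BilinForm ℝ V} {N : Submodule ℤ V}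
    (γ : DiscGroup B N) : Module.Dual ℂ (DiscSpace B N) :=
  Finsupp.lapply γ

/-- The formulae for the Weil representation on the generators `T` and `S`:
`ρ(T) 𝔢_γ = 𝐞(γ²/2) 𝔢_γ` and `ρ(S) 𝔢_γ = 𝐞((b₋ - b₊)/8) |D_N|^(-1/2) ∑_δ 𝐞(-(γ, δ)) 𝔢_δ`,
the latter being expressed through the coefficient of each `𝔢_δ`. -/
structure IsWeilRep (B : LinearMap.BilinForm ℝ V) (N : Submodule ℤ V)
    (ρ : Representation ℂ Mp2Z (DiscSpace B N)) : Prop where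
  T_apply : ∀ x : dualLattice B N,
    ρ Mp2Z.T (basisVec (discMk B N x)) = e ((B x x / 2 : ℝ) : ℂ) • basisVec (discMk B N x)
  S_apply : ∀ x y : dualLattice B N,
    ρ Mp2Z.S (basisVec (discMk B N x)) (discMk B N y) =
      e ((((sigNeg (B.restrict (realSpan N)).toQuadraticMap : ℝ) -
          (sigPos (B.restrict (realSpan N)).toQuadraticMap : ℝ)) / 8 : ℝ) : ℂ) /
        (Real.sqrt (Nat.card (DiscGroup B N)) : ℂ) * e ((-(B x y) : ℝ) : ℂ)

open Classical in
/-- The Weil representation `ρ_N` of `Mp₂(ℤ)` on `ℂ[D_N]`: the representation given by the formulae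
above on the generators `T` and `S` (they determine it uniquely). -/
noncomputable def weilRep (B : LinearMap.BilinForm ℝ V) (N : Submodule ℤ V) :
    Representation ℂ Mp2Z (DiscSpace B N) :=
  if h : ∃ ρ, IsWeilRep B N ρ then h.choose else Representation.trivial ℂ Mp2Z (DiscSpace B N)

end Lattices

/-! ### Grassmannians, homogeneous polynomials, and the Laplacian -/

section Grassmannian

variable {E : Type*} [AddCommGroup E] [Module ℝ E]

/-- A point of the Grassmannian: an orthogonal decomposition `E = v₊ ⊕ v₋` with `v₊` positive
definite and `v₋` negative definite. -/
structure Grassmannian (B : LinearMap.BilinForm ℝ E) where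
  pos : Submodule ℝ E
  neg : Submodule ℝ E
  isCompl : IsCompl pos neg
  posDef : ∀ x ∈ pos, x ≠ 0 → 0 < B x x
  negDef : ∀ x ∈ neg, x ≠ 0 → B x x < 0
  ortho : ∀ x ∈ pos, ∀ y ∈ neg, B x y = 0

variable {B : LinearMap.BilinForm ℝ E}

/-- The orthogonal projection `x ↦ x_{v₊}`. -/
noncomputable def Grassmannian.projPos (v : Grassmannian B) : E →ₗ[ℝ] E :=
  v.pos.projection v.neg v.isCompl

/-- The orthogonal projection `x ↦ x_{v₋}`. -/
noncomputable def Grassmannian.projNeg (v : Grassmannian B) : E →ₗ[ℝ] E :=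
  v.neg.projection v.pos v.isCompl.symm

/-- The majorant `(x_{v₊}, y_{v₊}) - (x_{v₋}, y_{v₋})` associated with `v`. -/
noncomputable def Grassmannian.majorant (v : Grassmannian B) (x y : E) : ℝ :=
  B (v.projPos x) (v.projPos y) - B (v.projNeg x) (v.projNeg y)

/-- Complex-valued polynomial functions on a real vector space: the `ℂ`-algebra generated by the
real linear functionals. -/
def IsPolynomial (p : E → ℂ) : Prop :=
  p ∈ Algebra.adjoin ℂ (Set.range fun (l : Module.Dual ℝ E) (x : E) => (l x : ℂ))

/-- `p` is homogeneous of degree `(a, b)` with respect to `v`. -/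
def IsHomogeneousOfDegree (v : Grassmannian B) (p : E → ℂ) (a b : ℕ) : Prop :=
  ∀ (x : E) (s t : ℝ),
    p (s • v.projPos x + t • v.projNeg x) = (s : ℂ) ^ a * (t : ℂ) ^ b * p x

/-- The Laplacian `Δ_v` of the majorant of `v`: in terms of a basis `b` with Gram matrix `G` with
respect to the majorant, `Δ_v = ∑ (G⁻¹)_{ij} ∂_{b_i} ∂_{b_j}`. This does not depend on the basis and
equals `∑ ∂_i²` in coordinates that are orthonormal with respect to the majorant. -/
noncomputable def laplacian [FiniteDimensional ℝ E] (v : Grassmannian B) (f : E → ℂ) (x : E) : ℂ :=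
  let b := Module.finBasis ℝ E
  let G : Matrix (Fin (Module.finrank ℝ E)) (Fin (Module.finrank ℝ E)) ℝ :=
    Matrix.of fun i j => v.majorant (b i) (b j)
  ∑ i, ∑ j, ((G⁻¹ i j : ℝ) : ℂ) * lineDeriv ℝ (fun z => lineDeriv ℝ f z (b j)) x (b i)

/-- `e^{c Δ_v} p = ∑_j (c^j / j!) Δ_v^j p`, a finite sum when `p` is a polynomial. -/
noncomputable def expLaplacian [FiniteDimensional ℝ E] (v : Grassmannian B) (c : ℝ)
    (p : E → ℂ) (x : E) : ℂ :=
  ∑' j : ℕ, ((c ^ j / (j.factorial : ℝ) : ℝ) : ℂ) * ((laplacian v)^[j] p) x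

end Grassmannian

/-! ### The modified theta function -/

section Theta

variable {V : Type*} [AddCommGroup V] [Module ℝ V] [FiniteDimensional ℝ V]
  {B : LinearMap.BilinForm ℝ V} {L M : Submodule ℤ V}

theorem isCompl_realSpan (hL : IsEvenLattice B L) (hM : IsPrimitiveSublattice B L M) :
    IsCompl (realSpan M) (realPerp B M) :=
  LinearMap.BilinForm.isCompl_orthogonal_of_restrict_nondegenerate hL.symm.isRefl hM.nondegenerate

/-- The orthogonal projection `V → M_ℝ`. -/
noncomputable def projSpan (hL : IsEvenLattice B L) (hM : IsPrimitiveSublattice B L M) :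
    V →ₗ[ℝ] realSpan M :=
  (realSpan M).projectionOnto (realPerp B M) (isCompl_realSpan hL hM)

/-- The orthogonal projection `x ↦ x_{M_ℝ^⊥}`. -/
noncomputable def projPerp (hL : IsEvenLattice B L) (hM : IsPrimitiveSublattice B L M) :
    V →ₗ[ℝ] realPerp B M :=
  (realPerp B M).projectionOnto (realSpan M) (isCompl_realSpan hL hM).symm

/-- The quotient `L* / M`. -/
abbrev DualMod (B : LinearMap.BilinForm ℝ V) (L M : Submodule ℤ V) : Type _ :=
  ↥(dualLattice B L) ⧸ M.submoduleOf (dualLattice B L)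

/-- The natural map `L*/M → D_L`, `λ ↦ λ + L`. -/
noncomputable def toDisc (hM : IsPrimitiveSublattice B L M) : DualMod B L M →ₗ[ℤ] DiscGroup B L :=
  Submodule.mapQ _ _ LinearMap.id fun _ hx => hM.le hx

theorem projSpan_mem (hL : IsEvenLattice B L) (hM : IsPrimitiveSublattice B L M) (x : V)
    (hx : x ∈ dualLattice B L) : (projSpan hL hM x : V) ∈ dualLattice B M := by
  refine ⟨fun y hy => ?_, (projSpan hL hM x).2⟩
  have hd : x - (projSpan hL hM x : V) ∈ realPerp B M := by
    have h := Submodule.projection_add_projection_eq_self (isCompl_realSpan hL hM) x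
    have h2 : x - (projSpan hL hM x : V) =
        (realPerp B M).projection (realSpan M) (isCompl_realSpan hL hM).symm x :=
      sub_eq_of_eq_add' h.symm
    rw [h2]
    exact (((realPerp B M).projectionOnto (realSpan M) (isCompl_realSpan hL hM).symm) x).2
  have h0 : B y (x - (projSpan hL hM x : V)) = 0 :=
    (LinearMap.BilinForm.mem_orthogonal_iff.mp hd) y (Submodule.subset_span hy)
  rw [hL.symm.eq, map_sub, LinearMap.sub_apply, sub_eq_zero] at h0
  rw [← h0]
  exact hx.1 y (hM.le hy)

/-- The map `L* → M*` given by the orthogonal projection. -/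
noncomputable def dualProj (hL : IsEvenLattice B L) (hM : IsPrimitiveSublattice B L M) :
    dualLattice B L →ₗ[ℤ] dualLattice B M where
  toFun x := ⟨projSpan hL hM x, projSpan_mem hL hM x x.2⟩
  map_add' x y := by ext; simp
  map_smul' k x := by ext; simp

theorem dualProj_mem (hL : IsEvenLattice B L) (hM : IsPrimitiveSublattice B L M) :
    M.submoduleOf (dualLattice B L) ≤
      (M.submoduleOf (dualLattice B M)).comap (dualProj hL hM) := by
  intro x hx
  have hx' : (x : V) ∈ M := hx
  have h : (projSpan hL hM x : V) = x :=
    congrArg Subtype.val (Submodule.projectionOnto_apply_of_mem_left (isCompl_realSpan hL hM)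
      (Submodule.subset_span hx' : (x : V) ∈ realSpan M))
  change (projSpan hL hM x : V) ∈ M
  rw [h]
  exact hx'

/-- The map `π_M : L*/M → D_M` induced by the orthogonal projection `L* → M*`. -/
noncomputable def piM (hL : IsEvenLattice B L) (hM : IsPrimitiveSublattice B L M) :
    DualMod B L M →ₗ[ℤ] DiscGroup B M :=
  Submodule.mapQ _ _ (dualProj hL hM) (dualProj_mem hL hM)

/-- The map `L*/M → M_ℝ^⊥`, `λ ↦ λ_{M_ℝ^⊥}`. -/
noncomputable def perpMap (hL : IsEvenLattice B L) (hM : IsPrimitiveSublattice B L M) :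
    DualMod B L M →ₗ[ℤ] realPerp B M :=
  Submodule.liftQ _
    (((projPerp hL hM).restrictScalars ℤ).comp (dualLattice B L).subtype) fun x hx => by
      have hx' : (x : V) ∈ M := hx
      exact Submodule.projectionOnto_apply_of_mem_right (isCompl_realSpan hL hM).symm
        (Submodule.subset_span hx' : (x : V) ∈ realSpan M)

/-- The scalar summand of the modified theta function associated with `l ∈ L*/M`. -/
noncomputable def thetaTerm (hL : IsEvenLattice B L) (hM : IsPrimitiveSublattice B L M)
    (u : Grassmannian (B.restrict (realPerp B M))) (p : realPerp B M → ℂ)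
    (ξ η : realPerp B M) (τ : ℍ) (l : DualMod B L M) : ℂ :=
  let w : realPerp B M := perpMap hL hM l
  expLaplacian u (-1 / (8 * Real.pi * τ.im)) p (w + η) *
    e ((τ : ℂ) * ((B (u.projPos (w + η)) (u.projPos (w + η)) / 2 : ℝ) : ℂ) +
      (starRingEnd ℂ) (τ : ℂ) * ((B (u.projNeg (w + η)) (u.projNeg (w + η)) / 2 : ℝ) : ℂ) -
      ((B (w + (1 / 2 : ℝ) • η : realPerp B M) ξ : ℝ) : ℂ))

/-- The modified theta function `Θ_{L,M}(τ; (ξ, η); u, p)` with values in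
`ℂ[D_L] ⊗ ℂ[D_{M(-1)}]`, where `kneg` is the power of `y` in front of the sum, i.e.
`(b₋ - c₋)/2` plus the degree of `p` in the negative part. The discriminant groups are finite, so
that the outer sum is a finite sum. -/
noncomputable def thetaLM (hL : IsEvenLattice B L) (hM : IsPrimitiveSublattice B L M)
    (kneg : ℝ) (u : Grassmannian (B.restrict (realPerp B M))) (p : realPerp B M → ℂ)
    (ξ η : realPerp B M) (τ : ℍ) :
    DiscSpace B L ⊗[ℂ] Module.Dual ℂ (DiscSpace B M) :=
  ((τ.im ^ kneg : ℝ) : ℂ) •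
    ∑ᶠ (γ : DiscGroup B L) (δ : DiscGroup B M),
      (∑' l : {l : DualMod B L M // toDisc hM l = γ ∧ piM hL hM l = δ},
        thetaTerm hL hM u p ξ η τ l) • (basisVec γ ⊗ₜ[ℂ] dualVec δ)

end Theta

end ModifiedTheta

open ModifiedTheta

/-! The modified theta function is what remains of the theta function of `L` once the theta function
of `M` has been divided out. Choose coordinates of `L_ℝ = M_ℝ ⊕ M_ℝ^⊥` in which the form is a signed
sum of squares, adapted to `u^⊥` on the second summand. For a dual vector `x ∈ L*`, the summand of
`Θ_L` is the product of a factor depending only on the projection of `x` to `M*` and a factor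
depending only on the class of `x` in `L*/M` (`thetaSummand_sumFrame`). Since the fibre of `L* →
L*/M` over `l` is mapped bijectively onto the coset `π_M(l)` (`bijective_dualProj_fiber`), summation
gives `⟨Θ_{L,M}, Θ_M⟩ = Θ_L`, where `Θ_M` carries the constant polynomial and its own free
parameters `ξ', η'` (`contraction_thetaVec`).

Both `Θ_L` and `Θ_M` are classical. Under `T` they transform because the lattices are even. Under
`S` they transform by Poisson summation (`LatticeFrame.poisson`), because `e^{-Δ/(8πy)} p` times the
Gaussian is carried by the Fourier transform to the same function at `-1/τ`, up to powers of `τ` and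
`τ̄`. This reduces to one variable, where a raising operator generates these functions from the
Gaussian (`fourier_hermiteGauss`). Since `S` and `T` generate the metaplectic group, the laws hold
for all of it.

For fixed `τ` the values of `Θ_M` span `ℂ[D_M]`: as a function of `ξ'` at `η' = 0`, a linear
functional applied to `Θ_M` is an absolutely convergent Fourier series, whose coefficients are
nonzero Gaussian values times the values of the functional on basis vectors (`span_thetaVec`). This
is used twice. It lets `Θ_M` be cancelled from the pairing, which leaves the law for `Θ_{L,M}` with
the difference of the two weights (`thetaLM_transformation`). It also proves that the Weil
representation exists without checking any relations: an operator that transforms a spanning theta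
function is determined by the group element, so the operators compose as the elements do
(`Transforms.exists_representation`). -/

namespace ModifiedTheta

/-! ### Polynomials times Gaussians in one variable -/

section OneVariable

open Complex FourierTransform MeasureTheory

/-- The function `x ↦ P(x) exp(πiτx²)`. -/
noncomputable def polyGauss (P : Polynomial ℂ) (τ : ℂ) (x : ℝ) : ℂ :=
  P.eval (x : ℂ) * cexp (Real.pi * I * τ * x ^ 2)

theorem hasDerivAt_polyGauss (P : Polynomial ℂ) (τ : ℂ) (x : ℝ) :
    HasDerivAt (polyGauss P τ)
      (polyGauss (Polynomial.derivative P + Polynomial.C (2 * Real.pi * I * τ) *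
        (Polynomial.X * P)) τ x) x := by
  have h1 : HasDerivAt (fun z : ℂ => P.eval z * cexp (Real.pi * I * τ * z ^ 2))
      (P.derivative.eval (x : ℂ) * cexp (Real.pi * I * τ * (x : ℂ) ^ 2) +
        P.eval (x : ℂ) * (cexp (Real.pi * I * τ * (x : ℂ) ^ 2) *
          (Real.pi * I * τ * (2 * x)))) (x : ℂ) := by
    refine (P.hasDerivAt _).mul (HasDerivAt.cexp ?_)
    simpa using (hasDerivAt_pow 2 (x : ℂ)).const_mul (Real.pi * I * τ)
  refine h1.comp_ofReal.congr_deriv ?_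
  simp [polyGauss]
  ring

theorem continuous_polyGauss (P : Polynomial ℂ) (τ : ℂ) : Continuous (polyGauss P τ) :=
  continuous_iff_continuousAt.2 fun x => (hasDerivAt_polyGauss P τ x).continuousAt

theorem norm_polynomial_eval_le_exp (P : Polynomial ℂ) :
    ∃ C : ℝ, 0 ≤ C ∧ ∀ x : ℝ, ‖P.eval (x : ℂ)‖ ≤ C * Real.exp |x| := by
  induction P using Polynomial.induction_on' with
  | add p q hp hq =>
    obtain ⟨C, hC, h⟩ := hp
    obtain ⟨D, hD, h'⟩ := hq
    refine ⟨C + D, by positivity, fun x => ?_⟩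
    rw [Polynomial.eval_add, add_mul]
    exact (norm_add_le _ _).trans (add_le_add (h x) (h' x))
  | monomial n a =>
    refine ⟨‖a‖ * n.factorial, by positivity, fun x => ?_⟩
    have h := Real.pow_div_factorial_le_exp |x| (abs_nonneg x) n
    rw [div_le_iff₀ (by positivity)] at h
    simp only [Polynomial.eval_monomial, norm_mul, norm_pow, Complex.norm_real, Real.norm_eq_abs]
    rw [mul_assoc, mul_comm (n.factorial : ℝ)]
    gcongr

theorem norm_polyGauss_le (P : Polynomial ℂ) {τ : ℂ} (hτ : 0 < τ.im) :
    ∃ C : ℝ, 0 ≤ C ∧ ∀ x : ℝ, ‖polyGauss P τ x‖ ≤ C * Real.exp (-|x|) := by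
  obtain ⟨C, hC, h⟩ := norm_polynomial_eval_le_exp P
  refine ⟨C * Real.exp (1 / (Real.pi * τ.im)), by positivity, fun x => ?_⟩
  have h1 : ‖cexp (Real.pi * I * τ * x ^ 2)‖ = Real.exp (-(Real.pi * τ.im * x ^ 2)) := by
    rw [Complex.norm_exp]
    congr 1
    have : (Real.pi * I * τ * x ^ 2 : ℂ) = ((Real.pi * x ^ 2 : ℝ) : ℂ) * (I * τ) := by
      push_cast; ring
    rw [this, Complex.re_ofReal_mul]
    simp
    ring
  rw [polyGauss, norm_mul, h1]
  have hπ : 0 < Real.pi * τ.im := by positivity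
  have h2 : |x| - Real.pi * τ.im * x ^ 2 ≤ 1 / (Real.pi * τ.im) + -|x| := by
    -- This is `(πy|x| - 1)² ≥ 0` divided by `πy`; it is the source of the constant `exp (1/(πy))`.
    have h3 : 2 * |x| ≤ 1 / (Real.pi * τ.im) + Real.pi * τ.im * x ^ 2 := by
      rw [← sq_abs x, div_add' _ _ _ hπ.ne', le_div_iff₀ hπ]
      nlinarith [sq_nonneg (Real.pi * τ.im * |x| - 1)]
    linarith
  calc ‖P.eval (x : ℂ)‖ * Real.exp (-(Real.pi * τ.im * x ^ 2))
      ≤ (C * Real.exp |x|) * Real.exp (-(Real.pi * τ.im * x ^ 2)) := by gcongr; exact h x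
    _ = C * Real.exp (|x| - Real.pi * τ.im * x ^ 2) := by
        rw [mul_assoc, ← Real.exp_add]; rfl
    _ ≤ C * Real.exp (1 / (Real.pi * τ.im) + -|x|) := by gcongr
    _ = _ := by rw [Real.exp_add]; ring

theorem integrable_of_norm_le_exp_neg_abs {f : ℝ → ℂ} (hf : Continuous f) {C : ℝ} (hC : 0 ≤ C)
    (h : ∀ x, ‖f x‖ ≤ C * Real.exp (-|x|)) : Integrable f := by
  have h1 : Integrable (fun x : ℝ => (2 * C) * (1 + ‖x‖) ^ (-2 : ℝ)) :=
    (integrable_one_add_norm (by simp)).const_mul _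
  refine h1.mono' hf.aestronglyMeasurable (Filter.Eventually.of_forall fun x => (h x).trans ?_)
  have h2 : (0 : ℝ) < 1 + |x| := by positivity
  have h3 := Real.quadratic_le_exp_of_nonneg (abs_nonneg x)
  rw [Real.norm_eq_abs, Real.rpow_neg h2.le, Real.exp_neg, mul_comm 2 C, mul_assoc]
  gcongr
  rw [← div_eq_mul_inv, le_div_iff₀ (by positivity), inv_mul_le_iff₀ (Real.exp_pos _)]
  norm_num
  nlinarith [abs_nonneg x]

theorem integrable_polyGauss (P : Polynomial ℂ) {τ : ℂ} (hτ : 0 < τ.im) :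
    Integrable (polyGauss P τ) := by
  obtain ⟨C, hC, h⟩ := norm_polyGauss_le P hτ
  exact integrable_of_norm_le_exp_neg_abs (continuous_polyGauss P τ) hC h

/-! ### Hermite–Gauss functions and their Fourier transforms -/

/-- The polynomials `e^{c d²/dx²} x^k`. -/
noncomputable def heatPoly (c : ℂ) : ℕ → Polynomial ℂ
  | 0 => 1
  | k + 1 => Polynomial.X * heatPoly c k +
      Polynomial.C (2 * c) * Polynomial.derivative (heatPoly c k)

/-- Multiplication by `X` and differentiation both reverse parity. The induction runs on polynomials
rather than on values, so that its hypothesis can be differentiated to give the parity of the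
derivative. -/
theorem heatPoly_eval_neg (c : ℂ) (k : ℕ) (x : ℂ) :
    (heatPoly c k).eval (-x) = (-1) ^ k * (heatPoly c k).eval x := by
  have h : (heatPoly c k).comp (-Polynomial.X) = Polynomial.C ((-1) ^ k) * heatPoly c k := by
    induction k with
    | zero => simp [heatPoly]
    | succ k ih =>
      have ih' := congrArg Polynomial.derivative ih
      rw [Polynomial.derivative_comp, Polynomial.derivative_C_mul] at ih'
      simp only [Polynomial.derivative_neg, Polynomial.derivative_X] at ih'
      have ih2 : (Polynomial.derivative (heatPoly c k)).comp (-Polynomial.X) =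
          Polynomial.C ((-1) ^ (k + 1)) * Polynomial.derivative (heatPoly c k) := by
        rw [pow_succ, Polynomial.C_mul, Polynomial.C_neg, Polynomial.C_1]
        linear_combination (-1) * ih'
      simp only [heatPoly, Polynomial.add_comp, Polynomial.mul_comp, Polynomial.X_comp, ih,
        Polynomial.C_comp, ih2]
      simp only [pow_succ, Polynomial.C_mul, Polynomial.C_neg, Polynomial.C_1]
      ring
  have := congrArg (Polynomial.eval x) h
  simpa [Polynomial.eval_comp] using this

/-- The parameter `c = -1/(8πy)` of the heat flow at `τ = x + iy`. -/
noncomputable def heatTime (τ : ℂ) : ℝ := -1 / (8 * Real.pi * τ.im)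

/-- The function `(e^{-(8πy)⁻¹ d²/dx²} x^k) exp(πiτx²)`. -/
noncomputable def hermiteGauss (k : ℕ) (τ : ℂ) : ℝ → ℂ :=
  polyGauss (heatPoly (heatTime τ) k) τ

theorem hermiteGauss_neg (k : ℕ) (τ : ℂ) (x : ℝ) :
    hermiteGauss k τ (-x) = (-1) ^ k * hermiteGauss k τ x := by
  simp [hermiteGauss, polyGauss, heatPoly_eval_neg, mul_assoc]

/-- A raising operator in position and derivative. The term `2cP'` in the recursion of `heatPoly` is
expressed by the derivative of `P` times the Gaussian, and the choice `2c = -1/(4πy)` turns the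
coefficient `1 + iτ/(2y)` of `x` into `iτ̄/(2y)`. -/
theorem hermiteGauss_succ (k : ℕ) {τ : ℂ} (hτ : 0 < τ.im) (x : ℝ) :
    hermiteGauss (k + 1) τ x =
      (I * (starRingEnd ℂ) τ / (2 * τ.im)) * (x * hermiteGauss k τ x) -
        (1 / (4 * Real.pi * τ.im)) * deriv (hermiteGauss k τ) x := by
  rw [hermiteGauss, hermiteGauss, (hasDerivAt_polyGauss _ _ _).deriv]
  simp only [polyGauss, heatPoly, Polynomial.eval_add, Polynomial.eval_mul, Polynomial.eval_X,
    Polynomial.eval_C]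
  set E := cexp (Real.pi * I * τ * x ^ 2)
  set P := (heatPoly (heatTime τ) k).eval (x : ℂ)
  set P' := (Polynomial.derivative (heatPoly (heatTime τ) k)).eval (x : ℂ)
  have hy : (τ.im : ℂ) ≠ 0 := by exact_mod_cast hτ.ne'
  have hpi : (Real.pi : ℂ) ≠ 0 := by exact_mod_cast Real.pi_ne_zero
  have hc : (starRingEnd ℂ) τ = τ - 2 * I * τ.im := by
    apply Complex.ext
    · simp
    · simp; ring
  rw [hc, heatTime]
  push_cast
  field_simp
  ring_nf
  simp only [I_sq]
  ring

theorem im_neg_one_div (τ : ℂ) : (-1 / τ).im = τ.im / normSq τ := by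
  rw [Complex.div_im]; simp; ring

theorem im_neg_one_div_pos {τ : ℂ} (hτ : 0 < τ.im) : 0 < (-1 / τ).im := by
  rw [im_neg_one_div]
  have : τ ≠ 0 := by rintro rfl; simp at hτ
  exact div_pos hτ (normSq_pos.2 this)

theorem differentiable_hermiteGauss (k : ℕ) (τ : ℂ) : Differentiable ℝ (hermiteGauss k τ) :=
  fun x => (hasDerivAt_polyGauss _ _ x).differentiableAt

/-- The Fourier transform exchanges position and derivative. It therefore carries the raising
operator at `τ` to `τ⁻¹` times the raising operator at `-1/τ`, so each step up from the Gaussian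
contributes one factor `τ⁻¹`. -/
theorem fourier_hermiteGauss (k : ℕ) {τ : ℂ} (hτ : 0 < τ.im) :
    𝓕 (hermiteGauss k τ) = fun s : ℝ =>
      1 / (-I * τ) ^ (1 / 2 : ℂ) * (τ ^ k)⁻¹ * hermiteGauss k (-1 / τ) s := by
  have hτ0 : τ ≠ 0 := by rintro rfl; simp at hτ
  induction k with
  | zero =>
    have h := fourier_gaussian_pi (b := -I * τ) (by simpa using hτ)
    have h1 : (fun x : ℝ => cexp (-Real.pi * (-I * τ) * x ^ 2)) = hermiteGauss 0 τ := by
      funext x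
      simp only [hermiteGauss, polyGauss, heatPoly, Polynomial.eval_one, one_mul]
      congr 1; ring
    rw [← h1, h]
    funext s
    simp only [hermiteGauss, polyGauss, heatPoly, Polynomial.eval_one, one_mul, pow_zero, inv_one,
      mul_one]
    congr 2
    field_simp
    ring_nf
    simp
  | succ k ih =>
    have hd : deriv (hermiteGauss k τ) = polyGauss _ τ :=
      funext fun x => (hasDerivAt_polyGauss _ _ x).deriv
    have hX : ∀ x : ℝ, polyGauss (Polynomial.X * heatPoly (heatTime τ) k) τ x =
        x * hermiteGauss k τ x := fun x => by simp [polyGauss, hermiteGauss, mul_assoc]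
    have i1 : Integrable (hermiteGauss k τ) := integrable_polyGauss _ hτ
    have i2 : Integrable (fun x : ℝ => x * hermiteGauss k τ x) := by
      have := integrable_polyGauss (Polynomial.X * heatPoly (heatTime τ) k) hτ
      rwa [funext hX] at this
    have i3 : Integrable (deriv (hermiteGauss k τ)) := by
      rw [hd]; exact integrable_polyGauss _ hτ
    have f1 := Real.fourier_deriv i1 (differentiable_hermiteGauss k τ) i3
    have f2 := Real.deriv_fourier i1 (by simpa using i2)
    funext s
    -- The factor `-2πi` and its inverse are inserted because the derivative of a Fourier transform
    -- is the transform of `-2πi x f`.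
    have e1 : hermiteGauss (k + 1) τ =
        (I * (starRingEnd ℂ) τ / (2 * τ.im) * (-2 * Real.pi * I)⁻¹) •
          (fun x : ℝ => (-2 * Real.pi * I * x) • hermiteGauss k τ x) +
        (-(1 / (4 * Real.pi * τ.im)) : ℂ) • deriv (hermiteGauss k τ) := by
      funext x
      have hpi : (Real.pi : ℂ) ≠ 0 := by exact_mod_cast Real.pi_ne_zero
      simp only [Pi.add_apply, Pi.smul_apply, smul_eq_mul, hermiteGauss_succ k hτ]
      have : (-2 * (Real.pi : ℂ) * I)⁻¹ * (-2 * Real.pi * I) = 1 :=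
        inv_mul_cancel₀ (by simp [hpi])
      linear_combination (-(I * (starRingEnd ℂ) τ / (2 * τ.im)) * (x * hermiteGauss k τ x)) * this
    have i2' : Integrable (fun x : ℝ => (-2 * Real.pi * I * x) • hermiteGauss k τ x) := by
      have := i2.const_mul (-2 * Real.pi * I)
      refine this.congr (Filter.Eventually.of_forall fun x => ?_)
      simp only [smul_eq_mul]; ring
    have e2 : 𝓕 (hermiteGauss (k + 1) τ) s =
        (I * (starRingEnd ℂ) τ / (2 * τ.im) * (-2 * Real.pi * I)⁻¹) *
          deriv (𝓕 (hermiteGauss k τ)) s +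
        (-(1 / (4 * Real.pi * τ.im)) : ℂ) * ((2 * Real.pi * I * s) * 𝓕 (hermiteGauss k τ) s) := by
      rw [f2, e1]
      have f1' := congrFun f1 s
      simp only [smul_eq_mul] at f1'
      rw [← f1']
      simp only [Real.fourier_real_eq, Circle.smul_def]
      rw [← integral_const_mul, ← integral_const_mul, ← integral_add]
      · congr 1
        funext v
        simp only [Pi.add_apply, Pi.smul_apply, smul_eq_mul]
        ring
      · simpa [Circle.smul_def, mul_comm s] using
          ((Real.fourierIntegral_convergent_iff s).2 i2').const_mul _
      · simpa [Circle.smul_def, mul_comm s] using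
          ((Real.fourierIntegral_convergent_iff s).2 i3).const_mul _
    rw [e2, ih]
    have hdm : deriv (fun s : ℝ => 1 / (-I * τ) ^ (1 / 2 : ℂ) * (τ ^ k)⁻¹ *
        hermiteGauss k (-1 / τ) s) s = 1 / (-I * τ) ^ (1 / 2 : ℂ) * (τ ^ k)⁻¹ *
          deriv (hermiteGauss k (-1 / τ)) s :=
      deriv_const_mul_field _
    rw [hdm, hermiteGauss_succ k (im_neg_one_div_pos hτ), im_neg_one_div]
    have hy : (τ.im : ℂ) ≠ 0 := by exact_mod_cast hτ.ne'
    have hpi : (Real.pi : ℂ) ≠ 0 := by exact_mod_cast Real.pi_ne_zero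
    have hcj : (starRingEnd ℂ) τ ≠ 0 := by simpa using hτ0
    have hns : ((normSq τ : ℝ) : ℂ) = (starRingEnd ℂ) τ * τ := Complex.normSq_eq_conj_mul_self
    simp only [map_div₀, map_neg, map_one]
    push_cast
    rw [hns]
    set A := (-I * τ) ^ (1 / 2 : ℂ)
    have hA : 1 / A = A⁻¹ := one_div A
    rw [hA]
    set D := deriv (hermiteGauss k (-1 / τ)) s
    set H := hermiteGauss k (-1 / τ) s
    rw [pow_succ]
    have hII : I⁻¹ = -I := Complex.inv_I
    field_simp
    ring_nf

end OneVariable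

/-! ### The Poisson summation formula on `ℝ^ι` -/

section Poisson

open MeasureTheory

theorem norm_e_ofReal (x : ℝ) : ‖e (x : ℂ)‖ = 1 := by
  rw [e, show (2 * Real.pi * Complex.I * x : ℂ) = ((2 * Real.pi * x : ℝ) : ℂ) * Complex.I by
    push_cast; ring]
  exact Complex.norm_exp_ofReal_mul_I _

theorem e_add (x y : ℂ) : e (x + y) = e x * e y := by
  rw [e, e, e, ← Complex.exp_add]; congr 1; ring

theorem e_intCast (n : ℤ) : e (n : ℂ) = 1 := by
  rw [e, show (2 * Real.pi * Complex.I * n : ℂ) = n * (2 * Real.pi * Complex.I) by ring]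
  exact Complex.exp_int_mul_two_pi_mul_I n

theorem e_zero : e 0 = 1 := by simp [e]

theorem continuous_e : Continuous e := by unfold e; fun_prop

variable {ι : Type*}

/-- An integral vector, viewed as a real vector. -/
def intVec (n : ι → ℤ) : ι → ℝ := fun i => n i

theorem intVec_add (m n : ι → ℤ) : intVec (m + n) = intVec m + intVec n := by
  ext i; simp [intVec]

variable [Fintype ι]

/-- Continuous functions that decay sufficiently fast for Poisson summation. -/
structure RapidDecay (f : (ι → ℝ) → ℂ) : Prop where
  cont : Continuous f
  bound : ∃ C : ℝ, 0 ≤ C ∧ ∀ x, ‖f x‖ ≤ C * ((1 + ‖x‖) ^ (Fintype.card ι + 1))⁻¹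

/-- The standard lattice `ℤ^ι` in `ℝ^ι` is isomorphic to `ι → ℤ`. -/
noncomputable def stdLatticeEquiv (ι : Type*) [Fintype ι] :
    Submodule.span ℤ (Set.range (Pi.basisFun ℝ ι)) ≃ₗ[ℤ] (ι → ℤ) :=
  ((Pi.basisFun ℝ ι).restrictScalars ℤ).equivFun

theorem coe_stdLatticeEquiv_symm (n : ι → ℤ) : ((stdLatticeEquiv ι).symm n : ι → ℝ) = intVec n := by
  classical
  rw [stdLatticeEquiv, Module.Basis.equivFun_symm_apply]
  ext i
  simp [intVec, Module.Basis.restrictScalars_apply, Pi.single_apply]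

theorem summable_intVec :
    Summable fun n : ι → ℤ => ((1 + ‖intVec n‖) ^ (Fintype.card ι + 1))⁻¹ := by
  have h1 : Module.finrank ℤ (Submodule.span ℤ (Set.range (Pi.basisFun ℝ ι))) <
      Fintype.card ι + 1 := by
    rw [(stdLatticeEquiv ι).finrank_eq, Module.finrank_fintype_fun_eq_card]; omega
  have h := ZLattice.summable_norm_pow_inv _ _ h1
  rw [← (stdLatticeEquiv ι).symm.toEquiv.summable_iff] at h
  refine Summable.of_norm_bounded_eventually (g := _) h ?_
  -- Only `n = 0` escapes the comparison, since there the inverse of the norm is `0` by convention.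
  have hf : ({0} : Set (ι → ℤ)).Finite := Set.finite_singleton 0
  refine hf.subset fun n hn => ?_
  by_contra hne
  apply hn
  change ‖((1 + ‖intVec n‖) ^ (Fintype.card ι + 1))⁻¹‖ ≤
    ‖((stdLatticeEquiv ι).symm n : ι → ℝ)‖⁻¹ ^ (Fintype.card ι + 1)
  have h2 : ((stdLatticeEquiv ι).symm n : ι → ℝ) = intVec n := coe_stdLatticeEquiv_symm n
  have h0 : intVec n ≠ 0 := fun h0 => hne (by
    ext i; have := congrFun h0 i; simpa [intVec] using this)
  have h3 : 0 < ‖intVec n‖ := norm_pos_iff.2 h0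
  rw [h2, inv_pow, Real.norm_of_nonneg (by positivity)]
  gcongr
  linarith

namespace RapidDecay

variable {f g : (ι → ℝ) → ℂ}

theorem integrable (hf : RapidDecay f) : Integrable f := by
  obtain ⟨C, hC, h⟩ := hf.bound
  have h1 : Integrable (fun x : ι → ℝ => C * (1 + ‖x‖) ^ (-((Fintype.card ι : ℝ) + 1))) :=
    (integrable_one_add_norm (by simp)).const_mul _
  refine h1.mono' hf.cont.aestronglyMeasurable
    (Filter.Eventually.of_forall fun x => (h x).trans (le_of_eq ?_))
  rw [Real.rpow_neg (by positivity)]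
  congr 2
  exact_mod_cast (Real.rpow_natCast _ _).symm

theorem mul_bounded (hf : RapidDecay f) (hg : Continuous g) {D : ℝ} (h : ∀ x, ‖g x‖ ≤ D) :
    RapidDecay fun x => f x * g x := by
  obtain ⟨C, hC, hb⟩ := hf.bound
  have hD : 0 ≤ D := (norm_nonneg _).trans (h 0)
  refine ⟨hf.cont.mul hg, C * D, by positivity, fun x => ?_⟩
  rw [norm_mul, mul_right_comm]
  exact mul_le_mul (hb x) (h x) (norm_nonneg _) (by positivity)

theorem comp_add (hf : RapidDecay f) (v : ι → ℝ) : RapidDecay fun x => f (x + v) := by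
  obtain ⟨C, hC, hb⟩ := hf.bound
  refine ⟨hf.cont.comp (continuous_id.add continuous_const),
    C * (1 + ‖v‖) ^ (Fintype.card ι + 1), by positivity, fun x => (hb _).trans ?_⟩
  rw [mul_assoc]
  gcongr
  rw [← div_eq_mul_inv, inv_le_comm₀ (by positivity) (by positivity), inv_div, ← div_pow]
  gcongr
  rw [div_le_iff₀ (by positivity)]
  have : ‖x‖ ≤ ‖x + v‖ + ‖v‖ := by
    simpa using norm_sub_le (x + v) v
  nlinarith [norm_nonneg (x + v), norm_nonneg v, mul_nonneg (norm_nonneg (x + v)) (norm_nonneg v)]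

theorem comp_linearEquiv (hf : RapidDecay f) (A : (ι → ℝ) ≃ₗ[ℝ] (ι → ℝ)) :
    RapidDecay fun x => f (A x) := by
  obtain ⟨C, hC, hb⟩ := hf.bound
  set K : ℝ := ‖LinearMap.toContinuousLinearMap (A.symm : (ι → ℝ) →ₗ[ℝ] (ι → ℝ))‖ + 1
  have hK : 1 ≤ K := by simp [K]
  refine ⟨hf.cont.comp (LinearMap.continuous_of_finiteDimensional (A : (ι → ℝ) →ₗ[ℝ] (ι → ℝ))),
    C * K ^ (Fintype.card ι + 1), by positivity, fun x => (hb _).trans ?_⟩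
  rw [mul_assoc]
  gcongr
  rw [← div_eq_mul_inv, inv_le_comm₀ (by positivity) (by positivity), inv_div, ← div_pow]
  gcongr
  rw [div_le_iff₀ (by positivity)]
  have : ‖x‖ ≤ (K - 1) * ‖A x‖ := by
    have := (LinearMap.toContinuousLinearMap (A.symm : (ι → ℝ) →ₗ[ℝ] (ι → ℝ))).le_opNorm (A x)
    simpa [K] using this
  nlinarith [norm_nonneg (A x)]

theorem add (hf : RapidDecay f) (hg : RapidDecay g) : RapidDecay fun x => f x + g x := by
  obtain ⟨C, hC, hb⟩ := hf.bound
  obtain ⟨D, hD, hb'⟩ := hg.bound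
  refine ⟨hf.cont.add hg.cont, C + D, by positivity, fun x => ?_⟩
  rw [add_mul]
  exact (norm_add_le _ _).trans (add_le_add (hb x) (hb' x))

theorem const_mul (hf : RapidDecay f) (a : ℂ) : RapidDecay fun x => a * f x := by
  simpa only [mul_comm a] using hf.mul_bounded (g := fun _ => a) continuous_const fun _ => le_rfl

theorem summable (hf : RapidDecay f) : Summable fun n : ι → ℤ => f (intVec n) := by
  obtain ⟨C, hC, hb⟩ := hf.bound
  exact Summable.of_norm_bounded (summable_intVec.mul_left C) fun n => hb _

/-- Translates of `f` by integral vectors are dominated by a summable sequence, locally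
uniformly. -/
theorem exists_summable_bound (hf : RapidDecay f) (R : ℝ) :
    ∃ u : (ι → ℤ) → ℝ, Summable u ∧ ∀ n, ∀ x : ι → ℝ, ‖x‖ ≤ R → ‖f (x + intVec n)‖ ≤ u n := by
  obtain ⟨C, hC, hb⟩ := hf.bound
  rcases lt_or_ge R 0 with hR | hR
  · exact ⟨0, summable_zero, fun n x hx => absurd (norm_nonneg x) (by linarith)⟩
  refine ⟨_, summable_intVec.mul_left (C * (1 + R) ^ (Fintype.card ι + 1)), fun n x hx =>
    (hb _).trans ?_⟩
  rw [mul_assoc]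
  gcongr
  rw [← div_eq_mul_inv, inv_le_comm₀ (by positivity) (by positivity), inv_div, ← div_pow]
  gcongr
  rw [div_le_iff₀ (by positivity)]
  have : ‖intVec n‖ ≤ ‖x + intVec n‖ + ‖x‖ := by
    simpa using norm_sub_le (x + intVec n) x
  nlinarith [norm_nonneg (x + intVec n), norm_nonneg x,
    mul_nonneg (norm_nonneg (x + intVec n)) hR]

theorem continuous_periodization (hf : RapidDecay f) :
    Continuous fun x : ι → ℝ => ∑' n : ι → ℤ, f (x + intVec n) := by
  rw [continuous_iff_continuousAt]
  intro x
  obtain ⟨u, hu, h⟩ := hf.exists_summable_bound (‖x‖ + 1)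
  have h1 : ContinuousOn (fun x : ι → ℝ => ∑' n : ι → ℤ, f (x + intVec n))
      (Metric.closedBall 0 (‖x‖ + 1)) :=
    continuousOn_tsum (fun n => (hf.cont.comp (continuous_id.add continuous_const)).continuousOn)
      hu fun n x hx => h n x (by simpa using hx)
  refine h1.continuousAt (Filter.mem_of_superset (Metric.ball_mem_nhds x one_pos) ?_)
  intro y hy
  have h2 : ‖y - x‖ < 1 := by simpa [dist_eq_norm] using hy
  have h3 : ‖y‖ ≤ ‖x‖ + ‖y - x‖ := by simpa using norm_add_le x (y - x)
  simpa using (by linarith : ‖y‖ ≤ ‖x‖ + 1)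

end RapidDecay

theorem measurableSet_unitBox :
    MeasurableSet {x : ι → ℝ | ∀ i, x i ∈ Set.Ioc (0 : ℝ) (0 + 1)} :=
  MeasurableSet.univ_pi' fun _ => measurableSet_Ioc

theorem volume_unitBox : volume {x : ι → ℝ | ∀ i, x i ∈ Set.Ioc (0 : ℝ) (0 + 1)} = 1 := by
  have : {x : ι → ℝ | ∀ i, x i ∈ Set.Ioc (0 : ℝ) (0 + 1)} =
      Set.pi Set.univ fun _ => Set.Ioc (0 : ℝ) (0 + 1) := by ext; simp
  rw [this, Real.volume_pi_Ioc]; simp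

theorem norm_le_one_of_mem_unitBox {x : ι → ℝ}
    (hx : x ∈ {x : ι → ℝ | ∀ i, x i ∈ Set.Ioc (0 : ℝ) (0 + 1)}) : ‖x‖ ≤ 1 := by
  refine (pi_norm_le_iff_of_nonneg zero_le_one).2 fun i => ?_
  have := hx i
  rw [Set.mem_Ioc] at this
  rw [Real.norm_eq_abs, abs_le]; constructor <;> linarith

/-- Unfolding: `ℝ^ι` is tiled by the integral translates of a unit box, and the locally uniform
summable bound permits exchanging sum and integral. -/
theorem RapidDecay.integral_eq_tsum {f : (ι → ℝ) → ℂ} (hf : RapidDecay f) :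
    ∫ x, f x = ∫ x in {x : ι → ℝ | ∀ i, x i ∈ Set.Ioc (0 : ℝ) (0 + 1)},
      ∑' n : ι → ℤ, f (x + intVec n) := by
  have hfin : IsFiniteMeasure (volume.restrict
      {x : ι → ℝ | ∀ i, x i ∈ Set.Ioc (0 : ℝ) (0 + 1)}) :=
    ⟨by rw [Measure.restrict_apply_univ, volume_unitBox]; simp⟩
  obtain ⟨u, hu, h⟩ := hf.exists_summable_bound 1
  have hae : ∀ n : ι → ℤ, ∀ᵐ x ∂(volume.restrict
      {x : ι → ℝ | ∀ i, x i ∈ Set.Ioc (0 : ℝ) (0 + 1)}), ‖f (x + intVec n)‖ ≤ u n := fun n =>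
    (ae_restrict_iff' measurableSet_unitBox).2 (Filter.Eventually.of_forall fun x hx =>
      h n x (norm_le_one_of_mem_unitBox hx))
  have hint : ∀ n : ι → ℤ, Integrable (fun x => f (x + intVec n)) (volume.restrict
      {x : ι → ℝ | ∀ i, x i ∈ Set.Ioc (0 : ℝ) (0 + 1)}) := fun n =>
    (hf.comp_add _).integrable.restrict
  have hS : Summable fun n : ι → ℤ => ∫ x in {x : ι → ℝ | ∀ i, x i ∈ Set.Ioc (0 : ℝ) (0 + 1)},
      ‖f (x + intVec n)‖ := by
    refine Summable.of_nonneg_of_le (fun n => integral_nonneg fun _ => norm_nonneg _)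
      (fun n => ?_) hu
    refine (integral_mono_ae (hint n).norm (integrable_const _) (hae n)).trans (le_of_eq ?_)
    rw [integral_const, measureReal_restrict_apply MeasurableSet.univ, Set.univ_inter,
      measureReal_def, volume_unitBox]
    simp
  rw [← (hasSum_integral_of_summable_integral_norm hint hS).tsum_eq]
  have hinv : VAddInvariantMeasure (Submodule.span ℤ (Set.range (Pi.basisFun ℝ ι))) (ι → ℝ)
      volume := ⟨fun c s _ => measure_preimage_add volume (c : ι → ℝ) s⟩
  rw [(ZSpan.isAddFundamentalDomain (Pi.basisFun ℝ ι) volume).integral_eq_tsum'' f hf.integrable]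
  rw [← (stdLatticeEquiv ι).symm.toEquiv.tsum_eq]
  refine tsum_congr fun n => ?_
  -- The fundamental domain of the lattice is the box `[0,1)^ι`, whereas Fourier coefficients on the
  -- torus are integrals over `(0,1]^ι`; the two differ by a null set.
  have hset : (ZSpan.fundamentalDomain (Pi.basisFun ℝ ι)) =ᵐ[volume]
      {x : ι → ℝ | ∀ i, x i ∈ Set.Ioc (0 : ℝ) (0 + 1)} := by
    have h1 : ZSpan.fundamentalDomain (Pi.basisFun ℝ ι) =
        Set.pi Set.univ fun i : ι => Set.Ico ((0 : ι → ℝ) i) ((1 : ι → ℝ) i) := by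
      ext; simp [ZSpan.mem_fundamentalDomain]
    have h2 : {x : ι → ℝ | ∀ i, x i ∈ Set.Ioc (0 : ℝ) (0 + 1)} =
        Set.pi Set.univ fun i : ι => Set.Ioc ((0 : ι → ℝ) i) ((1 : ι → ℝ) i) := by ext; simp
    rw [h1, h2]
    exact Measure.univ_pi_Ico_ae_eq_Icc.trans Measure.univ_pi_Ioc_ae_eq_Icc.symm
  rw [setIntegral_congr_set hset]
  congr 1
  funext x
  rw [add_comm, ← coe_stdLatticeEquiv_symm]
  rfl

theorem mFourier_coe_apply (m : ι → ℤ) (x : ι → ℝ) :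
    UnitAddTorus.mFourier m (fun i => (x i : UnitAddCircle)) =
      e ((∑ i, (m i : ℝ) * x i : ℝ) : ℂ) := by
  simp only [UnitAddTorus.mFourier, ContinuousMap.coe_mk, fourier_coe_apply, e]
  rw [← Complex.exp_sum]
  congr 1
  push_cast
  rw [Finset.mul_sum]
  exact Finset.sum_congr rfl fun i _ => by simp; ring

theorem e_dot_intVec (m : ι → ℤ) (x : ι → ℝ) (n : ι → ℤ) :
    e ((-(∑ i, (m i : ℝ) * (x + intVec n) i) : ℝ) : ℂ) =
      e ((-(∑ i, (m i : ℝ) * x i) : ℝ) : ℂ) := by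
  have : ((-(∑ i, (m i : ℝ) * (x + intVec n) i) : ℝ) : ℂ) =
      ((-(∑ i, (m i : ℝ) * x i) : ℝ) : ℂ) + ((-∑ i, m i * n i : ℤ) : ℂ) := by
    push_cast
    simp only [Pi.add_apply, intVec]
    push_cast
    simp only [mul_add, Finset.sum_add_distrib]
    ring
  rw [this, e_add, e_intCast, mul_one]

theorem continuous_dot (m : ι → ℝ) : Continuous fun x : ι → ℝ => ∑ i, m i * x i := by fun_prop

/-- The Poisson summation formula for the lattice `ℤ^ι`. -/
theorem RapidDecay.poisson {f : (ι → ℝ) → ℂ} (hf : RapidDecay f)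
    (hs : Summable fun m : ι → ℤ => ∫ x, f x * e ((-(∑ i, (m i : ℝ) * x i) : ℝ) : ℂ)) :
    ∑' n : ι → ℤ, f (intVec n) =
      ∑' m : ι → ℤ, ∫ x, f x * e ((-(∑ i, (m i : ℝ) * x i) : ℝ) : ℂ) := by
  set q : (ι → ℝ) → UnitAddTorus ι := fun x i => (x i : UnitAddCircle) with hq
  have hopen : IsOpenQuotientMap q := IsOpenQuotientMap.piMap fun _ =>
    (QuotientAddGroup.isOpenQuotientMap_mk : IsOpenQuotientMap ((↑) : ℝ → UnitAddCircle))
  set F : (ι → ℝ) → ℂ := fun x => ∑' n : ι → ℤ, f (x + intVec n) with hF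
  -- The periodization `F` is invariant under integral translations, so it descends to a continuous
  -- function `G` on the torus.
  have hper : ∀ x y, q x = q y → F x = F y := by
    intro x y hxy
    have h1 : ∀ i, ∃ k : ℤ, y i = x i + k := fun i => by
      have := congrFun hxy i
      simp only [hq] at this
      have h0 : ((y i - x i : ℝ) : UnitAddCircle) = 0 := by rw [AddCircle.coe_sub, this, sub_self]
      obtain ⟨k, hk⟩ := AddCircle.coe_eq_zero_iff (1 : ℝ) |>.1 h0
      exact ⟨k, by simp at hk; linarith⟩
    choose k hk using h1
    have h2 : y = x + intVec k := by ext i; simp [hk, intVec]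
    rw [h2, hF]
    simp only
    rw [← (Equiv.addLeft k).tsum_eq]
    refine tsum_congr fun n => ?_
    rw [Equiv.coe_addLeft, intVec_add, add_assoc]
  set qc : C(ι → ℝ, UnitAddTorus ι) := ⟨q, hopen.continuous⟩
  have hquot : Topology.IsQuotientMap qc := hopen.isQuotientMap
  have hper' : Function.FactorsThrough (⟨F, hf.continuous_periodization⟩ : C(ι → ℝ, ℂ)) qc :=
    fun x y hxy => hper x y hxy
  set G : C(UnitAddTorus ι, ℂ) := hquot.lift ⟨F, hf.continuous_periodization⟩ hper' with hG
  have hGq : ∀ x, G (q x) = F x := fun x =>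
    congrArg (fun φ : C(ι → ℝ, ℂ) => φ x)
      (hquot.lift_comp ⟨F, hf.continuous_periodization⟩ hper')
  -- Multiplying by a character, which is itself periodic, and unfolding turns the Fourier
  -- coefficients of `G` into values of the Fourier transform of `f`.
  have hcoeff : ∀ m : ι → ℤ, UnitAddTorus.mFourierCoeff G m =
      ∫ x, f x * e ((-(∑ i, (m i : ℝ) * x i) : ℝ) : ℂ) := by
    intro m
    have hfe : RapidDecay fun x => f x * e ((-(∑ i, (m i : ℝ) * x i) : ℝ) : ℂ) :=
      hf.mul_bounded (continuous_e.comp (Complex.continuous_ofReal.comp (continuous_dot _).neg))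
        (D := 1) fun x => (norm_e_ofReal _).le
    rw [UnitAddTorus.mFourierCoeff_eq_integral G m 0, hfe.integral_eq_tsum]
    refine setIntegral_congr_fun measurableSet_unitBox fun x _ => ?_
    have h1 : G (fun i => (x i : UnitAddCircle)) = F x := hGq x
    simp only [h1, smul_eq_mul, mFourier_coe_apply, e_dot_intVec]
    rw [tsum_mul_right, mul_comm]
    congr 2
    push_cast
    simp only [Pi.neg_apply, Int.cast_neg, neg_mul, Finset.sum_neg_distrib]
  -- A continuous function with summable Fourier coefficients equals its Fourier series at every
  -- point; at the origin this is the Poisson formula.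
  have h := UnitAddTorus.hasSum_mFourier_series_apply_of_summable (f := G)
    (by rw [funext hcoeff]; exact hs) (q 0)
  rw [hGq] at h
  have h2 := h.tsum_eq
  simp only [hcoeff] at h2
  have h3 : F 0 = ∑' n : ι → ℤ, f (intVec n) := by simp only [hF, zero_add]
  rw [← h3, ← h2]
  refine tsum_congr fun m => ?_
  rw [hq, mFourier_coe_apply]
  simp [e_zero]

-- The characters of the torus are orthonormal with respect to normalised Haar measure.
noncomputable local instance : MeasureSpace UnitAddCircle := ⟨AddCircle.haarAddCircle⟩

local instance : IsProbabilityMeasure (volume : Measure UnitAddCircle) :=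
  inferInstanceAs (IsProbabilityMeasure AddCircle.haarAddCircle)

/-- An absolutely convergent Fourier series that vanishes identically has zero coefficients. -/
theorem eq_zero_of_tsum_mul_e_eq_zero {a : (ι → ℤ) → ℂ} (ha : Summable a)
    (h : ∀ t : ι → ℝ, ∑' m : ι → ℤ, a m * e ((∑ i, (m i : ℝ) * t i : ℝ) : ℂ) = 0) : a = 0 := by
  -- Characters have sup norm one, so the series converges uniformly. Its sum is then zero in the
  -- space of continuous functions, and pairing in `L²` with the character of index `m` isolates `a
  -- m`.
  have hS : Summable fun m : ι → ℤ => a m • UnitAddTorus.mFourier (d := ι) m := by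
    refine Summable.of_norm ?_
    simpa only [norm_smul, UnitAddTorus.mFourier_norm, mul_one] using ha.norm
  have h0 : ∑' m : ι → ℤ, a m • UnitAddTorus.mFourier (d := ι) m = 0 := by
    ext x
    obtain ⟨t, rfl⟩ : ∃ t : ι → ℝ, (fun i => (t i : UnitAddCircle)) = x := by
      choose t ht using fun i => QuotientAddGroup.mk_surjective (x i)
      exact ⟨t, funext ht⟩
    rw [← ContinuousMap.tsum_apply hS]
    simpa [mFourier_coe_apply] using h t
  have hsum : HasSum (fun m : ι → ℤ => a m • UnitAddTorus.mFourier (d := ι) m) 0 := h0 ▸ hS.hasSum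
  have hon := UnitAddTorus.orthonormal_mFourier (d := ι)
  have h1 := (ContinuousMap.toLp (E := ℂ) 2 (volume : Measure (UnitAddTorus ι)) ℂ).hasSum hsum
  funext m
  have h2 := (innerSL ℂ (UnitAddTorus.mFourierLp 2 m)).hasSum h1
  classical
  simp only [map_smul, map_zero, innerSL_apply_apply] at h2
  have h3 := hasSum_ite_eq m (a m)
  refine h3.unique (h2.congr_fun fun n => ?_)
  have := (orthonormal_iff_ite.1 hon) m n
  simp only [UnitAddTorus.mFourierLp] at this
  rw [this]
  by_cases hn : n = m
  · simp [hn]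
  · simp [hn, Ne.symm hn]

end Poisson

/-! ### The heat flow on polynomials -/

section Heat

open MvPolynomial

variable {ι : Type*} [Fintype ι]

/-- The Laplacian `∑ ∂_i²` on polynomials. -/
noncomputable def polyLaplacian (ι : Type*) [Fintype ι] :
    MvPolynomial ι ℂ →ₗ[ℂ] MvPolynomial ι ℂ :=
  ∑ i : ι, ((pderiv i : Derivation ℂ _ _) : MvPolynomial ι ℂ →ₗ[ℂ] MvPolynomial ι ℂ) ∘ₗ
    ((pderiv i : Derivation ℂ _ _) : MvPolynomial ι ℂ →ₗ[ℂ] MvPolynomial ι ℂ)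

theorem polyLaplacian_apply (q : MvPolynomial ι ℂ) :
    polyLaplacian ι q = ∑ i, pderiv i (pderiv i q) := by
  simp [polyLaplacian]

theorem pderiv_comm {σ : Type*} (i j : σ) (q : MvPolynomial σ ℂ) :
    pderiv i (pderiv j q) = pderiv j (pderiv i q) := by
  classical
  have h : ⁅(pderiv i : Derivation ℂ (MvPolynomial σ ℂ) (MvPolynomial σ ℂ)),
      (pderiv j : Derivation ℂ (MvPolynomial σ ℂ) (MvPolynomial σ ℂ))⁆ = 0 := by
    refine MvPolynomial.derivation_ext fun k => ?_
    rw [Derivation.commutator_apply, pderiv_X, pderiv_X]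
    simp only [Pi.single_apply]
    split_ifs <;> simp
  have h2 := congrArg (fun D => D q) h
  rw [Derivation.commutator_apply] at h2
  exact sub_eq_zero.1 h2

theorem pderiv_polyLaplacian (i : ι) (q : MvPolynomial ι ℂ) :
    pderiv i (polyLaplacian ι q) = polyLaplacian ι (pderiv i q) := by
  rw [polyLaplacian_apply, polyLaplacian_apply, map_sum]
  exact Finset.sum_congr rfl fun j _ => by rw [pderiv_comm i j, pderiv_comm i j]

theorem polyLaplacian_mul_X (i : ι) (q : MvPolynomial ι ℂ) :
    polyLaplacian ι (q * X i) = polyLaplacian ι q * X i + 2 * pderiv i q := by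
  classical
  rw [polyLaplacian_apply, polyLaplacian_apply, Finset.sum_mul]
  have h : ∀ j, pderiv j (pderiv j (q * X i)) =
      pderiv j (pderiv j q) * X i + if j = i then 2 * pderiv i q else 0 := fun j => by
    by_cases hj : j = i
    · subst hj; simp only [pderiv_mul, map_add, pderiv_X_self, if_true, mul_one]; ring
    · simp [pderiv_X_of_ne (Ne.symm hj), hj, mul_comm]
  simp only [h, Finset.sum_add_distrib, Finset.sum_ite_eq', Finset.mem_univ, if_true]

/-- Since `[Δ, x_i] = 2∂_i` commutes with `Δ`, the commutator of a power is computed as for a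
derivation: `[Δ^n, x_i] = 2n ∂_i Δ^(n-1)`. -/
theorem polyLaplacian_pow_mul_X (i : ι) (j : ℕ) (q : MvPolynomial ι ℂ) :
    (polyLaplacian ι ^ (j + 1)) (q * X i) = (polyLaplacian ι ^ (j + 1)) q * X i +
      (2 * (j + 1) : ℂ) • pderiv i ((polyLaplacian ι ^ j) q) := by
  induction j with
  | zero =>
    have h2 : (C 2 : MvPolynomial ι ℂ) = 2 := map_ofNat C 2
    simp [polyLaplacian_mul_X, MvPolynomial.smul_eq_C_mul, h2]
  | succ j ih =>
    rw [pow_succ' _ (j + 1), Module.End.mul_apply, ih, map_add, polyLaplacian_mul_X, map_smul,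
      ← pderiv_polyLaplacian, Module.End.mul_apply, ← Module.End.mul_apply _ (_ ^ j), ← pow_succ',
      add_assoc]
    congr 1
    simp only [MvPolynomial.smul_eq_C_mul]
    push_cast
    simp only [map_mul, map_add, map_natCast, map_one, map_ofNat]
    ring

/-- The polynomial `e^{cΔ} x^k`. -/
noncomputable def heatMonomial (c : ℂ) (k : ι →₀ ℕ) : MvPolynomial ι ℂ :=
  ∏ i, Polynomial.aeval (X i) (heatPoly c (k i))

/-- The operator `e^{cΔ}` on polynomials. -/
noncomputable def heat (ι : Type*) [Fintype ι] (c : ℂ) :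
    MvPolynomial ι ℂ →ₗ[ℂ] MvPolynomial ι ℂ :=
  (basisMonomials ι ℂ).constr ℂ (heatMonomial c)

theorem heat_monomial (c : ℂ) (k : ι →₀ ℕ) (a : ℂ) :
    heat ι c (monomial k a) = a • heatMonomial c k := by
  have h : monomial k a = a • (basisMonomials ι ℂ k) := by
    rw [coe_basisMonomials, smul_monomial, smul_eq_mul, mul_one]
  rw [h, map_smul, heat, Module.Basis.constr_basis]

theorem heat_C (c a : ℂ) : heat ι c (C a) = C a := by
  rw [C_apply, heat_monomial]
  simp [heatMonomial, heatPoly, MvPolynomial.smul_eq_C_mul]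

theorem heatMonomial_add_single (c : ℂ) (k : ι →₀ ℕ) (i : ι) :
    heatMonomial c (k + Finsupp.single i 1) =
      heatMonomial c k * X i + (2 * c) • pderiv i (heatMonomial c k) := by
  classical
  have h0 : pderiv i (∏ j ∈ Finset.univ.erase i,
      Polynomial.aeval (X j : MvPolynomial ι ℂ) (heatPoly c (k j))) = 0 := by
    refine Finset.prod_induction _ (fun f : MvPolynomial ι ℂ => pderiv i f = 0) ?_ (by simp) ?_
    · intro a b ha hb
      rw [pderiv_mul, ha, hb]; simp
    · intro j hj
      rw [Derivation.map_aeval, pderiv_X_of_ne (Finset.ne_of_mem_erase hj), smul_zero]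
  have h1 : heatMonomial c k = Polynomial.aeval (X i) (heatPoly c (k i)) *
      ∏ j ∈ Finset.univ.erase i, Polynomial.aeval (X j) (heatPoly c (k j)) :=
    (Finset.mul_prod_erase _ _ (Finset.mem_univ i)).symm
  have h2 : heatMonomial c (k + Finsupp.single i 1) =
      Polynomial.aeval (X i) (heatPoly c (k i + 1)) *
        ∏ j ∈ Finset.univ.erase i, Polynomial.aeval (X j) (heatPoly c (k j)) := by
    rw [heatMonomial, ← Finset.mul_prod_erase _ _ (Finset.mem_univ i)]
    congr 1
    · simp
    · refine Finset.prod_congr rfl fun j hj => ?_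
      simp [(Finset.ne_of_mem_erase hj).symm]
  rw [h2, h1, pderiv_mul, h0, Derivation.map_aeval, pderiv_X_self, heatPoly]
  simp only [map_add, map_mul, Polynomial.aeval_X, Polynomial.aeval_C, smul_eq_mul, mul_one,
    mul_zero, add_zero, MvPolynomial.smul_eq_C_mul, MvPolynomial.algebraMap_eq]
  ring

/-- The commutator relation `[e^{cΔ}, x_i] = 2c ∂_i e^{cΔ}`. Together with the action on constants
it determines the operator, which is how the product of one-variable polynomials is identified with
the exponential series. -/
theorem heat_mul_X (c : ℂ) (q : MvPolynomial ι ℂ) (i : ι) :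
    heat ι c (q * X i) = heat ι c q * X i + (2 * c) • pderiv i (heat ι c q) := by
  induction q using MvPolynomial.induction_on' with
  | monomial k a =>
    rw [X, monomial_mul, mul_one, heat_monomial, heat_monomial, heatMonomial_add_single]
    simp only [smul_add, X, smul_mul_assoc]
    rw [Derivation.map_smul, smul_comm]
  | add p q hp hq =>
    rw [add_mul, map_add, hp, hq, map_add, map_add, add_mul, smul_add]; abel

/-- The operator `heat` is given by the exponential series of the Laplacian, which terminates. -/
theorem exists_heat_eq_sum (q : MvPolynomial ι ℂ) : ∃ N : ℕ,
    (∀ j, N ≤ j → (polyLaplacian ι ^ j) q = 0) ∧ ∀ c : ℂ,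
    heat ι c q = ∑ j ∈ Finset.range N, (c ^ j / (j.factorial : ℂ)) • (polyLaplacian ι ^ j) q := by
  -- Allowing every truncation from `N` on lets the induction align sums of different lengths.
  suffices H : ∃ N : ℕ, (∀ j, N ≤ j → (polyLaplacian ι ^ j) q = 0) ∧ ∀ c : ℂ, ∀ n, N ≤ n →
      heat ι c q = ∑ j ∈ Finset.range n, (c ^ j / (j.factorial : ℂ)) • (polyLaplacian ι ^ j) q by
    obtain ⟨N, h1, h2⟩ := H
    exact ⟨N, h1, fun c => h2 c N le_rfl⟩
  induction q using MvPolynomial.induction_on with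
  | C a =>
    have hz : ∀ j, 1 ≤ j → (polyLaplacian ι ^ j) (C a : MvPolynomial ι ℂ) = 0 := fun j hj => by
      obtain ⟨j, rfl⟩ := Nat.exists_eq_add_of_le' hj
      rw [pow_succ, Module.End.mul_apply, polyLaplacian_apply]; simp
    refine ⟨1, hz, fun c n hn => ?_⟩
    obtain ⟨n, rfl⟩ := Nat.exists_eq_add_of_le' hn
    rw [Finset.sum_range_succ', Finset.sum_eq_zero fun j _ => by rw [hz _ (by omega), smul_zero]]
    simp [heat_C]
  | add p q hp hq =>
    obtain ⟨N, h1, h2⟩ := hp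
    obtain ⟨N', h1', h2'⟩ := hq
    refine ⟨max N N', fun j hj => ?_, fun c n hn => ?_⟩
    · rw [map_add, h1 j (by omega), h1' j (by omega), add_zero]
    · rw [map_add, h2 c n (by omega), h2' c n (by omega), ← Finset.sum_add_distrib]
      simp
  | mul_X p i hp =>
    obtain ⟨N, h1, h2⟩ := hp
    refine ⟨N + 1, fun j hj => ?_, fun c n hn => ?_⟩
    · obtain ⟨j, rfl⟩ := Nat.exists_eq_add_of_le' (show 1 ≤ j by omega)
      rw [polyLaplacian_pow_mul_X, h1 _ (by omega), h1 _ (by omega)]; simp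
    · obtain ⟨n, rfl⟩ := Nat.exists_eq_add_of_le' (show 1 ≤ n by omega)
      rw [heat_mul_X]
      -- The term multiplied by `X i` is truncated one place later than the term carrying `pderiv
      -- i`, because the commutator with `Δ^(j+1)` involves only `Δ^j`.
      nth_rewrite 1 [h2 c (n + 1) (by omega)]
      rw [h2 c n (by omega), Finset.sum_range_succ', Finset.sum_range_succ', add_mul,
        Finset.sum_mul, map_sum, Finset.smul_sum, add_right_comm, ← Finset.sum_add_distrib]
      congr 1
      · refine Finset.sum_congr rfl fun j _ => ?_
        rw [polyLaplacian_pow_mul_X, smul_add, smul_mul_assoc, Derivation.map_smul, smul_smul,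
          smul_smul]
        congr 2
        rw [Nat.factorial_succ]
        have : (j.factorial : ℂ) ≠ 0 := by exact_mod_cast j.factorial_ne_zero
        have : ((j : ℂ) + 1) ≠ 0 := by exact_mod_cast j.succ_ne_zero
        push_cast
        field_simp
        ring
      · simp

theorem heatMonomial_mapDomain {κ : Type*} [Fintype κ] (f : κ → ι) (hf : Function.Injective f)
    (k : κ →₀ ℕ) (c : ℂ) :
    heatMonomial c (k.mapDomain f) = rename f (heatMonomial c k) := by
  classical
  rw [heatMonomial, heatMonomial, map_prod]
  have h : ∀ i, i ∉ Finset.univ.image f →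
      Polynomial.aeval (X i : MvPolynomial ι ℂ) (heatPoly c (k.mapDomain f i)) = 1 := fun i hi => by
    rw [Finsupp.mapDomain_of_notMem_range _ _ (by simpa using hi)]
    simp [heatPoly]
  rw [← Finset.prod_subset (Finset.subset_univ (Finset.univ.image f)) fun i _ hi => h i hi,
    Finset.prod_image fun a _ b _ hab => hf hab]
  refine Finset.prod_congr rfl fun i _ => ?_
  rw [Finsupp.mapDomain_apply hf, ← rename_X (R := ℂ) f i]
  exact Polynomial.aeval_algHom_apply (rename f : MvPolynomial κ ℂ →ₐ[ℂ] MvPolynomial ι ℂ) (X i) _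

/-- The heat operator does nothing in variables that are absent from the polynomial. A polynomial on
`M_ℝ^⊥` may therefore be regarded as one on the whole space. -/
theorem heat_rename {κ : Type*} [Fintype κ] (f : κ → ι) (hf : Function.Injective f) (c : ℂ)
    (q : MvPolynomial κ ℂ) : heat ι c (rename f q) = rename f (heat κ c q) := by
  induction q using MvPolynomial.induction_on' with
  | monomial k a =>
    rw [rename_monomial, heat_monomial, heat_monomial, heatMonomial_mapDomain f hf, map_smul]
  | add p q hp hq => simp only [map_add, hp, hq]

end Heat

/-! ### The Fourier transform of polynomials times Gaussians -/

section Gaussian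

open MeasureTheory Complex

variable {ι : Type*} [Fintype ι]

/-- The quadratic form `∑ ε_i x_i²` in polarized form. -/
def signForm (ε : ι → ℝ) (x y : ι → ℝ) : ℝ := ∑ i, ε i * x i * y i

theorem signForm_add_left (ε x y z : ι → ℝ) :
    signForm ε (x + y) z = signForm ε x z + signForm ε y z := by
  simp [signForm, mul_add, add_mul, Finset.sum_add_distrib]

theorem signForm_comm (ε x y : ι → ℝ) : signForm ε x y = signForm ε y x :=
  Finset.sum_congr rfl fun i _ => by ring

theorem signForm_add_right (ε x y z : ι → ℝ) :
    signForm ε x (y + z) = signForm ε x y + signForm ε x z := by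
  rw [signForm_comm, signForm_add_left, signForm_comm ε y, signForm_comm ε z]

theorem signForm_neg_left (ε x y : ι → ℝ) : signForm ε (-x) y = -signForm ε x y := by
  simp [signForm]

theorem signForm_neg_right (ε x y : ι → ℝ) : signForm ε x (-y) = -signForm ε x y := by
  simp [signForm]

theorem signForm_smul_left (ε x y : ι → ℝ) (t : ℝ) :
    signForm ε (t • x) y = t * signForm ε x y := by
  simp only [signForm, Finset.mul_sum, Pi.smul_apply, smul_eq_mul]
  exact Finset.sum_congr rfl fun i _ => by ring

theorem continuous_signForm (ε s : ι → ℝ) : Continuous (signForm ε s) := by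
  unfold signForm; fun_prop

/-- The number of positive signs. -/
noncomputable def posCount (ε : ι → ℝ) : ℕ := (Finset.univ.filter fun i => 0 < ε i).card

/-- The number of negative signs. -/
noncomputable def negCount (ε : ι → ℝ) : ℕ := (Finset.univ.filter fun i => ¬ 0 < ε i).card

/-- The parameter `τ` or `-τ̄`, depending on the sign. -/
noncomputable def signParam (s : ℝ) (τ : ℂ) : ℂ := if 0 < s then τ else -(starRingEnd ℂ) τ

theorem im_signParam (s : ℝ) (τ : ℂ) : (signParam s τ).im = τ.im := by
  unfold signParam; split_ifs <;> simp

/-- Passing from `τ` to `-τ̄` preserves `y`, so one heat time serves the variables of both signs. -/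
theorem heatTime_signParam (s : ℝ) (τ : ℂ) : heatTime (signParam s τ) = heatTime τ := by
  rw [heatTime, heatTime, im_signParam]

theorem signParam_neg_one_div (s : ℝ) (τ : ℂ) : signParam s (-1 / τ) = -1 / signParam s τ := by
  unfold signParam; split_ifs
  · rfl
  · simp [div_neg]

/-- The function `(e^{-Δ/(8πy)} q)(x) 𝐞(τ x₊²/2 + τ̄ x₋²/2)`. -/
noncomputable def polyGaussian (ε : ι → ℝ) (q : MvPolynomial ι ℂ) (τ : ℂ) (x : ι → ℝ) : ℂ :=
  MvPolynomial.eval (fun i => (x i : ℂ)) (heat ι (heatTime τ) q) *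
    ∏ i, cexp (Real.pi * I * signParam (ε i) τ * x i ^ 2)

theorem polyGaussian_add (ε : ι → ℝ) (q r : MvPolynomial ι ℂ) (τ : ℂ) (x : ι → ℝ) :
    polyGaussian ε (q + r) τ x = polyGaussian ε q τ x + polyGaussian ε r τ x := by
  simp [polyGaussian, add_mul]

theorem polyGaussian_monomial (ε : ι → ℝ) (k : ι →₀ ℕ) (a : ℂ) (τ : ℂ) (x : ι → ℝ) :
    polyGaussian ε (MvPolynomial.monomial k a) τ x =
      a * ∏ i, hermiteGauss (k i) (signParam (ε i) τ) (x i) := by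
  rw [polyGaussian, heat_monomial, MvPolynomial.smul_eval, mul_assoc, heatMonomial, map_prod,
    ← Finset.prod_mul_distrib]
  congr 1
  refine Finset.prod_congr rfl fun i _ => ?_
  rw [hermiteGauss, polyGauss, heatTime_signParam]
  congr 1
  have := Polynomial.aeval_algHom_apply (MvPolynomial.aeval fun i => (x i : ℂ))
    (MvPolynomial.X i : MvPolynomial ι ℂ) (heatPoly (heatTime τ) (k i))
  rw [MvPolynomial.aeval_X, Polynomial.coe_aeval_eq_eval] at this
  rw [this, MvPolynomial.aeval_eq_eval]

theorem exp_neg_le_inv_pow (n : ℕ) :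
    ∃ K : ℝ, 0 ≤ K ∧ ∀ t : ℝ, 0 ≤ t → Real.exp (-t) ≤ K * ((1 + t) ^ n)⁻¹ := by
  refine ⟨n.factorial * Real.exp 1, by positivity, fun t ht => ?_⟩
  have h := Real.pow_div_factorial_le_exp (1 + t) (by positivity) n
  rw [div_le_iff₀ (by positivity), Real.exp_add] at h
  rw [← div_eq_mul_inv, le_div_iff₀ (by positivity), Real.exp_neg, inv_mul_le_iff₀ (by positivity)]
  linarith

/-- For a monomial the function is a product of one-variable factors, each bounded by a multiple of
`exp (-|x_i|)`, and `∑ |x_i|` dominates the sup norm. -/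
theorem rapidDecay_polyGaussian (ε : ι → ℝ) (q : MvPolynomial ι ℂ) {τ : ℂ} (hτ : 0 < τ.im) :
    RapidDecay (polyGaussian ε q τ) := by
  induction q using MvPolynomial.induction_on' with
  | add p q hp hq => simpa only [← polyGaussian_add] using hp.add hq
  | monomial k a =>
    have h1 : RapidDecay fun x : ι → ℝ =>
        ∏ i, hermiteGauss (k i) (signParam (ε i) τ) (x i) := by
      choose C hC hb using fun i => norm_polyGauss_le
        (heatPoly (heatTime (signParam (ε i) τ)) (k i)) (τ := signParam (ε i) τ)
        (by rwa [im_signParam])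
      obtain ⟨K, hK, hexp⟩ := exp_neg_le_inv_pow (Fintype.card ι + 1)
      refine ⟨continuous_finsetProd _ fun i _ =>
        (continuous_polyGauss _ _).comp (continuous_apply i), (∏ i, C i) * K,
        mul_nonneg (Finset.prod_nonneg fun i _ => hC i) hK, fun x => ?_⟩
      rw [norm_prod, mul_assoc]
      calc ∏ i, ‖hermiteGauss (k i) (signParam (ε i) τ) (x i)‖
          ≤ ∏ i, (C i * Real.exp (-|x i|)) :=
            Finset.prod_le_prod (fun i _ => norm_nonneg _) fun i _ => hb i (x i)
        _ = (∏ i, C i) * Real.exp (-∑ i, |x i|) := by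
            rw [Finset.prod_mul_distrib, ← Real.exp_sum, Finset.sum_neg_distrib]
        _ ≤ (∏ i, C i) * (K * ((1 + ‖x‖) ^ (Fintype.card ι + 1))⁻¹) := by
            refine mul_le_mul_of_nonneg_left ?_ (Finset.prod_nonneg fun i _ => hC i)
            refine le_trans ?_ (hexp ‖x‖ (norm_nonneg _))
            refine Real.exp_le_exp.2 (neg_le_neg ?_)
            refine (pi_norm_le_iff_of_nonneg (Finset.sum_nonneg fun i _ => abs_nonneg _)).2
              fun i => ?_
            exact Finset.single_le_sum (f := fun i => |x i|) (fun i _ => abs_nonneg _)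
              (Finset.mem_univ i)
    rw [funext fun x => polyGaussian_monomial ε k a τ x]
    exact h1.const_mul a

/-- `q` is homogeneous of degree `a` in the positive and of degree `b` in the negative variables. -/
def IsBihomogeneous (ε : ι → ℝ) (q : MvPolynomial ι ℂ) (a b : ℕ) : Prop :=
  ∀ k ∈ q.support, (∑ i with 0 < ε i, k i) = a ∧ (∑ i with ¬ 0 < ε i, k i) = b

theorem prod_ite_pos (ε : ι → ℝ) (u v : ℂ) :
    ∏ i, (if 0 < ε i then u else v) = u ^ posCount ε * v ^ negCount ε := by
  rw [Finset.prod_ite, Finset.prod_const, Finset.prod_const]; rfl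

theorem prod_ite_pos_pow (ε : ι → ℝ) (u v : ℂ) (k : ι → ℕ) :
    ∏ i, (if 0 < ε i then u else v) ^ k i =
      u ^ (∑ i with 0 < ε i, k i) * v ^ (∑ i with ¬ 0 < ε i, k i) := by
  rw [← Finset.prod_filter_mul_prod_filter_not Finset.univ (fun i => 0 < ε i),
    ← Finset.prod_pow_eq_pow_sum, ← Finset.prod_pow_eq_pow_sum]
  congr 1
  · exact Finset.prod_congr rfl fun i hi => by rw [if_pos (Finset.mem_filter.1 hi).2]
  · exact Finset.prod_congr rfl fun i hi => by rw [if_neg (Finset.mem_filter.1 hi).2]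

theorem integral_hermiteGauss_mul_e (k : ℕ) {τ : ℂ} (hτ : 0 < τ.im) (s : ℝ) :
    ∫ x : ℝ, hermiteGauss k τ x * e ((-(s * x) : ℝ) : ℂ) =
      1 / (-I * τ) ^ (1 / 2 : ℂ) * (τ ^ k)⁻¹ * hermiteGauss k (-1 / τ) s := by
  have h := congrFun (fourier_hermiteGauss k hτ) s
  rw [Real.fourier_real_eq_integral_exp_smul] at h
  rw [← h]
  congr 1
  funext x
  rw [smul_eq_mul, mul_comm, e]
  congr 2
  push_cast; ring

theorem hermiteGauss_sign_mul (k : ℕ) (τ : ℂ) {s : ℝ} (hs : s = 1 ∨ s = -1) (x : ℝ) :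
    hermiteGauss k τ (s * x) = (s : ℂ) ^ k * hermiteGauss k τ x := by
  rcases hs with rfl | rfl
  · simp
  · simpa using hermiteGauss_neg k τ x

variable {ε : ι → ℝ}

/-- On monomials the integral is a product of one-variable Fourier transforms, at `τ` for positive
and at `-τ̄` for negative variables. Bihomogeneity gives every monomial the same power of `τ` and of
`τ̄`, so the formula extends to `q` by linearity. -/
theorem integral_polyGaussian_mul_e (hε : ∀ i, ε i = 1 ∨ ε i = -1) {q : MvPolynomial ι ℂ}
    {a b : ℕ} (hq : IsBihomogeneous ε q a b) {τ : ℂ} (hτ : 0 < τ.im) (s : ι → ℝ) :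
    ∫ x, polyGaussian ε q τ x * e ((-signForm ε s x : ℝ) : ℂ) =
      (1 / (-I * τ) ^ (1 / 2 : ℂ)) ^ posCount ε *
        (1 / (-I * (-(starRingEnd ℂ) τ)) ^ (1 / 2 : ℂ)) ^ negCount ε *
        ((τ ^ a)⁻¹ * ((starRingEnd ℂ) τ ^ b)⁻¹) * polyGaussian ε q (-1 / τ) s := by
  have hmon : ∀ (k : ι →₀ ℕ) (z : ℂ), (∑ i with 0 < ε i, k i) = a →
      (∑ i with ¬ 0 < ε i, k i) = b →
      ∫ x, polyGaussian ε (MvPolynomial.monomial k z) τ x * e ((-signForm ε s x : ℝ) : ℂ) =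
      (1 / (-I * τ) ^ (1 / 2 : ℂ)) ^ posCount ε *
        (1 / (-I * (-(starRingEnd ℂ) τ)) ^ (1 / 2 : ℂ)) ^ negCount ε *
        ((τ ^ a)⁻¹ * ((starRingEnd ℂ) τ ^ b)⁻¹) *
          polyGaussian ε (MvPolynomial.monomial k z) (-1 / τ) s := by
    intro k z ha hb
    have h1 : ∀ x : ι → ℝ, polyGaussian ε (MvPolynomial.monomial k z) τ x *
        e ((-signForm ε s x : ℝ) : ℂ) = z * ∏ i, (hermiteGauss (k i) (signParam (ε i) τ) (x i) *
          e ((-(ε i * s i * x i) : ℝ) : ℂ)) := fun x => by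
      rw [polyGaussian_monomial, Finset.prod_mul_distrib, mul_assoc]
      congr 2
      simp only [e]
      rw [← Complex.exp_sum, ← Finset.mul_sum, signForm]
      push_cast
      rw [Finset.sum_neg_distrib]
    simp only [h1]
    rw [integral_const_mul, integral_fintype_prod_volume_eq_prod (𝕜 := ℂ)
      (f := fun i t => hermiteGauss (k i) (signParam (ε i) τ) t *
        e ((-(ε i * s i * t) : ℝ) : ℂ)), polyGaussian_monomial]
    have h2 : ∀ i, ∫ t : ℝ, hermiteGauss (k i) (signParam (ε i) τ) t *
        e ((-(ε i * s i * t) : ℝ) : ℂ) =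
        (if 0 < ε i then 1 / (-I * τ) ^ (1 / 2 : ℂ) else
          1 / (-I * (-(starRingEnd ℂ) τ)) ^ (1 / 2 : ℂ)) *
        ((if 0 < ε i then τ⁻¹ else ((starRingEnd ℂ) τ)⁻¹) ^ k i *
          hermiteGauss (k i) (signParam (ε i) (-1 / τ)) (s i)) := fun i => by
      rw [integral_hermiteGauss_mul_e _ (by rwa [im_signParam]), hermiteGauss_sign_mul _ _ (hε i),
        ← signParam_neg_one_div]
      rcases hε i with h | h
      · simp only [h, signParam, zero_lt_one, if_true, Complex.ofReal_one, one_pow, inv_pow]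
        ring
      · have h0 : ¬ (0 : ℝ) < -1 := by norm_num
        -- In a negative variable the frequency is `-s i`; the parity sign this produces cancels the
        -- sign of `(-τ̄)^{-k}`.
        have h1 : (((-1 : ℂ) ^ k i)⁻¹) * (-1) ^ k i = 1 := inv_mul_cancel₀ (by simp)
        simp only [h, signParam, h0, if_false, Complex.ofReal_neg, Complex.ofReal_one, inv_pow]
        rw [neg_pow ((starRingEnd ℂ) τ), mul_inv]
        linear_combination (1 / (-I * -(starRingEnd ℂ) τ) ^ (1 / 2 : ℂ) *
          ((starRingEnd ℂ) τ ^ k i)⁻¹ *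
            hermiteGauss (k i) (-(starRingEnd ℂ) (-1 / τ)) (s i)) * h1
    simp only [h2]
    rw [Finset.prod_mul_distrib, Finset.prod_mul_distrib, prod_ite_pos, prod_ite_pos_pow, ha, hb,
      inv_pow, inv_pow]
    ring
  have hsum : ∀ (τ' : ℂ) (x : ι → ℝ), polyGaussian ε q τ' x =
      ∑ k ∈ q.support, polyGaussian ε (MvPolynomial.monomial k (q.coeff k)) τ' x := fun τ' x => by
    conv_lhs => rw [q.as_sum]
    simp only [polyGaussian, map_sum, Finset.sum_mul]
  simp only [hsum, Finset.sum_mul]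
  rw [integral_finsetSum, Finset.mul_sum]
  · exact Finset.sum_congr rfl fun k hk => hmon k _ (hq k hk).1 (hq k hk).2
  · intro k _
    exact ((rapidDecay_polyGaussian ε _ hτ).mul_bounded (D := 1)
      (continuous_e.comp (Complex.continuous_ofReal.comp (continuous_signForm ε s).neg))
      fun x => (norm_e_ofReal _).le).integrable

/-- Source of the eighth root of unity in the Weil representation. The logarithm of `-iτ` splits on
the principal branch because `arg τ` lies in `[0, π]`, so subtracting `π/2` does not leave `(-π,
π]`. -/
theorem cpow_half_rotate {τ : ℂ} (hτ : 0 < τ.im) :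
    1 / (-I * (-1 / τ)) ^ (1 / 2 : ℂ) = e ((-1 / 8 : ℝ) : ℂ) * τ ^ (1 / 2 : ℂ) := by
  have hτ0 : τ ≠ 0 := by rintro rfl; simp at hτ
  have h1 : -I * (-1 / τ) = (-I * τ)⁻¹ := by
    rw [mul_inv, inv_neg, Complex.inv_I]; ring
  have hre : 0 < (-I * τ).re := by simpa using hτ
  have harg : (-I * τ).arg ≠ Real.pi := by
    rw [Ne, Complex.arg_eq_pi_iff]; intro h; linarith [h.1]
  rw [h1, Complex.inv_cpow _ _ harg, one_div, inv_inv, Complex.cpow_def_of_ne_zero (by simp [hτ0]),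
    Complex.cpow_def_of_ne_zero hτ0, e, ← Complex.exp_add]
  have hlog : Complex.log (-I * τ) = Complex.log (-I) + Complex.log τ := by
    rw [Complex.log_mul_eq_add_log_iff (by simp) hτ0, Complex.arg_neg_I]
    have h0 : 0 ≤ τ.arg := Complex.arg_nonneg_iff.2 hτ.le
    have h2 := Complex.arg_le_pi τ
    constructor <;> linarith [Real.pi_pos]
  rw [hlog, Complex.log_neg_I]
  congr 1
  push_cast
  ring

theorem cpow_half_rotate_conj {τ : ℂ} (hτ : 0 < τ.im) :
    1 / (-I * (-(starRingEnd ℂ) (-1 / τ))) ^ (1 / 2 : ℂ) =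
      e ((1 / 8 : ℝ) : ℂ) * (starRingEnd ℂ) (τ ^ (1 / 2 : ℂ)) := by
  have h1 : -I * (-(starRingEnd ℂ) (-1 / τ)) = (starRingEnd ℂ) (-I * (-1 / τ)) := by
    simp
  have hre : 0 < (-I * (-1 / τ)).re := by
    have := im_neg_one_div_pos hτ
    simpa using this
  have harg : (-I * (-1 / τ)).arg ≠ Real.pi := by
    rw [Ne, Complex.arg_eq_pi_iff]; intro h; linarith [h.1]
  have h2 := congrArg (starRingEnd ℂ) (cpow_half_rotate hτ)
  rw [map_div₀, map_one, map_mul] at h2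
  rw [h1, Complex.conj_cpow _ _ harg]
  simp only [map_div₀, map_one, map_ofNat] at h2 ⊢
  rw [h2, e, e, ← Complex.exp_conj]
  congr 2
  simp only [map_mul, map_ofNat, Complex.conj_ofReal, Complex.conj_I]
  push_cast
  ring

/-- The Fourier formula is applied at `-1/τ`, so that `τ` itself appears on the right, as the
`S`-transformation requires. The roots of unity of the single variables combine to depend only on
the signature. -/
theorem integral_polyGaussian_neg_one_div_mul_e (hε : ∀ i, ε i = 1 ∨ ε i = -1)
    {q : MvPolynomial ι ℂ} {a b : ℕ} (hq : IsBihomogeneous ε q a b) {τ : ℂ} (hτ : 0 < τ.im)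
    (s : ι → ℝ) :
    ∫ x, polyGaussian ε q (-1 / τ) x * e ((-signForm ε s x : ℝ) : ℂ) =
      e (((negCount ε - posCount ε : ℝ) / 8 : ℝ) : ℂ) *
        ((τ ^ (1 / 2 : ℂ)) ^ posCount ε * ((starRingEnd ℂ) (τ ^ (1 / 2 : ℂ))) ^ negCount ε *
        ((-τ) ^ a * (-(starRingEnd ℂ) τ) ^ b)) * polyGaussian ε q τ s := by
  have hτ0 : τ ≠ 0 := by rintro rfl; simp at hτ
  rw [integral_polyGaussian_mul_e hε hq (im_neg_one_div_pos hτ), cpow_half_rotate hτ,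
    cpow_half_rotate_conj hτ]
  have h1 : -1 / (-1 / τ) = τ := by field_simp
  have h2 : e (((negCount ε - posCount ε : ℝ) / 8 : ℝ) : ℂ) =
      e ((-1 / 8 : ℝ) : ℂ) ^ posCount ε * e ((1 / 8 : ℝ) : ℂ) ^ negCount ε := by
    simp only [e]
    rw [← Complex.exp_nat_mul, ← Complex.exp_nat_mul, ← Complex.exp_add]
    congr 1; push_cast; ring
  have h3 : ((-1 / τ) ^ a)⁻¹ = (-τ) ^ a := by
    rw [← inv_pow]; congr 1; field_simp
  have hcj : (starRingEnd ℂ) τ ≠ 0 := by simpa using hτ0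
  have h4 : (((starRingEnd ℂ) (-1 / τ)) ^ b)⁻¹ = (-(starRingEnd ℂ) τ) ^ b := by
    rw [← inv_pow]; congr 1; simp only [map_div₀, map_neg, map_one]; field_simp
  rw [h1, h2, h3, h4, mul_pow, mul_pow]
  ring

theorem polyGaussian_add_one (hε : ∀ i, ε i = 1 ∨ ε i = -1) (q : MvPolynomial ι ℂ) (τ : ℂ)
    (x : ι → ℝ) : polyGaussian ε q (τ + 1) x =
      e ((signForm ε x x / 2 : ℝ) : ℂ) * polyGaussian ε q τ x := by
  have h1 : heatTime (τ + 1) = heatTime τ := by simp [heatTime]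
  have h2 : ∏ i, cexp (Real.pi * I * signParam (ε i) (τ + 1) * x i ^ 2) =
      e ((signForm ε x x / 2 : ℝ) : ℂ) * ∏ i, cexp (Real.pi * I * signParam (ε i) τ * x i ^ 2) := by
    rw [e, ← Complex.exp_sum, ← Complex.exp_sum, ← Complex.exp_add, signForm]
    congr 1
    push_cast
    rw [Finset.sum_div, Finset.mul_sum, ← Finset.sum_add_distrib]
    refine Finset.sum_congr rfl fun i _ => ?_
    have h0 : ¬ (0 : ℝ) < -1 := by norm_num
    rcases hε i with h | h
    · simp only [h, signParam, zero_lt_one, if_true]; push_cast; ring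
    · simp only [h, signParam, h0, if_false, map_add, map_one]; push_cast; ring
  rw [polyGaussian, polyGaussian, h1, h2]
  ring

theorem polyGaussian_neg {q : MvPolynomial ι ℂ} {a b : ℕ}
    (hq : IsBihomogeneous ε q a b) (τ : ℂ) (x : ι → ℝ) :
    polyGaussian ε q τ (-x) = (-1) ^ (a + b) * polyGaussian ε q τ x := by
  have hsum : ∀ x : ι → ℝ, polyGaussian ε q τ x =
      ∑ k ∈ q.support, polyGaussian ε (MvPolynomial.monomial k (q.coeff k)) τ x := fun x => by
    conv_lhs => rw [q.as_sum]
    simp only [polyGaussian, map_sum, Finset.sum_mul]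
  rw [hsum, hsum, Finset.mul_sum]
  refine Finset.sum_congr rfl fun k hk => ?_
  simp only [polyGaussian_monomial, Pi.neg_apply, hermiteGauss_neg, Finset.prod_mul_distrib]
  have : (∏ i, (-1 : ℂ) ^ k i) = (-1) ^ (a + b) := by
    rw [Finset.prod_pow_eq_pow_sum, ← (hq k hk).1, ← (hq k hk).2,
      Finset.sum_filter_add_sum_filter_not]
  rw [this]; ring

/-- Poisson summation for the lattice `A ℤ^ι`. -/
theorem RapidDecay.poisson_linearEquiv {f : (ι → ℝ) → ℂ} (hf : RapidDecay f)
    (A : (ι → ℝ) ≃ₗ[ℝ] (ι → ℝ))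
    (hs : Summable fun m : ι → ℤ => ∫ x, f x * e ((-(∑ i, (m i : ℝ) * A.symm x i) : ℝ) : ℂ)) :
    ∑' n : ι → ℤ, f (A (intVec n)) =
      (|LinearMap.det (A : (ι → ℝ) →ₗ[ℝ] (ι → ℝ))|⁻¹ : ℝ) *
        ∑' m : ι → ℤ, ∫ x, f x * e ((-(∑ i, (m i : ℝ) * A.symm x i) : ℝ) : ℂ) := by
  have hdet : LinearMap.det (A : (ι → ℝ) →ₗ[ℝ] (ι → ℝ)) ≠ 0 := A.isUnit_det'.ne_zero
  have hchange : ∀ m : ι → ℤ,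
      ∫ x, f (A x) * e ((-(∑ i, (m i : ℝ) * x i) : ℝ) : ℂ) =
        (|LinearMap.det (A : (ι → ℝ) →ₗ[ℝ] (ι → ℝ))|⁻¹ : ℝ) *
          ∫ x, f x * e ((-(∑ i, (m i : ℝ) * A.symm x i) : ℝ) : ℂ) := fun m => by
    have hmap := Measure.map_linearMap_addHaar_eq_smul_addHaar (volume : Measure (ι → ℝ)) hdet
    have hemb : MeasurableEmbedding (A : (ι → ℝ) →ₗ[ℝ] (ι → ℝ)) :=
      A.toContinuousLinearEquiv.toHomeomorph.measurableEmbedding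
    have h1 := hemb.integral_map (μ := volume)
      (fun x => f x * e ((-(∑ i, (m i : ℝ) * A.symm x i) : ℝ) : ℂ))
    rw [hmap, integral_smul_measure, ENNReal.toReal_ofReal (abs_nonneg _), abs_inv] at h1
    rw [← Complex.real_smul, h1]
    simp
  have h := (hf.comp_linearEquiv A).poisson (by simpa only [hchange] using hs.mul_left _)
  rw [h]
  simp only [hchange]
  rw [tsum_mul_left]

end Gaussian

/-! ### Even lattices in coordinates -/

section Frame

variable {V : Type*} [AddCommGroup V] [Module ℝ V]

/-- An even lattice `N` together with a `ℤ`-basis and coordinates on `N_ℝ` in which the form is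
`∑ ε_i x_i y_i`. -/
structure LatticeFrame (B : LinearMap.BilinForm ℝ V) (N : Submodule ℤ V) (ι : Type*)
    [Fintype ι] where
  ε : ι → ℝ
  sign : ∀ i, ε i = 1 ∨ ε i = -1
  coord : realSpan N ≃ₗ[ℝ] (ι → ℝ)
  form_eq : ∀ x y : realSpan N, B x y = signForm ε (coord x) (coord y)
  basis : Module.Basis ι ℝ (realSpan N)
  span_eq : N = Submodule.span ℤ (Set.range fun i => (basis i : V))
  even : ∀ x ∈ N, ∃ k : ℤ, B x x = 2 * k

namespace LatticeFrame

variable {B : LinearMap.BilinForm ℝ V} {N : Submodule ℤ V}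

theorem exists_int_of_mem_dual {x y : V} (hx : x ∈ dualLattice B N) (hy : y ∈ N) :
    ∃ k : ℤ, B x y = k := by
  obtain ⟨k, hk⟩ := Submodule.mem_one.1 (hx.1 y hy)
  exact ⟨k, by simpa using hk.symm⟩

variable {ι : Type*} [Fintype ι]

theorem form_comm (F : LatticeFrame B N ι) {x y : V} (hx : x ∈ realSpan N) (hy : y ∈ realSpan N) :
    B x y = B y x := by
  rw [F.form_eq ⟨x, hx⟩ ⟨y, hy⟩, F.form_eq ⟨y, hy⟩ ⟨x, hx⟩, signForm_comm]

theorem integral (F : LatticeFrame B N ι) {x y : V} (hx : x ∈ N) (hy : y ∈ N) :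
    ∃ k : ℤ, B x y = k := by
  obtain ⟨a, ha⟩ := F.even x hx
  obtain ⟨b, hb⟩ := F.even y hy
  obtain ⟨c, hc⟩ := F.even (x + y) (N.add_mem hx hy)
  refine ⟨c - a - b, ?_⟩
  simp only [map_add, LinearMap.add_apply] at hc
  rw [ha, hb,
    F.form_comm (Submodule.subset_span hy) (Submodule.subset_span hx)] at hc
  push_cast
  linarith

theorem le_dualLattice (F : LatticeFrame B N ι) : N ≤ dualLattice B N := fun x hx =>
  ⟨fun _ hy => by
    obtain ⟨k, hk⟩ := F.integral hx hy
    exact Submodule.mem_one.2 ⟨k, by simp [hk]⟩, Submodule.subset_span hx⟩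

variable (F : LatticeFrame B N ι)

theorem basis_mem (i : ι) : (F.basis i : V) ∈ N := by
  have h : (F.basis i : V) ∈ Submodule.span ℤ (Set.range fun i => (F.basis i : V)) :=
    Submodule.subset_span ⟨i, rfl⟩
  rwa [← F.span_eq] at h

/-- The pairings of an element of the dual lattice with the lattice basis. -/
noncomputable def pairing : dualLattice B N →ₗ[ℤ] (ι → ℤ) where
  toFun x i := (exists_int_of_mem_dual x.2 (F.basis_mem i)).choose
  map_add' x y := by
    ext i
    have h := (exists_int_of_mem_dual (x + y).2 (F.basis_mem i)).choose_spec
    have hx := (exists_int_of_mem_dual x.2 (F.basis_mem i)).choose_spec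
    have hy := (exists_int_of_mem_dual y.2 (F.basis_mem i)).choose_spec
    have : B (x + y : dualLattice B N) (F.basis i) = B x (F.basis i) + B y (F.basis i) := by simp
    rw [h, hx, hy] at this
    exact_mod_cast this
  map_smul' k x := by
    ext i
    have h := (exists_int_of_mem_dual (k • x).2 (F.basis_mem i)).choose_spec
    have hx := (exists_int_of_mem_dual x.2 (F.basis_mem i)).choose_spec
    have : B (k • x : dualLattice B N) (F.basis i) = k * B x (F.basis i) := by simp
    rw [h, hx] at this
    exact_mod_cast this

theorem coe_pairing (x : dualLattice B N) (i : ι) : (F.pairing x i : ℝ) = B x (F.basis i) :=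
  (exists_int_of_mem_dual x.2 (F.basis_mem i)).choose_spec.symm

/-- The coordinates of an element of the dual lattice. -/
noncomputable def dualCoord : dualLattice B N →ₗ[ℤ] (ι → ℝ) :=
  (F.coord.toLinearMap.restrictScalars ℤ) ∘ₗ
    { toFun := fun x => (⟨x, x.2.2⟩ : realSpan N)
      map_add' := fun _ _ => rfl
      map_smul' := fun _ _ => rfl }

theorem dualCoord_apply (x : dualLattice B N) : F.dualCoord x = F.coord ⟨x, x.2.2⟩ := rfl

theorem form_dualCoord (x y : dualLattice B N) :
    B x y = signForm F.ε (F.dualCoord x) (F.dualCoord y) :=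
  F.form_eq ⟨x, x.2.2⟩ ⟨y, y.2.2⟩

/-- The linear automorphism of `ℝ^ι` mapping `ℤ^ι` to the coordinates of the lattice. -/
noncomputable def latMap : (ι → ℝ) ≃ₗ[ℝ] (ι → ℝ) := F.basis.equivFun.symm ≪≫ₗ F.coord

theorem dot_latMap_symm (x : dualLattice B N) (v : ι → ℝ) :
    ∑ i, (F.pairing x i : ℝ) * F.latMap.symm v i = signForm F.ε (F.dualCoord x) v := by
  obtain ⟨w, rfl⟩ := F.coord.surjective v
  have h1 : F.latMap.symm (F.coord w) = F.basis.equivFun w := by simp [latMap]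
  rw [dualCoord_apply, ← F.form_eq, h1]
  conv_rhs => rw [← F.basis.sum_equivFun w]
  simp only [coe_pairing, AddSubmonoidClass.coe_finsetSum, Submodule.coe_smul, map_sum, map_smul,
    smul_eq_mul]
  exact Finset.sum_congr rfl fun i _ => mul_comm _ _

theorem pairing_injective : Function.Injective F.pairing := by
  refine (injective_iff_map_eq_zero _).2 fun x hx => ?_
  have h : ∀ v, signForm F.ε (F.dualCoord x) v = 0 := fun v => by
    rw [← dot_latMap_symm, hx]; simp
  have h0 : F.dualCoord x = 0 := by
    classical
    ext i
    have := h (Pi.single i 1)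
    simp only [signForm, Pi.single_apply, mul_ite, mul_one, mul_zero, Finset.sum_ite_eq',
      Finset.mem_univ, if_true] at this
    rcases F.sign i with hi | hi <;> simpa [hi] using this
  have h1 : (⟨x, x.2.2⟩ : realSpan N) = 0 := F.coord.injective (by rw [map_zero]; exact h0)
  exact Subtype.ext (congrArg (fun z : realSpan N => (z : V)) h1)

theorem pairing_surjective : Function.Surjective F.pairing := by
  classical
  intro m
  -- The vector representing, with respect to the signed form, the functional that takes the value
  -- `m j` on the basis vector of index `j`; the factor `ε i` is its own inverse.
  set s : ι → ℝ := fun i => F.ε i * ∑ j, (m j : ℝ) * F.latMap.symm (Pi.single i 1) j with hs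
  have h1 : ∀ v, signForm F.ε s v = ∑ j, (m j : ℝ) * F.latMap.symm v j := fun v => by
    have hv : F.latMap.symm v = ∑ i, v i • F.latMap.symm (Pi.single i 1) := by
      conv_lhs => rw [pi_eq_sum_univ' v, map_sum]
      exact Finset.sum_congr rfl fun i _ => by
        rw [← map_smul]
    rw [hv]
    simp only [signForm, hs, Finset.sum_apply, Pi.smul_apply, smul_eq_mul, Finset.mul_sum,
      Finset.sum_mul]
    rw [Finset.sum_comm]
    refine Finset.sum_congr rfl fun j _ => Finset.sum_congr rfl fun i _ => ?_
    have : F.ε i * F.ε i = 1 := by rcases F.sign i with h | h <;> simp [h]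
    linear_combination ((m j : ℝ) * F.latMap.symm (Pi.single i 1) j * v i) * this
  set w : realSpan N := F.coord.symm s
  have h2 : ∀ i, B w (F.basis i) = m i := fun i => by
    rw [F.form_eq, LinearEquiv.apply_symm_apply, h1]
    have : F.latMap.symm (F.coord (F.basis i)) = Pi.single i 1 := by
      simp [latMap, Finsupp.single_eq_pi_single]
    rw [this]
    simp [Pi.single_apply]
  have h3 : (w : V) ∈ dualLattice B N := by
    refine ⟨fun y hy => ?_, w.2⟩
    rw [F.span_eq] at hy
    induction hy using Submodule.span_induction with
    | mem y hy =>
      obtain ⟨i, rfl⟩ := hy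
      exact Submodule.mem_one.2 ⟨m i, by simp [h2]⟩
    | zero => simp
    | add y z _ _ hy hz => rw [map_add]; exact add_mem hy hz
    | smul k y _ hy => rw [map_zsmul]; exact Submodule.smul_mem _ _ hy
  refine ⟨⟨w, h3⟩, ?_⟩
  ext i
  have := F.coe_pairing ⟨w, h3⟩ i
  rw [h2] at this
  exact_mod_cast this

/-- The dual lattice is isomorphic to `ℤ^ι`. -/
noncomputable def dualEquiv : dualLattice B N ≃ₗ[ℤ] (ι → ℤ) :=
  LinearEquiv.ofBijective F.pairing ⟨F.pairing_injective, F.pairing_surjective⟩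

theorem dualEquiv_apply (x : dualLattice B N) : F.dualEquiv x = F.pairing x := rfl

theorem linearIndependent_basis : LinearIndependent ℤ fun i => (F.basis i : V) :=
  (F.basis.linearIndependent.map' (realSpan N).subtype (by simp)).restrict_scalars
    (fun a b h => by simpa using h)

/-- The lattice basis, as a `ℤ`-basis of `N ⊆ N*`. -/
noncomputable def latBasis : Module.Basis ι ℤ (N.submoduleOf (dualLattice B N)) :=
  ((Module.Basis.span F.linearIndependent_basis).map (LinearEquiv.ofEq _ _ F.span_eq.symm)).map
    (Submodule.submoduleOfEquivOfLe F.le_dualLattice).symm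

theorem coe_latBasis (i : ι) : ((F.latBasis i : dualLattice B N) : V) = F.basis i := by
  simp only [latBasis, Module.Basis.map_apply]
  exact congrArg Subtype.val (Module.Basis.span_apply F.linearIndependent_basis i)

/-- The lattice `N ⊆ N*` is isomorphic to `ℤ^ι`. -/
noncomputable def latEquiv : (ι → ℤ) ≃ₗ[ℤ] N.submoduleOf (dualLattice B N) :=
  F.latBasis.equivFun.symm

theorem dualCoord_latEquiv (n : ι → ℤ) :
    F.dualCoord (F.latEquiv n : dualLattice B N) = F.latMap (intVec n) := by
  have h1 : F.latMap (intVec n) = ∑ i, (n i : ℝ) • F.coord (F.basis i) := by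
    simp [latMap, Module.Basis.equivFun_symm_apply, intVec]
  rw [latEquiv, Module.Basis.equivFun_symm_apply, h1]
  simp only [AddSubmonoidClass.coe_finsetSum, Submodule.coe_smul, map_sum, map_smul]
  refine Finset.sum_congr rfl fun i _ => ?_
  rw [Int.cast_smul_eq_zsmul]
  congr 1
  rw [dualCoord_apply]
  congr 1
  exact Subtype.ext (F.coe_latBasis i)

/-- With respect to a basis of `N` and the dual basis of `N*`, the inclusion `N ⊆ N*` is the Gram
matrix `Pᵀ diag(ε) P`, where `P` is the matrix of `latMap`. The index is its determinant up to sign,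
and the signs contribute `±1`. -/
theorem card_discGroup :
    (Nat.card (DiscGroup B N) : ℝ) = LinearMap.det (F.latMap : (ι → ℝ) →ₗ[ℝ] (ι → ℝ)) ^ 2 := by
  classical
  have : Module.Free ℤ (dualLattice B N) :=
    Module.Free.of_basis (Module.Basis.ofEquivFun F.dualEquiv)
  have : Module.Finite ℤ (dualLattice B N) :=
    Module.Finite.of_basis (Module.Basis.ofEquivFun F.dualEquiv)
  have h := Submodule.natAbs_det_basis_change (Module.Basis.ofEquivFun F.dualEquiv) _ F.latBasis
  rw [← h, Nat.cast_natAbs, Int.cast_abs]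
  set P : Matrix ι ι ℝ := LinearMap.toMatrix' (F.latMap : (ι → ℝ) →ₗ[ℝ] (ι → ℝ)) with hP
  have hPe : ∀ i j, P i j = F.coord (F.basis j) i := fun i j => by
    rw [hP, LinearMap.toMatrix'_apply]
    simp [latMap, Module.Basis.equivFun_symm_apply, Pi.single_apply]
  have hG : ((((Module.Basis.ofEquivFun F.dualEquiv).toMatrix (Subtype.val ∘ F.latBasis))).map
      (Int.cast : ℤ → ℝ)) = P.transpose * Matrix.diagonal F.ε * P := by
    ext i j
    rw [Matrix.map_apply, Module.Basis.toMatrix_apply, Module.Basis.ofEquivFun_repr_apply,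
      dualEquiv_apply, coe_pairing, Function.comp_apply, F.coe_latBasis, F.form_eq, signForm,
      Matrix.mul_apply]
    refine Finset.sum_congr rfl fun k _ => ?_
    rw [Matrix.mul_diagonal, Matrix.transpose_apply, hPe, hPe]
    ring
  have hdet := congrArg Matrix.det hG
  rw [Matrix.det_mul, Matrix.det_mul, Matrix.det_transpose, Matrix.det_diagonal] at hdet
  have hdet' : (((Module.Basis.ofEquivFun F.dualEquiv).det (Subtype.val ∘ F.latBasis) : ℤ) : ℝ) =
      P.det * (∏ i, F.ε i) * P.det := by
    rw [← hdet, Module.Basis.det_apply, Int.cast_det]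
  rw [hdet', abs_mul, abs_mul, ← LinearMap.det_toMatrix', ← hP]
  have hprod : |∏ i, F.ε i| = 1 := by
    rw [Finset.abs_prod]
    exact Finset.prod_eq_one fun i _ => by rcases F.sign i with h | h <;> simp [h]
  rw [hprod, mul_one, abs_mul_abs_self, sq]

end LatticeFrame

end Frame

/-! ### Theta functions of an even lattice in coordinates -/

section FrameTheta

open MeasureTheory

variable {V : Type*} [AddCommGroup V] [Module ℝ V]

namespace LatticeFrame

variable {B : LinearMap.BilinForm ℝ V} {N : Submodule ℤ V} {ι : Type*} [Fintype ι]
  (F : LatticeFrame B N ι)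

theorem toQuadraticMap_equivalent :
    QuadraticMap.Equivalent (B.restrict (realSpan N)).toQuadraticMap
      (QuadraticMap.weightedSumSquares ℝ F.ε) :=
  ⟨{ F.coord with
      map_app' := fun x => by
        have h := F.form_eq x x
        change QuadraticMap.weightedSumSquares ℝ F.ε (F.coord x) = B x x
        rw [h, QuadraticMap.weightedSumSquares_apply, signForm]
        exact Finset.sum_congr rfl fun i _ => by rw [smul_eq_mul, mul_assoc] }⟩

theorem sigPos_eq : sigPos (B.restrict (realSpan N)).toQuadraticMap = posCount F.ε := by
  rw [F.toQuadraticMap_equivalent.sigPos_eq, QuadraticForm.sigPos_weightedSumSquares, posCount,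
    ← Set.ncard_coe_finset]
  simp

theorem sigNeg_eq : sigNeg (B.restrict (realSpan N)).toQuadraticMap = negCount F.ε := by
  rw [F.toQuadraticMap_equivalent.sigNeg_eq, QuadraticForm.sigNeg_weightedSumSquares, negCount,
    ← Set.ncard_coe_finset]
  congr 1
  ext i
  rcases F.sign i with h | h <;> simp [h]
  norm_num

theorem finite_discGroup (F : LatticeFrame B N ι) : Finite (DiscGroup B N) := by
  refine Nat.finite_of_card_ne_zero fun h => ?_
  have h1 := F.card_discGroup
  rw [h, Nat.cast_zero, eq_comm, sq_eq_zero_iff] at h1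
  exact F.latMap.isUnit_det'.ne_zero h1

theorem abs_det_latMap :
    |LinearMap.det (F.latMap : (ι → ℝ) →ₗ[ℝ] (ι → ℝ))| = Real.sqrt (Nat.card (DiscGroup B N)) := by
  rw [F.card_discGroup, Real.sqrt_sq_eq_abs]

/-- The linear automorphism of `ℝ^ι` mapping `ℤ^ι` to the coordinates of the dual lattice. -/
theorem exists_dualCoord_eq : ∃ A : (ι → ℝ) ≃ₗ[ℝ] (ι → ℝ), ∀ x : dualLattice B N,
    F.dualCoord x = A (intVec (F.dualEquiv x)) := by
  classical
  -- The pairings with the lattice basis, extended to all real vectors. `D` sends the coordinates of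
  -- `N*` onto integral vectors, so the required automorphism is its inverse.
  let D : (ι → ℝ) →ₗ[ℝ] (ι → ℝ) :=
    { toFun := fun v i => signForm F.ε v (F.coord (F.basis i))
      map_add' := fun v w => by ext i; simp [signForm_add_left]
      map_smul' := fun t v => by ext i; simp [signForm_smul_left] }
  have hD : Function.Injective D := by
    refine (injective_iff_map_eq_zero _).2 fun v hv => ?_
    have h1 : ∀ w : realSpan N, signForm F.ε v (F.coord w) = 0 := fun w => by
      rw [← F.basis.sum_equivFun w, map_sum]
      have h2 : ∀ s : Finset ι, signForm F.ε v
          (∑ i ∈ s, F.coord (F.basis.equivFun w i • F.basis i)) = 0 := fun s => by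
        induction s using Finset.induction_on with
        | empty => simp [signForm]
        | insert i s hi ih =>
          have hvi : signForm F.ε v (F.coord (F.basis i)) = 0 := congrFun hv i
          rw [Finset.sum_insert hi, signForm_add_right, ih, map_smul, signForm_comm,
            signForm_smul_left, signForm_comm, hvi, mul_zero, add_zero]
      exact h2 _
    ext i
    have := h1 (F.coord.symm (Pi.single i 1))
    simp only [LinearEquiv.apply_symm_apply, signForm, Pi.single_apply, mul_ite, mul_one, mul_zero,
      Finset.sum_ite_eq', Finset.mem_univ, if_true] at this
    rcases F.sign i with hi | hi <;> simpa [hi] using this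
  refine ⟨(LinearEquiv.ofInjectiveEndo D hD).symm, fun x => ?_⟩
  rw [LinearEquiv.eq_symm_apply]
  ext i
  change signForm F.ε (F.dualCoord x) (F.coord (F.basis i)) = intVec (F.pairing x) i
  rw [intVec, coe_pairing, dualCoord_apply, ← F.form_eq]

theorem _root_.ModifiedTheta.RapidDecay.summable_dualCoord {f : (ι → ℝ) → ℂ} (hf : RapidDecay f) :
    Summable fun x : dualLattice B N => f (F.dualCoord x) := by
  obtain ⟨A, hA⟩ := F.exists_dualCoord_eq
  simp only [hA]
  exact (F.dualEquiv.toEquiv.summable_iff (f := fun m => f (A (intVec m)))).2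
    (hf.comp_linearEquiv A).summable

/-- Poisson summation for an even lattice and its dual. -/
theorem poisson {f : (ι → ℝ) → ℂ} (hf : RapidDecay f)
    (hs : Summable fun x : dualLattice B N =>
      ∫ v, f v * e ((-signForm F.ε (F.dualCoord x) v : ℝ) : ℂ)) :
    ∑' n : ι → ℤ, f (F.latMap (intVec n)) = ((Real.sqrt (Nat.card (DiscGroup B N)) : ℝ) : ℂ)⁻¹ *
      ∑' x : dualLattice B N, ∫ v, f v * e ((-signForm F.ε (F.dualCoord x) v : ℝ) : ℂ) := by
  have h1 : (fun x : dualLattice B N =>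
      ∫ v, f v * e ((-signForm F.ε (F.dualCoord x) v : ℝ) : ℂ)) =
      (fun m : ι → ℤ => ∫ v, f v * e ((-(∑ i, (m i : ℝ) * F.latMap.symm v i) : ℝ) : ℂ)) ∘
        F.dualEquiv.toEquiv := by
    funext x
    simp only [Function.comp_apply, LinearEquiv.coe_toEquiv, dualEquiv_apply, dot_latMap_symm]
  rw [h1, F.dualEquiv.toEquiv.summable_iff] at hs
  rw [hf.poisson_linearEquiv F.latMap hs, h1, abs_det_latMap]
  rw [Complex.ofReal_inv]
  congr 1
  exact (F.dualEquiv.toEquiv.tsum_eq (fun m : ι → ℤ =>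
    ∫ v, f v * e ((-(∑ i, (m i : ℝ) * F.latMap.symm v i) : ℝ) : ℂ))).symm

theorem discMk_eq_iff {x y : dualLattice B N} :
    discMk B N x = discMk B N y ↔ x - y ∈ N.submoduleOf (dualLattice B N) :=
  Submodule.Quotient.eq _

/-- The coset `x + N` is parametrized by `ℤ^ι`. -/
noncomputable def cosetEquiv (x : dualLattice B N) :
    (ι → ℤ) ≃ {y : dualLattice B N // discMk B N y = discMk B N x} where
  toFun n := ⟨x + F.latEquiv n, discMk_eq_iff.2 (by simp)⟩
  invFun y := F.latEquiv.symm ⟨y - x, discMk_eq_iff.1 y.2⟩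
  left_inv n := by simp
  right_inv y := by ext; simp

theorem form_latEquiv_integral (x : dualLattice B N) (y : dualLattice B N)
    (hy : y ∈ N.submoduleOf (dualLattice B N)) : ∃ k : ℤ, B x y = k :=
  exists_int_of_mem_dual x.2 hy

/-- Elements of `N` pair integrally with `N*`; hence the matrix entries of `S` are well defined on
the discriminant group. -/
theorem e_form_congr (F : LatticeFrame B N ι) {x x' y y' : dualLattice B N}
    (hx : discMk B N x = discMk B N x')
    (hy : discMk B N y = discMk B N y') :
    e ((-(B x y) : ℝ) : ℂ) = e ((-(B x' y') : ℝ) : ℂ) := by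
  obtain ⟨k, hk⟩ := form_latEquiv_integral x _ (discMk_eq_iff.1 hy)
  obtain ⟨l, hl⟩ := form_latEquiv_integral y' _ (discMk_eq_iff.1 hx)
  have h2 : B y' (x - x' : dualLattice B N) = B (x - x' : dualLattice B N) y' :=
    F.form_comm y'.2.2 (x - x' : dualLattice B N).2.2
  rw [h2] at hl
  simp only [AddSubgroupClass.coe_sub, map_sub, LinearMap.sub_apply] at hk hl
  have : ((-(B x y) : ℝ) : ℂ) = ((-(B x' y') : ℝ) : ℂ) + ((-k - l : ℤ) : ℂ) := by
    have h3 : -(B x y) = -(B x' y') + ((-k - l : ℤ) : ℝ) := by push_cast; linarith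
    rw [h3]; push_cast; ring
  rw [this, e_add, e_intCast, mul_one]

/-- For `n ∈ N` the value `x²/2` changes by `(x, n) + n²/2`. The second term is an integer because
the lattice is even. -/
theorem e_half_form_congr (F : LatticeFrame B N ι) {x x' : dualLattice B N}
    (hx : discMk B N x = discMk B N x') :
    e ((B x x / 2 : ℝ) : ℂ) = e ((B x' x' / 2 : ℝ) : ℂ) := by
  have hn := discMk_eq_iff.1 hx
  obtain ⟨k, hk⟩ := form_latEquiv_integral x' _ hn
  obtain ⟨l, hl⟩ := F.even _ hn
  have h2 : B x' (x - x' : dualLattice B N) = B (x - x' : dualLattice B N) x' :=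
    F.form_comm x'.2.2 (x - x' : dualLattice B N).2.2
  change B (x - x' : dualLattice B N) (x - x' : dualLattice B N) = 2 * l at hl
  rw [h2] at hk
  have hk' := h2 ▸ hk
  simp only [AddSubgroupClass.coe_sub, map_sub, LinearMap.sub_apply] at hk hl h2
  have : ((B x x / 2 : ℝ) : ℂ) = ((B x' x' / 2 : ℝ) : ℂ) + ((k + l : ℤ) : ℂ) := by
    have h3 : B x x / 2 = B x' x' / 2 + ((k + l : ℤ) : ℝ) := by push_cast; linarith
    rw [h3]; push_cast; ring
  rw [this, e_add, e_intCast, mul_one]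

/-! ### The theta series of a lattice and its behaviour under `T` and `S` -/

/-- The summand of the theta function of the lattice. -/
noncomputable def thetaSummand (q : MvPolynomial ι ℂ) (τ : ℂ) (ξ η : ι → ℝ)
    (x : dualLattice B N) : ℂ :=
  polyGaussian F.ε q τ (F.dualCoord x + η) *
    e ((-signForm F.ε (F.dualCoord x + (1 / 2 : ℝ) • η) ξ : ℝ) : ℂ)

theorem summable_thetaSummand (q : MvPolynomial ι ℂ) {τ : ℂ} (hτ : 0 < τ.im) (ξ η : ι → ℝ) :
    Summable (F.thetaSummand q τ ξ η) := by
  have h : RapidDecay fun v : ι → ℝ => polyGaussian F.ε q τ (v + η) *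
      e ((-signForm F.ε (v + (1 / 2 : ℝ) • η) ξ : ℝ) : ℂ) := by
    refine ((rapidDecay_polyGaussian F.ε q hτ).comp_add η).mul_bounded (D := 1) ?_
      fun x => (norm_e_ofReal _).le
    refine continuous_e.comp (Complex.continuous_ofReal.comp ?_)
    rw [funext fun v : ι → ℝ => congrArg Neg.neg (signForm_comm F.ε (v + (1 / 2 : ℝ) • η) ξ)]
    exact ((continuous_signForm F.ε ξ).comp (continuous_id.add continuous_const)).neg
  have h' := RapidDecay.summable_dualCoord F h
  exact h'.congr fun x => rfl

/-- The shift by `η/2` in the character is chosen for this: `(x+η)²/2 - (x+η/2, η) = x²/2`. -/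
theorem thetaSummand_T (q : MvPolynomial ι ℂ) (τ : ℂ) (ξ η : ι → ℝ) (x : dualLattice B N) :
    F.thetaSummand q (τ + 1) (ξ + η) η x =
      e ((B x x / 2 : ℝ) : ℂ) * F.thetaSummand q τ ξ η x := by
  rw [thetaSummand, thetaSummand, polyGaussian_add_one F.sign, F.form_dualCoord]
  have h : ∀ u v w : ℂ, ∀ E E' : ℂ, u * E' = v * E → u * w * E' = v * (w * E) := by
    intro u v w E E' h; linear_combination w * h
  refine h _ _ _ _ _ ?_
  rw [← e_add, ← e_add]
  congr 1
  norm_cast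
  simp only [signForm_add_left, signForm_add_right, signForm_smul_left]
  rw [signForm_comm F.ε η (F.dualCoord x)]
  ring

/-- Poisson summation over the coset `x₀ + N`. The translation by `x₀` becomes the character `𝐞(-(x,
x₀))` on the dual side, while the translation by `ξ` and the modulation by `η` exchange their roles.
-/
theorem tsum_thetaSummand_S {q : MvPolynomial ι ℂ} {a b : ℕ} (hq : IsBihomogeneous F.ε q a b)
    {τ : ℂ} (hτ : 0 < τ.im) (ξ η : ι → ℝ) (x₀ : dualLattice B N) :
    ∑' x : {x : dualLattice B N // discMk B N x = discMk B N x₀},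
      F.thetaSummand q (-1 / τ) (-η) ξ x =
    e (((negCount F.ε - posCount F.ε : ℝ) / 8 : ℝ) : ℂ) /
      (Real.sqrt (Nat.card (DiscGroup B N)) : ℂ) *
      ((τ ^ (1 / 2 : ℂ)) ^ posCount F.ε * ((starRingEnd ℂ) (τ ^ (1 / 2 : ℂ))) ^ negCount F.ε *
        (τ ^ a * (starRingEnd ℂ) τ ^ b)) *
      ∑' x : dualLattice B N, e ((-(B x x₀) : ℝ) : ℂ) * F.thetaSummand q τ ξ η x := by
  set c₀ := F.dualCoord x₀ with hc₀
  set h : (ι → ℝ) → ℂ := fun v => polyGaussian F.ε q (-1 / τ) (v + (c₀ + ξ)) *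
    e ((signForm F.ε η (v + (c₀ + (1 / 2 : ℝ) • ξ)) : ℝ) : ℂ) with hh
  have hdec : RapidDecay h := by
    refine ((rapidDecay_polyGaussian F.ε q (im_neg_one_div_pos hτ)).comp_add _).mul_bounded (D := 1)
      ?_ fun x => (norm_e_ofReal _).le
    exact continuous_e.comp (Complex.continuous_ofReal.comp
      ((continuous_signForm F.ε η).comp (continuous_id.add continuous_const)))
  have hlhs : ∑' x : {x : dualLattice B N // discMk B N x = discMk B N x₀},
      F.thetaSummand q (-1 / τ) (-η) ξ x = ∑' n : ι → ℤ, h (F.latMap (intVec n)) := by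
    rw [← (F.cosetEquiv x₀).tsum_eq]
    refine tsum_congr fun n => ?_
    simp only [cosetEquiv, Equiv.coe_fn_mk, thetaSummand, map_add, dualCoord_latEquiv, hh,
      signForm_neg_right, neg_neg, ← hc₀]
    rw [signForm_comm F.ε η]
    rw [add_comm c₀, add_assoc, add_assoc]
  set K := e (((negCount F.ε - posCount F.ε : ℝ) / 8 : ℝ) : ℂ) *
    ((τ ^ (1 / 2 : ℂ)) ^ posCount F.ε * ((starRingEnd ℂ) (τ ^ (1 / 2 : ℂ))) ^ negCount F.ε *
        ((-τ) ^ a * (-(starRingEnd ℂ) τ) ^ b)) with hK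
  have hint : ∀ x : dualLattice B N,
      ∫ v, h v * e ((-signForm F.ε (F.dualCoord x) v : ℝ) : ℂ) =
        K * (-1) ^ (a + b) * (e ((-(B (-x : dualLattice B N) x₀) : ℝ) : ℂ) *
          F.thetaSummand q τ ξ η (-x)) := fun x => by
    -- Collecting all exponentials after the substitution `w = v + c₀ + ξ` leaves a constant phase
    -- and the frequency `x - η`. Replacing `x` by `-x` then turns this into the expected argument
    -- `x + η`.
    have h1 : ∀ v, h v * e ((-signForm F.ε (F.dualCoord x) v : ℝ) : ℂ) =
        (fun w => e ((signForm F.ε (F.dualCoord x) (c₀ + ξ) -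
          signForm F.ε η ((1 / 2 : ℝ) • ξ) : ℝ) : ℂ) * (polyGaussian F.ε q (-1 / τ) w *
            e ((-signForm F.ε (F.dualCoord x + -η) w : ℝ) : ℂ))) (v + (c₀ + ξ)) := fun v => by
      simp only [hh]
      rw [mul_left_comm, mul_assoc, ← e_add, ← e_add]
      congr 2
      norm_cast
      simp only [signForm_add_left, signForm_add_right, signForm_neg_left,
        signForm_comm F.ε η ((1 / 2 : ℝ) • ξ), signForm_smul_left, signForm_comm F.ε ξ η]
      ring
    simp only [h1]
    rw [integral_add_right_eq_self (fun w => e ((signForm F.ε (F.dualCoord x) (c₀ + ξ) -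
          signForm F.ε η ((1 / 2 : ℝ) • ξ) : ℝ) : ℂ) * (polyGaussian F.ε q (-1 / τ) w *
            e ((-signForm F.ε (F.dualCoord x + -η) w : ℝ) : ℂ))), integral_const_mul,
      integral_polyGaussian_neg_one_div_mul_e F.sign hq hτ, thetaSummand, F.form_dualCoord, ← hc₀,
      map_neg]
    have h2 : -F.dualCoord x + η = -(F.dualCoord x + -η) := by abel
    rw [h2, polyGaussian_neg hq, ← hK]
    have h3 : ((-1 : ℂ) ^ (a + b)) * (-1) ^ (a + b) = 1 := by
      rw [← mul_pow]; simp
    have h4 : e ((signForm F.ε (F.dualCoord x) (c₀ + ξ) -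
        signForm F.ε η ((1 / 2 : ℝ) • ξ) : ℝ) : ℂ) =
        e ((-(signForm F.ε (-F.dualCoord x) c₀) : ℝ) : ℂ) *
          e ((-signForm F.ε (-F.dualCoord x + (1 / 2 : ℝ) • η) ξ : ℝ) : ℂ) := by
      rw [← e_add]
      congr 1
      norm_cast
      simp only [signForm_add_left, signForm_add_right, signForm_neg_left,
        signForm_comm F.ε η ((1 / 2 : ℝ) • ξ), signForm_smul_left, signForm_comm F.ε ξ η]
      ring
    rw [h4]
    linear_combination (-(e ((-(signForm F.ε (-F.dualCoord x) c₀) : ℝ) : ℂ) *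
      e ((-signForm F.ε (-F.dualCoord x + (1 / 2 : ℝ) • η) ξ : ℝ) : ℂ) * K *
      polyGaussian F.ε q τ (F.dualCoord x + -η))) * h3
  have hsum : Summable fun x : dualLattice B N =>
      e ((-(B x x₀) : ℝ) : ℂ) * F.thetaSummand q τ ξ η x := by
    refine Summable.of_norm ?_
    simpa only [norm_mul, norm_e_ofReal, one_mul] using (F.summable_thetaSummand q hτ ξ η).norm
  rw [hlhs, F.poisson hdec]
  · simp only [hint]
    rw [tsum_mul_left, ← (Equiv.neg (dualLattice B N)).tsum_eq
      (fun x => e ((-(B x x₀) : ℝ) : ℂ) * F.thetaSummand q τ ξ η x), hK]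
    -- The parity sign from replacing `x` by `-x` cancels the signs of the automorphy factors.
    have h5 : (-τ) ^ a * (-(starRingEnd ℂ) τ) ^ b * (-1) ^ (a + b) =
        τ ^ a * (starRingEnd ℂ) τ ^ b := by
      rw [neg_pow, neg_pow ((starRingEnd ℂ) τ), pow_add]
      have h3 : ((-1 : ℂ) ^ a) * (-1) ^ a = 1 := by rw [← mul_pow]; simp
      have h4 : ((-1 : ℂ) ^ b) * (-1) ^ b = 1 := by rw [← mul_pow]; simp
      linear_combination (τ ^ a * (starRingEnd ℂ) τ ^ b * (-1) ^ b * (-1) ^ b) * h3 +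
        (τ ^ a * (starRingEnd ℂ) τ ^ b) * h4
    rw [← h5]
    simp only [Equiv.neg_apply]
    ring
  · simp only [hint]
    exact ((Equiv.neg (dualLattice B N)).summable_iff.2 hsum).mul_left _

end LatticeFrame

end FrameTheta

/-! ### Transformation laws under the metaplectic group -/

section Metaplectic

namespace Mp2Z

/-- The projection `Mp₂(ℤ) → SL₂(ℤ)`. -/
noncomputable def toSL : Mp2Z →* SL(2, ℤ) where
  toFun := mat
  map_one' := rfl
  map_mul' _ _ := rfl

theorem S_sq_mat : (S * S).mat = -1 := by
  change ModularGroup.S * ModularGroup.S = -1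
  decide

theorem S_pow_four_mat : (S * S * (S * S)).mat = 1 := by
  rw [mul_mat, S_sq_mat]; simp

/-- `S²` has matrix `-1`, which acts trivially on the half-plane, so the value is the square of the
function of `S²`; that square is prescribed by the bottom row of its matrix. No branch of the root
is needed. -/
theorem S_pow_four_phi (τ : ℍ) : (S * S * (S * S)).phi τ = -1 := by
  rw [mul_phi, S_sq_mat]
  have h : (-1 : SL(2, ℤ)) • τ = τ := by
    rw [ModularGroup.SL_neg_smul, one_smul]
  rw [h, ← pow_two, (S * S).sq, S_sq_mat]
  simp

/-- The images of the two elements generate `SL₂(ℤ)`, and the kernel of the projection consists of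
`1` and `S⁴`. -/
theorem closure_S_T : Subgroup.closure {S, T} = (⊤ : Subgroup Mp2Z) := by
  rw [eq_top_iff]
  intro g _
  have h1 : (Subgroup.closure {S, T}).map toSL = ⊤ := by
    rw [MonoidHom.map_closure, Set.image_pair]
    exact SpecialLinearGroup.SL2Z_generators
  obtain ⟨h, hh, hg⟩ : g.mat ∈ (Subgroup.closure {S, T}).map toSL := by rw [h1]; trivial
  have hg' : h.mat = g.mat := hg
  have hS : S ∈ Subgroup.closure ({S, T} : Set Mp2Z) := Subgroup.subset_closure (by simp)
  set k := g * h⁻¹ with hk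
  have hkm : k.mat = 1 := by rw [hk, mul_mat, inv_mat, hg', mul_inv_cancel]
  have hsq : ∀ τ, k.phi τ ^ 2 = 1 := fun τ => by rw [k.sq, hkm]; simp
  have hcont : Continuous k.phi := k.holo.continuous
  -- A continuous function with square one on the connected half-plane is constant.
  have hpm : Set.EqOn k.phi 1 Set.univ ∨ Set.EqOn k.phi (-1) Set.univ :=
    isPreconnected_univ.eq_or_eq_neg_of_sq_eq hcont.continuousOn continuousOn_const
      (fun τ _ => by simp [hsq]) (fun _ => by simp)
  have hkc : k ∈ Subgroup.closure ({S, T} : Set Mp2Z) := by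
    rcases hpm with h | h
    · have : k = 1 := by
        ext1
        · exact hkm
        · funext τ; exact h (Set.mem_univ τ)
      rw [this]; exact one_mem _
    · have : k = S * S * (S * S) := by
        ext1
        · rw [hkm, S_pow_four_mat]
        · funext τ; rw [S_pow_four_phi]; exact h (Set.mem_univ τ)
      rw [this]; exact mul_mem (mul_mem hS hS) (mul_mem hS hS)
  have : g = k * h := by simp [hk]
  rw [this]
  exact mul_mem hkc hh

end Mp2Z

variable {E W : Type*} [AddCommGroup E] [AddCommGroup W] [Module ℂ W]

/-- `Θ` transforms under `g` with weight `w / 2` and the operator `R`. -/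
def Transforms (w : ℤ) (Θ : ℍ → E → E → W) (g : Mp2Z) (R : W →ₗ[ℂ] W) : Prop :=
  ∀ (τ : ℍ) (ξ η : E),
    Θ (g.mat • τ) (g.mat 0 0 • ξ + g.mat 0 1 • η) (g.mat 1 0 • ξ + g.mat 1 1 • η) =
      g.phi τ ^ w • R (Θ τ ξ η)

namespace Transforms

variable {w : ℤ} {Θ : ℍ → E → E → W} {g h : Mp2Z} {R R' : W →ₗ[ℂ] W}

theorem one : Transforms w Θ 1 LinearMap.id := fun τ ξ η => by
  simp [Mp2Z.one_mat, Mp2Z.one_phi]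

theorem mul (hg : Transforms w Θ g R) (hh : Transforms w Θ h R') :
    Transforms w Θ (g * h) (R ∘ₗ R') := fun τ ξ η => by
  have h1 := hg (h.mat • τ) (h.mat 0 0 • ξ + h.mat 0 1 • η) (h.mat 1 0 • ξ + h.mat 1 1 • η)
  rw [hh τ ξ η, map_smul, ← mul_smul, smul_smul, ← mul_zpow, ← Mp2Z.mul_phi] at h1
  rw [LinearMap.comp_apply, ← h1]
  simp only [Mp2Z.mul_mat, Matrix.SpecialLinearGroup.coe_mul, Matrix.mul_apply, Fin.sum_univ_two]
  congr 1 <;> module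

theorem apply_inv (hg : Transforms w Θ g R) (τ : ℍ) (ξ η : E) :
    Θ τ ξ η = g.phi (g⁻¹.mat • τ) ^ w • R (Θ (g⁻¹.mat • τ)
      (g⁻¹.mat 0 0 • ξ + g⁻¹.mat 0 1 • η) (g⁻¹.mat 1 0 • ξ + g⁻¹.mat 1 1 • η)) := by
  have h1 := hg (g⁻¹.mat • τ) (g⁻¹.mat 0 0 • ξ + g⁻¹.mat 0 1 • η)
    (g⁻¹.mat 1 0 • ξ + g⁻¹.mat 1 1 • η)
  have h2 : g.mat * g⁻¹.mat = 1 := by rw [Mp2Z.inv_mat, mul_inv_cancel]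
  have e00 := congrFun (congrFun (congrArg Subtype.val h2) 0) 0
  have e01 := congrFun (congrFun (congrArg Subtype.val h2) 0) 1
  have e10 := congrFun (congrFun (congrArg Subtype.val h2) 1) 0
  have e11 := congrFun (congrFun (congrArg Subtype.val h2) 1) 1
  simp only [Matrix.SpecialLinearGroup.coe_mul, Matrix.mul_apply, Fin.sum_univ_two,
    Matrix.SpecialLinearGroup.coe_one, Matrix.one_apply_eq, Matrix.one_apply_ne zero_ne_one,
    Matrix.one_apply_ne one_ne_zero] at e00 e01 e10 e11
  have hξ : g.mat 0 0 • (g⁻¹.mat 0 0 • ξ + g⁻¹.mat 0 1 • η) +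
      g.mat 0 1 • (g⁻¹.mat 1 0 • ξ + g⁻¹.mat 1 1 • η) = ξ := by
    have h : (g.mat 0 0 * g⁻¹.mat 0 0 + g.mat 0 1 * g⁻¹.mat 1 0) • ξ +
        (g.mat 0 0 * g⁻¹.mat 0 1 + g.mat 0 1 * g⁻¹.mat 1 1) • η = ξ := by
      rw [e00, e01, one_smul, zero_smul, add_zero]
    exact Eq.trans (by module) h
  have hη : g.mat 1 0 • (g⁻¹.mat 0 0 • ξ + g⁻¹.mat 0 1 • η) +
      g.mat 1 1 • (g⁻¹.mat 1 0 • ξ + g⁻¹.mat 1 1 • η) = η := by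
    have h : (g.mat 1 0 * g⁻¹.mat 0 0 + g.mat 1 1 * g⁻¹.mat 1 0) • ξ +
        (g.mat 1 0 * g⁻¹.mat 0 1 + g.mat 1 1 * g⁻¹.mat 1 1) • η = η := by
      rw [e10, e11, one_smul, zero_smul, zero_add]
    exact Eq.trans (by module) h
  rw [hξ, hη, ← mul_smul, h2, one_smul] at h1
  exact h1

theorem inv (hg : Transforms w Θ g R) (hR : R' ∘ₗ R = LinearMap.id) :
    Transforms w Θ g⁻¹ R' := fun τ ξ η => by
  have h3 : g.phi (g⁻¹.mat • τ) * g⁻¹.phi τ = 1 := by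
    rw [Mp2Z.inv_phi, Mp2Z.inv_mat]; exact mul_inv_cancel₀ (g.phi_ne_zero _)
  rw [hg.apply_inv τ ξ η, map_smul, ← LinearMap.comp_apply, hR, LinearMap.id_apply, smul_smul,
    ← mul_zpow, mul_comm, h3, one_zpow, one_smul]

/-- Every value of `Θ` is reached from the point moved back by `g⁻¹`. When the values span, this
forces `R` to be surjective. -/
theorem mem_range (hg : Transforms w Θ g R) (τ : ℍ) (ξ η : E) :
    Θ τ ξ η ∈ LinearMap.range R := by
  rw [hg.apply_inv τ ξ η]
  exact Submodule.smul_mem _ _ (LinearMap.mem_range_self _ _)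

/-- A transformation law on the generators extends to the metaplectic group. -/
theorem of_generators {ρ : Representation ℂ Mp2Z W} (hS : Transforms w Θ Mp2Z.S (ρ Mp2Z.S))
    (hT : Transforms w Θ Mp2Z.T (ρ Mp2Z.T)) (g : Mp2Z) : Transforms w Θ g (ρ g) := by
  have hg : g ∈ Subgroup.closure {Mp2Z.S, Mp2Z.T} := by rw [Mp2Z.closure_S_T]; trivial
  induction hg using Subgroup.closure_induction with
  | mem x hx =>
    rcases hx with rfl | rfl
    exacts [hS, hT]
  | one => rw [map_one]; exact one
  | mul x y _ _ hx hy => rw [map_mul]; exact hx.mul hy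
  | inv x _ hx =>
    refine hx.inv ?_
    rw [← Module.End.mul_eq_comp, ← map_mul, inv_mul_cancel, map_one]; rfl

/-- If the values of `Θ` span, then transformation operators for the generators extend to a
representation. -/
theorem exists_representation [FiniteDimensional ℂ W]
    (hspan : Submodule.span ℂ {v | ∃ τ ξ η, Θ τ ξ η = v} = ⊤)
    (hS : Transforms w Θ Mp2Z.S R) (hT : Transforms w Θ Mp2Z.T R') :
    ∃ ρ : Representation ℂ Mp2Z W, ρ Mp2Z.S = R ∧ ρ Mp2Z.T = R' := by
  -- Writing `g` as a word in the generators gives some operator; for inverses, surjectivity and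
  -- finite dimension make the operator invertible.
  have hex : ∀ g : Mp2Z, ∃ Q : W →ₗ[ℂ] W, Transforms w Θ g Q := fun g => by
    have hg : g ∈ Subgroup.closure {Mp2Z.S, Mp2Z.T} := by rw [Mp2Z.closure_S_T]; trivial
    induction hg using Subgroup.closure_induction with
    | mem x hx =>
      rcases hx with rfl | rfl
      exacts [⟨_, hS⟩, ⟨_, hT⟩]
    | one => exact ⟨_, one⟩
    | mul x y _ _ hx hy => exact ⟨_, hx.choose_spec.mul hy.choose_spec⟩
    | inv x _ hx =>
      obtain ⟨Q, hQ⟩ := hx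
      have hsurj : Function.Surjective Q := by
        rw [← LinearMap.range_eq_top, eq_top_iff, ← hspan, Submodule.span_le]
        rintro _ ⟨τ, ξ, η, rfl⟩
        exact hQ.mem_range τ ξ η
      have hinj : Function.Injective Q := LinearMap.injective_iff_surjective.2 hsurj
      refine ⟨(LinearEquiv.ofBijective Q ⟨hinj, hsurj⟩).symm, hQ.inv ?_⟩
      ext v
      exact (LinearEquiv.ofBijective Q ⟨hinj, hsurj⟩).symm_apply_apply v
  -- An operator is determined by its effect on the spanning values, so it does not depend on the
  -- word, and multiplicativity follows.
  have huniq : ∀ (g : Mp2Z) (Q Q' : W →ₗ[ℂ] W), Transforms w Θ g Q → Transforms w Θ g Q' →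
      Q = Q' := fun g Q Q' h h' => by
    refine LinearMap.ext_on hspan ?_
    rintro _ ⟨τ, ξ, η, rfl⟩
    have h1 := (h τ ξ η).symm.trans (h' τ ξ η)
    exact smul_right_injective W (zpow_ne_zero w (g.phi_ne_zero τ)) h1
  choose Q hQ using hex
  exact ⟨{ toFun := Q
           map_one' := huniq _ _ _ (hQ 1) one
           map_mul' := fun g h => huniq _ _ _ (hQ (g * h)) ((hQ g).mul (hQ h)) },
    huniq _ _ _ (hQ _) hS, huniq _ _ _ (hQ _) hT⟩

end Transforms

end Metaplectic

/-! ### The Weil representation -/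

section WeilRepresentation

theorem tsum_eq_tsum_fiber {X D : Type*} [Finite D] {f : X → ℂ} (hf : Summable f) (π : X → D) :
    ∑' x, f x = ∑' d : D, ∑' x : {x // π x = d}, f x := by
  rw [← (Equiv.sigmaFiberEquiv π).tsum_eq]
  exact Summable.tsum_sigma ((Equiv.sigmaFiberEquiv π).summable_iff.2 hf)

variable {V : Type*} [AddCommGroup V] [Module ℝ V]

namespace LatticeFrame

variable {B : LinearMap.BilinForm ℝ V} {N : Submodule ℤ V} {ι : Type*} [Fintype ι]
  (F : LatticeFrame B N ι)

/-- The components of the theta function of the lattice. -/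
noncomputable def thetaCoeff (q : MvPolynomial ι ℂ) (b : ℕ) (τ : ℂ) (ξ η : ι → ℝ)
    (γ : DiscGroup B N) : ℂ :=
  ((τ.im ^ ((negCount F.ε : ℝ) / 2 + b) : ℝ) : ℂ) *
    ∑' x : {x : dualLattice B N // discMk B N x = γ}, F.thetaSummand q τ ξ η x

/-- The vector valued theta function of the lattice. -/
noncomputable def thetaVec (q : MvPolynomial ι ℂ) (b : ℕ) (τ : ℍ) (ξ η : ι → ℝ) : DiscSpace B N :=
  haveI := F.finite_discGroup
  Finsupp.ofSupportFinite (F.thetaCoeff q b τ ξ η) (Set.toFinite _)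

theorem thetaVec_apply (q : MvPolynomial ι ℂ) (b : ℕ) (τ : ℍ) (ξ η : ι → ℝ) (γ : DiscGroup B N) :
    F.thetaVec q b τ ξ η γ = F.thetaCoeff q b τ ξ η γ := rfl

theorem _root_.ModifiedTheta.discMk_surjective : Function.Surjective (discMk B N) :=
  Submodule.Quotient.mk_surjective _

theorem _root_.ModifiedTheta.eq_tsum_smul_basisVec [Finite (DiscGroup B N)]
    (R : DiscSpace B N →ₗ[ℂ] DiscSpace B N) (v : DiscSpace B N) (γ : DiscGroup B N) :
    R v γ = ∑' δ, v δ * R (basisVec δ) γ := by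
  have := Fintype.ofFinite (DiscGroup B N)
  have h : v = ∑ δ, v δ • basisVec δ := by
    ext δ
    simp [basisVec]
  conv_lhs => rw [h]
  rw [map_sum, Finsupp.finsetSum_apply, tsum_fintype]
  simp

/-- The weight of the theta function. -/
noncomputable def weight (F : LatticeFrame B N ι) (a b : ℕ) : ℤ :=
  (posCount F.ε : ℤ) - negCount F.ε + 2 * a - 2 * b

theorem thetaVec_T (q : MvPolynomial ι ℂ) (a b : ℕ) {R : DiscSpace B N →ₗ[ℂ] DiscSpace B N}
    (hR : ∀ x : dualLattice B N,
      R (basisVec (discMk B N x)) = e ((B x x / 2 : ℝ) : ℂ) • basisVec (discMk B N x)) :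
    Transforms (F.weight a b) (F.thetaVec q b) Mp2Z.T R := by
  intro τ ξ η
  have := F.finite_discGroup
  have hτ : ((Mp2Z.T.mat • τ : ℍ) : ℂ) = τ + 1 := by
    change ((ModularGroup.T • τ : ℍ) : ℂ) = _
    rw [UpperHalfPlane.modular_T_smul, UpperHalfPlane.coe_vadd]; push_cast; ring
  have h1 : Mp2Z.T.mat 0 0 • ξ + Mp2Z.T.mat 0 1 • η = ξ + η := by simp [Mp2Z.T, ModularGroup.T]
  have h2 : Mp2Z.T.mat 1 0 • ξ + Mp2Z.T.mat 1 1 • η = η := by simp [Mp2Z.T, ModularGroup.T]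
  have h3 : Mp2Z.T.phi τ = 1 := rfl
  rw [h1, h2, h3, one_zpow, one_smul]
  ext γ
  obtain ⟨x₀, rfl⟩ := discMk_surjective γ
  rw [eq_tsum_smul_basisVec, tsum_eq_single (discMk B N x₀), hR]
  · simp only [thetaVec_apply, thetaCoeff, hτ, thetaSummand_T]
    have h4 : ∀ x : {x : dualLattice B N // discMk B N x = discMk B N x₀},
        e ((B x x / 2 : ℝ) : ℂ) = e ((B x₀ x₀ / 2 : ℝ) : ℂ) := fun x => F.e_half_form_congr x.2
    simp only [h4]
    rw [tsum_mul_left]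
    simp [basisVec]
    ring
  · intro δ hδ
    obtain ⟨x, rfl⟩ := discMk_surjective δ
    rw [hR]
    simp [basisVec, hδ]

/-- Since `Im(-1/τ) = y/|τ|²`, the power of `y` in front of the theta series trades each conjugate
factor of `τ` or of its root for the inverse of the holomorphic one. -/
theorem im_rpow_neg_one_div {τ : ℂ} (hτ : 0 < τ.im) (n b : ℕ) :
    (((-1 / τ).im ^ ((n : ℝ) / 2 + b) : ℝ) : ℂ) *
      ((τ ^ (1 / 2 : ℂ)) * (starRingEnd ℂ) (τ ^ (1 / 2 : ℂ))) ^ n *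
        (τ * (starRingEnd ℂ) τ) ^ b = ((τ.im ^ ((n : ℝ) / 2 + b) : ℝ) : ℂ) := by
  have hτ0 : τ ≠ 0 := by rintro rfl; simp at hτ
  have hs : (τ ^ (1 / 2 : ℂ)) ^ 2 = τ := by
    rw [← Complex.cpow_nat_mul]; simp
  have hn : 0 < ‖τ‖ := norm_pos_iff.2 hτ0
  have hns : ‖τ ^ (1 / 2 : ℂ)‖ ^ 2 = ‖τ‖ := by rw [← norm_pow, hs]
  rw [Complex.mul_conj, Complex.mul_conj, Complex.normSq_eq_norm_sq, Complex.normSq_eq_norm_sq, hns,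
    im_neg_one_div, Complex.normSq_eq_norm_sq]
  norm_cast
  rw [Real.div_rpow hτ.le (by positivity), ← Real.rpow_natCast (‖τ‖) n,
    ← Real.rpow_natCast (‖τ‖ ^ 2) b, ← Real.rpow_natCast ‖τ‖ 2, ← Real.rpow_mul hn.le,
    ← Real.rpow_mul hn.le, mul_assoc, ← Real.rpow_add hn, div_mul_eq_mul_div, div_eq_iff]
  · congr 2; push_cast; ring
  · exact (Real.rpow_pos_of_pos hn _).ne'

/-- The sum over `N*` produced by Poisson summation is split into cosets of `N`. The character
`𝐞(-(x, x₀))` is constant on each of them, which yields the matrix entries of `R`. -/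
theorem thetaVec_S {q : MvPolynomial ι ℂ} {a b : ℕ} (hq : IsBihomogeneous F.ε q a b)
    {R : DiscSpace B N →ₗ[ℂ] DiscSpace B N}
    (hR : ∀ x y : dualLattice B N, R (basisVec (discMk B N x)) (discMk B N y) =
      e (((negCount F.ε - posCount F.ε : ℝ) / 8 : ℝ) : ℂ) /
        (Real.sqrt (Nat.card (DiscGroup B N)) : ℂ) * e ((-(B x y) : ℝ) : ℂ)) :
    Transforms (F.weight a b) (F.thetaVec q b) Mp2Z.S R := by
  intro τ ξ η
  have := F.finite_discGroup
  have hτ : ((Mp2Z.S.mat • τ : ℍ) : ℂ) = -1 / τ := by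
    change ((ModularGroup.S • τ : ℍ) : ℂ) = _
    rw [UpperHalfPlane.modular_S_smul]
    change (-(τ : ℂ))⁻¹ = _
    rw [inv_neg, neg_div, one_div]
  have h1 : Mp2Z.S.mat 0 0 • ξ + Mp2Z.S.mat 0 1 • η = -η := by simp [Mp2Z.S, ModularGroup.S]
  have h2 : Mp2Z.S.mat 1 0 • ξ + Mp2Z.S.mat 1 1 • η = ξ := by simp [Mp2Z.S, ModularGroup.S]
  have h3 : Mp2Z.S.phi τ = (τ : ℂ) ^ (1 / 2 : ℂ) := rfl
  have hpos : 0 < (τ : ℂ).im := τ.im_pos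
  have hτ0 : (τ : ℂ) ≠ 0 := τ.ne_zero
  rw [h1, h2, h3]
  ext γ
  obtain ⟨x₀, rfl⟩ := discMk_surjective γ
  have hsum : Summable fun x : dualLattice B N =>
      e ((-(B x x₀) : ℝ) : ℂ) * F.thetaSummand q τ ξ η x := by
    refine Summable.of_norm ?_
    simpa only [norm_mul, norm_e_ofReal, one_mul] using (F.summable_thetaSummand q hpos ξ η).norm
  obtain ⟨r, hr⟩ : ∃ r : DiscGroup B N → dualLattice B N, ∀ δ, discMk B N (r δ) = δ :=
    discMk_surjective.hasRightInverse
  have h4 : ∀ δ : DiscGroup B N, ∑' x : {x : dualLattice B N // discMk B N x = δ},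
      e ((-(B x x₀) : ℝ) : ℂ) * F.thetaSummand q τ ξ η x =
      e ((-(B (r δ) x₀) : ℝ) : ℂ) *
        ∑' x : {x : dualLattice B N // discMk B N x = δ}, F.thetaSummand q τ ξ η x := fun δ => by
    rw [← tsum_mul_left]
    refine tsum_congr fun x => ?_
    rw [F.e_form_congr (x.2.trans (hr δ).symm) rfl]
  rw [Finsupp.smul_apply, eq_tsum_smul_basisVec, thetaVec_apply, thetaCoeff, hτ,
    F.tsum_thetaSummand_S hq hpos, tsum_eq_tsum_fiber hsum (discMk B N), smul_eq_mul]
  simp only [h4]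
  rw [← tsum_mul_left, ← tsum_mul_left, ← tsum_mul_left]
  refine tsum_congr fun δ => ?_
  have h5 := hR (r δ) x₀
  rw [hr] at h5
  rw [h5, thetaVec_apply, thetaCoeff, ← im_rpow_neg_one_div hpos (negCount F.ε) b]
  set s := (τ : ℂ) ^ (1 / 2 : ℂ) with hs
  have hs0 : s ≠ 0 := by rw [hs, Ne, Complex.cpow_eq_zero_iff]; simp [hτ0]
  have hs2 : (τ : ℂ) = s ^ 2 := by rw [hs, ← Complex.cpow_nat_mul]; simp
  have h6 : s ^ F.weight a b * (s ^ negCount F.ε * (τ : ℂ) ^ b) =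
      s ^ posCount F.ε * (τ : ℂ) ^ a := by
    rw [hs2, ← pow_mul, ← pow_mul, ← pow_add, ← pow_add, ← zpow_natCast, ← zpow_natCast,
      ← zpow_add₀ hs0, weight]
    congr 1; push_cast; ring
  rw [mul_pow, mul_pow]
  linear_combination (-(e (((negCount F.ε - posCount F.ε : ℝ) / 8 : ℝ) : ℂ) /
    (Real.sqrt (Nat.card (DiscGroup B N)) : ℂ)) * (starRingEnd ℂ) s ^ negCount F.ε *
    (starRingEnd ℂ) (τ : ℂ) ^ b * (((-1 / (τ : ℂ)).im ^ ((negCount F.ε : ℝ) / 2 + b) : ℝ) : ℂ) *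
    e ((-(B (r δ) x₀) : ℝ) : ℂ) *
    ∑' x : {x : dualLattice B N // discMk B N x = δ}, F.thetaSummand q τ ξ η x) * h6

/-- For fixed `τ` the values of the theta function with trivial polynomial span. -/
theorem span_thetaVec (τ : ℍ) :
    Submodule.span ℂ {v | ∃ ξ η, F.thetaVec 1 0 τ ξ η = v} = ⊤ := by
  by_contra hne
  have := F.finite_discGroup
  obtain ⟨ℓ, hℓ, hle⟩ := Submodule.exists_le_ker_of_lt_top _ (lt_top_iff_ne_top.2 hne)
  apply hℓ
  have hpos : 0 < (τ : ℂ).im := τ.im_pos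
  -- If the values did not span, a nonzero functional `ℓ` would annihilate them. The case `η = 0` is
  -- enough for a contradiction.
  have h0 : ∀ ξ, ℓ (F.thetaVec 1 0 τ ξ 0) = 0 := fun ξ => hle (Submodule.subset_span ⟨ξ, 0, rfl⟩)
  have h1 : ∀ ξ, ∑' x : dualLattice B N,
      ℓ (basisVec (discMk B N x)) * F.thetaSummand 1 τ ξ 0 x = 0 := fun ξ => by
    have hfin := Fintype.ofFinite (DiscGroup B N)
    have hv : F.thetaVec 1 0 τ ξ 0 = ∑ δ, F.thetaVec 1 0 τ ξ 0 δ • basisVec δ := by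
      ext δ
      simp [basisVec]
    have h2 := h0 ξ
    obtain ⟨C, hC⟩ : ∃ C, ∀ δ : DiscGroup B N, ‖ℓ (basisVec δ)‖ ≤ C :=
      (Set.finite_range fun δ : DiscGroup B N => ‖ℓ (basisVec δ)‖).bddAbove.imp
        fun C hC δ => hC ⟨δ, rfl⟩
    have hsum : Summable fun x : dualLattice B N =>
        ℓ (basisVec (discMk B N x)) * F.thetaSummand 1 τ ξ 0 x := by
      refine Summable.of_norm_bounded ((F.summable_thetaSummand 1 hpos ξ 0).norm.mul_left C)
        fun x => ?_
      rw [norm_mul]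
      exact mul_le_mul_of_nonneg_right (hC _) (norm_nonneg _)
    rw [hv, map_sum] at h2
    rw [tsum_eq_tsum_fiber hsum (discMk B N), tsum_fintype]
    have h3 : ∀ δ : DiscGroup B N, ∑' x : {x : dualLattice B N // discMk B N x = δ},
        ℓ (basisVec (discMk B N x)) * F.thetaSummand 1 τ ξ 0 x = ℓ (basisVec δ) *
          ∑' x : {x : dualLattice B N // discMk B N x = δ}, F.thetaSummand 1 τ ξ 0 x := fun δ => by
      rw [← tsum_mul_left]
      exact tsum_congr fun x => by rw [x.2]
    simp only [map_smul, thetaVec_apply, thetaCoeff, smul_eq_mul, mul_assoc] at h2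
    rw [← Finset.mul_sum, mul_eq_zero] at h2
    simp only [h3]
    rcases h2 with h2 | h2
    · exact absurd h2 (by exact_mod_cast (Real.rpow_pos_of_pos hpos _).ne')
    · rw [← h2]
      exact Finset.sum_congr rfl fun δ _ => mul_comm _ _
  -- In the parameter `ξ` the annihilated sum is a Fourier series indexed by `N* ≅ ℤ^ι`, so its
  -- coefficients vanish; the Gaussian factor of each is nonzero.
  have h2 : (fun m : ι → ℤ => ℓ (basisVec (discMk B N (F.dualEquiv.symm m))) *
      polyGaussian F.ε 1 τ (F.dualCoord (F.dualEquiv.symm m))) = 0 := by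
    refine eq_zero_of_tsum_mul_e_eq_zero ?_ fun t => ?_
    · obtain ⟨C, hC⟩ : ∃ C, ∀ δ : DiscGroup B N, ‖ℓ (basisVec δ)‖ ≤ C :=
        (Set.finite_range fun δ : DiscGroup B N => ‖ℓ (basisVec δ)‖).bddAbove.imp
          fun C hC δ => hC ⟨δ, rfl⟩
      have h3 := (F.dualEquiv.symm.toEquiv.summable_iff.2
        (RapidDecay.summable_dualCoord F (rapidDecay_polyGaussian F.ε 1 hpos)))
      refine Summable.of_norm_bounded (h3.norm.mul_left C) fun x => ?_
      rw [norm_mul]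
      exact mul_le_mul_of_nonneg_right (hC _) (norm_nonneg _)
    -- In lattice coordinates the form `(x, ξ)` becomes the dot product of pairings with `-t`; the
    -- sign undoes the one in the character.
    · rw [← h1 (F.latMap (-t)), ← F.dualEquiv.symm.toEquiv.tsum_eq]
      refine tsum_congr fun m => ?_
      simp only [LinearEquiv.coe_toEquiv, thetaSummand, add_zero, smul_zero]
      rw [← dot_latMap_symm, mul_assoc, ← dualEquiv_apply]
      simp
  ext δ
  obtain ⟨x, rfl⟩ := discMk_surjective δ
  have h3 := congrFun h2 (F.dualEquiv x)
  simp only [LinearEquiv.symm_apply_apply, Pi.zero_apply, mul_eq_zero] at h3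
  rcases h3 with h3 | h3
  · simpa [basisVec] using h3
  · exfalso
    rw [polyGaussian, show (1 : MvPolynomial ι ℂ) = MvPolynomial.C 1 from MvPolynomial.C_1.symm,
      heat_C] at h3
    simp [Finset.prod_eq_zero_iff] at h3

theorem isBihomogeneous_one (ε : ι → ℝ) : IsBihomogeneous ε 1 0 0 := fun k hk => by
  classical
  have : k = 0 := by
    by_contra h
    exact MvPolynomial.mem_support_iff.1 hk (by rw [MvPolynomial.coeff_one, if_neg (Ne.symm h)])
  simp [this]

/-- The two operators are written down on coset representatives. The theta function with constant
polynomial transforms under them and its values span, which supplies the relations of the group. -/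
theorem exists_isWeilRep (F : LatticeFrame B N ι) : ∃ ρ, IsWeilRep B N ρ := by
  have := F.finite_discGroup
  set r := Function.surjInv (discMk_surjective (B := B) (N := N)) with hr
  have hrr : ∀ δ, discMk B N (r δ) = δ := Function.surjInv_eq _
  set RT : DiscSpace B N →ₗ[ℂ] DiscSpace B N := Finsupp.lift _ ℂ _ fun δ =>
    e ((B (r δ) (r δ) / 2 : ℝ) : ℂ) • basisVec δ with hRT
  set RS : DiscSpace B N →ₗ[ℂ] DiscSpace B N := Finsupp.lift _ ℂ _ fun δ =>
    Finsupp.ofSupportFinite (fun δ' => e (((negCount F.ε - posCount F.ε : ℝ) / 8 : ℝ) : ℂ) /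
      (Real.sqrt (Nat.card (DiscGroup B N)) : ℂ) * e ((-(B (r δ) (r δ')) : ℝ) : ℂ))
        (Set.toFinite _) with hRS
  have hT : ∀ x : dualLattice B N,
      RT (basisVec (discMk B N x)) = e ((B x x / 2 : ℝ) : ℂ) • basisVec (discMk B N x) :=
    fun x => by
    rw [hRT, basisVec, Finsupp.lift_apply, Finsupp.sum_single_index (by simp), one_smul,
      F.e_half_form_congr (hrr (discMk B N x))]
    rfl
  have hS : ∀ x y : dualLattice B N, RS (basisVec (discMk B N x)) (discMk B N y) =
      e (((negCount F.ε - posCount F.ε : ℝ) / 8 : ℝ) : ℂ) /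
        (Real.sqrt (Nat.card (DiscGroup B N)) : ℂ) * e ((-(B x y) : ℝ) : ℂ) := fun x y => by
    rw [hRS, basisVec, Finsupp.lift_apply, Finsupp.sum_single_index (by simp), one_smul,
      ← F.e_form_congr (hrr (discMk B N x)) (hrr (discMk B N y))]
    rfl
  have hspan : Submodule.span ℂ {v | ∃ τ ξ η, F.thetaVec 1 0 τ ξ η = v} = ⊤ := by
    rw [eq_top_iff, ← F.span_thetaVec UpperHalfPlane.I]
    exact Submodule.span_mono fun v ⟨ξ, η, h⟩ => ⟨_, ξ, η, h⟩
  obtain ⟨ρ, hρS, hρT⟩ := Transforms.exists_representation hspan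
    (F.thetaVec_S (isBihomogeneous_one F.ε) hS) (F.thetaVec_T 1 0 0 hT)
  refine ⟨ρ, fun x => by rw [hρT, hT], fun x y => ?_⟩
  rw [hρS, hS, F.sigPos_eq, F.sigNeg_eq]

theorem isWeilRep_weilRep (F : LatticeFrame B N ι) : IsWeilRep B N (weilRep B N) := by
  rw [weilRep, dif_pos F.exists_isWeilRep]
  exact F.exists_isWeilRep.choose_spec

/-- The theta function of an even lattice transforms with the Weil representation. -/
theorem transforms_thetaVec {q : MvPolynomial ι ℂ} {a b : ℕ} (hq : IsBihomogeneous F.ε q a b)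
    (g : Mp2Z) : Transforms (F.weight a b) (F.thetaVec q b) g (weilRep B N g) := by
  refine Transforms.of_generators (F.thetaVec_S hq fun x y => ?_)
    (F.thetaVec_T q a b F.isWeilRep_weilRep.T_apply) g
  rw [F.isWeilRep_weilRep.S_apply, F.sigPos_eq, F.sigNeg_eq]

end LatticeFrame

end WeilRepresentation

/-! ### Polynomials on a quadratic space in coordinates -/

section Coordinates

variable {E : Type*} [AddCommGroup E] [Module ℝ E] {B : LinearMap.BilinForm ℝ E}

/-- Orthonormal coordinates adapted to a point of the Grassmannian. -/
structure GrassmannianCoord (u : Grassmannian B) (κ : Type*) [Fintype κ] where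
  ε : κ → ℝ
  sign : ∀ i, ε i = 1 ∨ ε i = -1
  coord : E ≃ₗ[ℝ] (κ → ℝ)
  form_eq : ∀ x y, B x y = signForm ε (coord x) (coord y)
  projPos_apply : ∀ x i, coord (u.projPos x) i = if 0 < ε i then coord x i else 0
  projNeg_apply : ∀ x i, coord (u.projNeg x) i = if 0 < ε i then 0 else coord x i

namespace GrassmannianCoord

variable {u : Grassmannian B} {κ : Type*} [Fintype κ] (c : GrassmannianCoord u κ)

/-- The function on `E` given by a polynomial in the coordinates. -/
noncomputable def polyFun (q : MvPolynomial κ ℂ) (x : E) : ℂ :=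
  MvPolynomial.eval (fun i => (c.coord x i : ℂ)) q

theorem exists_polyFun_eq {p : E → ℂ} (hp : IsPolynomial p) : ∃ q, p = c.polyFun q := by
  classical
  refine Algebra.adjoin_induction (p := fun p _ => ∃ q, p = c.polyFun q) ?_ ?_ ?_ ?_ hp
  · rintro _ ⟨l, rfl⟩
    refine ⟨∑ i, MvPolynomial.C ((l (c.coord.symm (Pi.single i 1)) : ℝ) : ℂ) * MvPolynomial.X i,
      funext fun x => ?_⟩
    have hx : x = ∑ i, c.coord x i • c.coord.symm (Pi.single i 1) := by
      apply c.coord.injective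
      simp only [map_sum, map_smul, LinearEquiv.apply_symm_apply]
      exact pi_eq_sum_univ' _
    conv_lhs => rw [hx]
    simp [polyFun, mul_comm]
  · intro r
    exact ⟨MvPolynomial.C r, funext fun x => by simp [polyFun]⟩
  · rintro _ _ _ _ ⟨q, rfl⟩ ⟨r, rfl⟩
    exact ⟨q + r, funext fun x => by simp [polyFun]⟩
  · rintro _ _ _ _ ⟨q, rfl⟩ ⟨r, rfl⟩
    exact ⟨q * r, funext fun x => by simp [polyFun]⟩

/-- For fixed scalars the homogeneity condition holds at all real points, hence is an identity of
polynomials and can be compared coefficientwise. Scaling only one part by `2` then reads off each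
degree. -/
theorem isBihomogeneous {q : MvPolynomial κ ℂ} {a b : ℕ}
    (h : IsHomogeneousOfDegree u (c.polyFun q) a b) : IsBihomogeneous c.ε q a b := by
  classical
  have key : ∀ (s t : ℝ), ∀ k ∈ q.support,
      ((s : ℂ) ^ (∑ i with 0 < c.ε i, k i) * (t : ℂ) ^ (∑ i with ¬ 0 < c.ε i, k i)) =
        (s : ℂ) ^ a * (t : ℂ) ^ b := by
    intro s t k hk
    set z : κ → ℂ := fun i => if 0 < c.ε i then (s : ℂ) else t with hz
    have hprod : ∀ k : κ →₀ ℕ, ∏ i, z i ^ k i =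
        (s : ℂ) ^ (∑ i with 0 < c.ε i, k i) * (t : ℂ) ^ (∑ i with ¬ 0 < c.ε i, k i) :=
      fun k => prod_ite_pos_pow c.ε s t k
    have heq : ∑ k ∈ q.support, MvPolynomial.monomial k ((∏ i, z i ^ k i) * q.coeff k) =
        MvPolynomial.C ((s : ℂ) ^ a * (t : ℂ) ^ b) * q := by
      refine MvPolynomial.funext_set (fun _ => Set.range ((↑) : ℝ → ℂ))
        (fun _ => Set.infinite_range_of_injective Complex.ofReal_injective) fun x hx => ?_
      choose y hy using fun i => hx i (Set.mem_univ i)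
      obtain rfl : (fun i => (y i : ℂ)) = x := funext hy
      have h1 := h (c.coord.symm y) s t
      have h2 : ∀ i,
          (c.coord (s • u.projPos (c.coord.symm y) + t • u.projNeg (c.coord.symm y)) i : ℂ)
          = z i * y i := fun i => by
        rw [map_add, map_smul, map_smul, Pi.add_apply, Pi.smul_apply, Pi.smul_apply,
          c.projPos_apply, c.projNeg_apply, LinearEquiv.apply_symm_apply, hz]
        dsimp only
        split_ifs <;> simp
      simp only [polyFun, h2, LinearEquiv.apply_symm_apply] at h1
      rw [map_mul, MvPolynomial.eval_C, ← h1, MvPolynomial.eval_eq' _ q, map_sum]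
      refine Finset.sum_congr rfl fun k _ => ?_
      rw [MvPolynomial.eval_monomial, Finsupp.prod_fintype _ _ fun i => pow_zero _]
      simp only [mul_pow, Finset.prod_mul_distrib]
      ring
    have h3 := congrArg (MvPolynomial.coeff k) heq
    rw [MvPolynomial.coeff_sum, MvPolynomial.coeff_C_mul, Finset.sum_eq_single k] at h3
    · rw [MvPolynomial.coeff_monomial, if_pos rfl, hprod] at h3
      exact mul_right_cancel₀ (MvPolynomial.mem_support_iff.1 hk) h3
    · intro l _ hl
      rw [MvPolynomial.coeff_monomial, if_neg hl]
    · exact fun h => absurd hk h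
  intro k hk
  have h1 := key 2 1 k hk
  have h2 := key 1 2 k hk
  simp only [Complex.ofReal_one, one_pow, mul_one, one_mul, Complex.ofReal_ofNat] at h1 h2
  have inj : Function.Injective fun n : ℕ => (2 : ℂ) ^ n := fun m n hmn => by
    have : (2 : ℂ) ^ m = 2 ^ n := hmn
    have : (2 : ℕ) ^ m = 2 ^ n := by exact_mod_cast this
    exact Nat.pow_right_injective le_rfl this
  exact ⟨inj h1, inj h2⟩

theorem hasLineDerivAt_polyFun (q : MvPolynomial κ ℂ) (x v : E) :
    HasLineDerivAt ℝ (c.polyFun q)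
      (∑ k, (c.coord v k : ℂ) * c.polyFun (MvPolynomial.pderiv k q) x) x v := by
  classical
  induction q using MvPolynomial.induction_on with
  | C a =>
    have : c.polyFun (MvPolynomial.C a) = fun _ => a := funext fun x => by simp [polyFun]
    rw [this]
    simpa [polyFun, HasLineDerivAt] using hasDerivAt_const (0 : ℝ) a
  | add q r hq hr =>
    have h : c.polyFun (q + r) = fun z => c.polyFun q z + c.polyFun r z :=
      funext fun x => by simp [polyFun]
    rw [h]
    have h2 : HasLineDerivAt ℝ (fun z => c.polyFun q z + c.polyFun r z) _ x v :=
      HasDerivAt.add hq hr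
    convert h2 using 1
    simp [polyFun, mul_add, Finset.sum_add_distrib]
  | mul_X q i hq =>
    have h : c.polyFun (q * MvPolynomial.X i) = fun z => c.polyFun q z * (c.coord z i : ℂ) :=
      funext fun x => by simp [polyFun]
    have h1 : HasDerivAt (fun t : ℝ => ((c.coord (x + t • v) i : ℝ) : ℂ)) (c.coord v i : ℂ) 0 := by
      refine HasDerivAt.ofReal_comp (f := fun t : ℝ => c.coord (x + t • v) i) ?_
      simpa using (((hasDerivAt_id (0 : ℝ)).mul_const (c.coord v i)).const_add (c.coord x i))
    rw [h]
    have h2 : HasLineDerivAt ℝ (fun z => c.polyFun q z * (c.coord z i : ℂ)) _ x v :=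
      HasDerivAt.mul hq h1
    convert h2 using 1
    simp only [polyFun, Derivation.leibniz, MvPolynomial.pderiv_X, smul_eq_mul, map_add, map_mul,
      MvPolynomial.eval_X, zero_smul, add_zero, mul_add, Finset.sum_add_distrib, Finset.sum_mul]
    rw [add_comm]
    congr 1
    · exact Finset.sum_congr rfl fun k _ => by ring
    · rw [Finset.sum_eq_single i]
      · simp [mul_comm]
      · intro k _ hk
        simp [Ne.symm hk]
      · simp

theorem lineDeriv_polyFun (q : MvPolynomial κ ℂ) (x v : E) :
    lineDeriv ℝ (c.polyFun q) x v =
      ∑ k, (c.coord v k : ℂ) * c.polyFun (MvPolynomial.pderiv k q) x :=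
  (c.hasLineDerivAt_polyFun q x v).lineDeriv

theorem majorant_eq (x y : E) : u.majorant x y = ∑ i, c.coord x i * c.coord y i := by
  rw [Grassmannian.majorant, c.form_eq, c.form_eq, signForm, signForm, ← Finset.sum_sub_distrib]
  refine Finset.sum_congr rfl fun i _ => ?_
  rw [c.projPos_apply, c.projPos_apply, c.projNeg_apply, c.projNeg_apply]
  rcases c.sign i with h | h <;> norm_num [h]

variable [FiniteDimensional ℝ E]

/-- The majorant is the standard Euclidean form in these coordinates, so the Gram matrix is `G = P
Pᵀ` with `P` the change of basis. Then `Pᵀ G⁻¹ P = 1`, and only the pure second derivatives survive.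
-/
theorem laplacian_polyFun (q : MvPolynomial κ ℂ) :
    laplacian u (c.polyFun q) = c.polyFun (polyLaplacian κ q) := by
  classical
  funext x
  set b := Module.finBasis ℝ E with hb
  set P : Matrix (Fin (Module.finrank ℝ E)) κ ℝ := Matrix.of fun i k => c.coord (b i) k with hP
  set b' : Module.Basis κ ℝ E := Module.Basis.ofEquivFun c.coord with hb'
  have hPb : P.transpose = b'.toMatrix b := by
    ext k i
    simp [hP, hb', Module.Basis.toMatrix_apply]
  set Q := b.toMatrix b' with hQ
  have hPQ : P.transpose * Q = 1 := by rw [hPb]; exact b'.toMatrix_mul_toMatrix_flip b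
  have hQP : Q * P.transpose = 1 := by rw [hPb]; exact b.toMatrix_mul_toMatrix_flip b'
  have hG : (Matrix.of fun i j => u.majorant (b i) (b j)) = P * P.transpose := by
    ext i j
    rw [Matrix.of_apply, c.majorant_eq, Matrix.mul_apply]
    rfl
  have hinv : (Matrix.of fun i j => u.majorant (b i) (b j))⁻¹ = Q * Q.transpose := by
    refine Matrix.inv_eq_left_inv ?_
    have hQP' := congrArg Matrix.transpose hPQ
    rw [Matrix.transpose_mul, Matrix.transpose_transpose, Matrix.transpose_one] at hQP'
    rw [hG, Matrix.mul_assoc, ← Matrix.mul_assoc Q.transpose, hQP', Matrix.one_mul, hQP]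
  have hone : P.transpose * (Q * Q.transpose) * P = 1 := by
    have hQP' := congrArg Matrix.transpose hPQ
    rw [Matrix.transpose_mul, Matrix.transpose_transpose, Matrix.transpose_one] at hQP'
    rw [← Matrix.mul_assoc, hPQ, Matrix.one_mul, hQP']
  have hl : ∀ j, (fun z => lineDeriv ℝ (c.polyFun q) z (b j)) =
      c.polyFun (∑ k, MvPolynomial.C (P j k : ℂ) * MvPolynomial.pderiv k q) := fun j =>
    funext fun z => by rw [c.lineDeriv_polyFun]; simp [polyFun, hP]
  have hone' : ∀ k l, ∑ i, ∑ j, ((Q * Q.transpose) i j) * P j l * P i k = if k = l then 1 else 0 :=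
    fun k l => by
      have := congrFun (congrFun hone k) l
      rw [Matrix.one_apply, Matrix.mul_apply] at this
      rw [← this, Finset.sum_comm]
      refine Finset.sum_congr rfl fun j _ => ?_
      rw [Matrix.mul_apply, Finset.sum_mul]
      exact Finset.sum_congr rfl fun i _ => by rw [Matrix.transpose_apply]; ring
  rw [laplacian]
  simp only [← hb]
  rw [hinv]
  simp only [hl]
  simp only [lineDeriv_polyFun]
  have hpd : ∀ j k, c.polyFun (MvPolynomial.pderiv k
      (∑ l, MvPolynomial.C (P j l : ℂ) * MvPolynomial.pderiv l q)) x =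
      ∑ l, (P j l : ℂ) * c.polyFun (MvPolynomial.pderiv k (MvPolynomial.pderiv l q)) x :=
    fun j k => by
      rw [map_sum]
      simp [polyFun]
  simp only [hpd]
  calc ∑ i, ∑ j, (((Q * Q.transpose) i j : ℝ) : ℂ) * ∑ k, (c.coord (b i) k : ℂ) *
        ∑ l, (P j l : ℂ) * c.polyFun (MvPolynomial.pderiv k (MvPolynomial.pderiv l q)) x
      = ∑ i, ∑ j, ∑ k, ∑ l, (((Q * Q.transpose) i j * P j l * P i k : ℝ) : ℂ) *
        c.polyFun (MvPolynomial.pderiv k (MvPolynomial.pderiv l q)) x := by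
        simp only [Finset.mul_sum]
        refine Finset.sum_congr rfl fun i _ => Finset.sum_congr rfl fun j _ =>
          Finset.sum_congr rfl fun k _ => Finset.sum_congr rfl fun l _ => ?_
        rw [show c.coord (b i) k = P i k from rfl]
        push_cast; ring
    _ = ∑ k, ∑ l, ((∑ i, ∑ j, (Q * Q.transpose) i j * P j l * P i k : ℝ) : ℂ) *
        c.polyFun (MvPolynomial.pderiv k (MvPolynomial.pderiv l q)) x := by
        push_cast
        simp only [Finset.sum_mul]
        rw [Finset.sum_congr rfl fun i _ => Finset.sum_comm, Finset.sum_comm]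
        refine Finset.sum_congr rfl fun k _ => ?_
        rw [Finset.sum_congr rfl fun i _ => Finset.sum_comm, Finset.sum_comm]
    _ = _ := by
        simp only [hone']
        simp [polyFun, polyLaplacian_apply, apply_ite ((↑) : ℝ → ℂ)]

theorem expLaplacian_polyFun (q : MvPolynomial κ ℂ) (t : ℝ) :
    expLaplacian u t (c.polyFun q) = c.polyFun (heat κ t q) := by
  have hiter : ∀ j, (laplacian u)^[j] (c.polyFun q) = c.polyFun ((polyLaplacian κ ^ j) q) := by
    intro j
    induction j with
    | zero => rfl
    | succ j ih =>
      rw [Function.iterate_succ_apply', ih, laplacian_polyFun, pow_succ', Module.End.mul_apply]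
  obtain ⟨n, h0, hn⟩ := exists_heat_eq_sum q
  funext x
  rw [expLaplacian, tsum_eq_sum (s := Finset.range n), hn]
  · simp [hiter, polyFun, MvPolynomial.smul_eval]
  · intro j hj
    rw [hiter, h0 j (by simpa using hj)]
    simp [polyFun]

end GrassmannianCoord

end Coordinates

/-! ### Existence of frames and coordinates -/

section Existence

/-- A non-degenerate symmetric form has coordinates in which it is a signed sum of squares. -/
theorem exists_signForm_coord {W : Type*} [AddCommGroup W] [Module ℝ W] [FiniteDimensional ℝ W]
    (β : LinearMap.BilinForm ℝ W) (hs : β.IsSymm) (hn : β.Nondegenerate) :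
    ∃ (w : Fin (Module.finrank ℝ W) → ℝ) (c : W ≃ₗ[ℝ] (Fin (Module.finrank ℝ W) → ℝ)),
      (∀ i, w i = 1 ∨ w i = -1) ∧ ∀ x y, β x y = signForm w (c x) (c y) := by
  have hass : QuadraticMap.associated (R := ℝ) β.toQuadraticMap = β :=
    QuadraticMap.associated_left_inverse ℝ hs.eq
  obtain ⟨w, hw, ⟨c⟩⟩ := QuadraticForm.equivalent_one_neg_one_weighted_sum_squared β.toQuadraticMap
    (by rw [hass]; exact hn.1)
  refine ⟨w, c.toLinearEquiv, fun i => (hw i).symm, fun x y => ?_⟩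
  have hq : ∀ x, β x x = signForm w (c x) (c x) := fun x => by
    have h := c.map_app x
    rw [QuadraticMap.weightedSumSquares_apply] at h
    change _ = β x x at h
    rw [← h, signForm]
    exact Finset.sum_congr rfl fun i _ => by rw [smul_eq_mul, mul_assoc]
  have h1 := hq (x + y)
  have h2 : c (x + y) = c x + c y := map_add c.toLinearEquiv x y
  rw [h2] at h1
  simp only [map_add, LinearMap.add_apply, signForm_add_left, signForm_add_right, ← hq] at h1
  rw [hs.eq y x, signForm_comm w (c y)] at h1
  change _ = signForm w (c x) (c y)
  linarith

theorem exists_definite_coord {W : Type*} [AddCommGroup W] [Module ℝ W] [FiniteDimensional ℝ W]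
    (β : LinearMap.BilinForm ℝ W) (hs : β.IsSymm) {s : ℝ} (hsign : s = 1 ∨ s = -1)
    (hd : ∀ x, x ≠ 0 → 0 < s * β x x) :
    ∃ c : W ≃ₗ[ℝ] (Fin (Module.finrank ℝ W) → ℝ),
      ∀ x y, β x y = signForm (fun _ => s) (c x) (c y) := by
  have hn : β.Nondegenerate := by
    refine ⟨fun x hx => ?_, fun x hx => ?_⟩ <;>
    · by_contra h
      have := hd x h
      rw [hx x, mul_zero] at this
      exact this.false
  obtain ⟨w, c, hw, hc⟩ := exists_signForm_coord β hs hn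
  refine ⟨c, fun x y => ?_⟩
  rw [hc]
  congr 1
  funext i
  have h := hd (c.symm (Pi.single i 1)) (by simp)
  rw [hc] at h
  simp [signForm, Pi.single_apply] at h
  rcases hw i with h1 | h1 <;> rcases hsign with h2 | h2 <;> rw [h1, h2] at h <;> norm_num at h <;>
    rw [h1, h2]

/-- By the Smith normal form, `M` has a basis of nonzero integral multiples of members of a lattice
basis of the ambient space. Such multiples are independent over `ℝ`, not merely over `ℤ`. -/
theorem exists_basis_realSpan {V : Type*} [AddCommGroup V] [Module ℝ V] [FiniteDimensional ℝ V]
    (b : Module.Basis (Fin (Module.finrank ℝ V)) ℝ V) {M : Submodule ℤ V}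
    (hM : M ≤ Submodule.span ℤ (Set.range b)) :
    ∃ (n : ℕ) (v : Module.Basis (Fin n) ℝ (realSpan M)),
      M = Submodule.span ℤ (Set.range fun i => (v i : V)) := by
  have hli : LinearIndependent ℤ b := b.linearIndependent.restrict_scalars' ℤ
  let bL : Module.Basis (Fin (Module.finrank ℝ V)) ℤ (Submodule.span ℤ (Set.range b)) :=
    Module.Basis.span hli
  obtain ⟨k, bM, bN, f, a, snf⟩ :=
    (M.submoduleOf (Submodule.span ℤ (Set.range b))).smithNormalForm bL
  have hmap : ∀ {P : Submodule ℤ V} {ι : Type} (c : Module.Basis ι ℤ P),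
      Submodule.span ℤ (Set.range fun i => (c i : V)) = P := fun {P ι} c => by
    have h := congrArg (Submodule.map P.subtype) c.span_eq
    rw [Submodule.map_span, ← Set.range_comp, Submodule.map_top, Submodule.range_subtype] at h
    exact h
  have hw : LinearIndependent ℝ fun i => (bM i : V) := by
    refine linearIndependent_of_top_le_span_of_card_eq_finrank ?_ (by simp)
    rw [← Submodule.span_span_of_tower ℤ, hmap bM, Submodule.span_span_of_tower, b.span_eq]
  have ha : ∀ i, (a i : ℝ) ≠ 0 := fun i h => by
    refine bN.ne_zero i (Subtype.ext ?_)
    rw [snf, Int.cast_eq_zero.1 h, zero_smul]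
    rfl
  set v : Fin k → V := fun i => ((bN i : Submodule.span ℤ (Set.range b)) : V) with hv
  have hva : v = (fun i => Units.mk0 (a i : ℝ) (ha i)) • fun i => (bM (f i) : V) := by
    funext i
    simp only [hv, snf]
    rw [Submodule.coe_smul, ← Int.cast_smul_eq_zsmul ℝ]
    rfl
  have hvli : LinearIndependent ℝ v := by
    rw [hva]
    exact (hw.comp f f.injective).units_smul _
  have hspan : Submodule.span ℤ (Set.range v) = M := by
    have h := congrArg (Submodule.map (Submodule.subtype _))
      (congrArg (Submodule.map (Submodule.subtype _)) bN.span_eq)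
    rw [Submodule.map_span, Submodule.map_span, ← Set.range_comp, ← Set.range_comp,
      Submodule.map_top, Submodule.range_subtype] at h
    exact h.trans ((Submodule.map_comap_subtype _ _).trans (inf_eq_right.2 hM))
  have hreal : Submodule.span ℝ (Set.range v) = realSpan M := by
    rw [realSpan, ← Submodule.span_span_of_tower ℤ, hspan]
  refine ⟨k, (Module.Basis.span hvli).map (LinearEquiv.ofEq _ _ hreal), ?_⟩
  refine hspan.symm.trans (congrArg (fun w : Fin k → V => Submodule.span ℤ (Set.range w)) ?_)
  funext i
  exact congrArg Subtype.val (Module.Basis.span_apply hvli i).symm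

theorem realSpan_eq_top {V : Type*} [AddCommGroup V] [Module ℝ V]
    {B : LinearMap.BilinForm ℝ V} {L : Submodule ℤ V} (hL : IsEvenLattice B L) :
    realSpan L = ⊤ := by
  obtain ⟨b, hb⟩ := hL.exists_basis
  rw [realSpan, hb, Submodule.span_span_of_tower, b.span_eq]

theorem card_fin_finrank_eq {V : Type*} [AddCommGroup V] [Module ℝ V] {ι κ : Type*}
    [Fintype ι] [Fintype κ] (e : V ≃ₗ[ℝ] (ι ⊕ κ → ℝ)) :
    Fintype.card (Fin (Module.finrank ℝ V)) = Fintype.card (ι ⊕ κ) := by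
  rw [e.finrank_eq, Module.finrank_fintype_fun_eq_card, Fintype.card_fin]

variable {V : Type*} [AddCommGroup V] [Module ℝ V] [FiniteDimensional ℝ V]
  {B : LinearMap.BilinForm ℝ V} {L M : Submodule ℤ V}

theorem exists_latticeFrame (hL : IsEvenLattice B L) (hM : IsPrimitiveSublattice B L M) :
    Nonempty (LatticeFrame B M (Fin (Module.finrank ℝ (realSpan M)))) := by
  obtain ⟨b, hb⟩ := hL.exists_basis
  obtain ⟨n, v, hv⟩ := exists_basis_realSpan b (hb ▸ hM.le)
  obtain ⟨w, c, hw, hc⟩ := exists_signForm_coord (B.restrict (realSpan M)) (hL.symm.restrict _)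
    hM.nondegenerate
  obtain rfl : n = Module.finrank ℝ (realSpan M) := by
    rw [Module.finrank_eq_card_basis v, Fintype.card_fin]
  exact ⟨⟨w, hw, c, hc, v, hv, fun x hx => hL.even x (hM.le hx)⟩⟩

theorem exists_grassmannianCoord {E : Type*} [AddCommGroup E] [Module ℝ E] [FiniteDimensional ℝ E]
    {β : LinearMap.BilinForm ℝ E} (hs : β.IsSymm) (u : Grassmannian β) :
    Nonempty (GrassmannianCoord u
      (Fin (Module.finrank ℝ u.pos) ⊕ Fin (Module.finrank ℝ u.neg))) := by
  obtain ⟨cp, hcp⟩ := exists_definite_coord (β.restrict u.pos) (hs.restrict _) (Or.inl rfl)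
    fun x hx => by simpa using u.posDef x x.2 (by simpa using hx)
  obtain ⟨cn, hcn⟩ := exists_definite_coord (β.restrict u.neg) (hs.restrict _) (Or.inr rfl)
    fun x hx => by simpa using u.negDef x x.2 (by simpa using hx)
  let c := (Submodule.prodEquivOfIsCompl u.pos u.neg u.isCompl).symm ≪≫ₗ (cp.prodCongr cn) ≪≫ₗ
    (LinearEquiv.sumArrowLequivProdArrow _ _ ℝ ℝ).symm
  have hc : ∀ (x : u.pos) (y : u.neg), c (x + y) = Sum.elim (cp x) (cn y) := fun x y => by
    have : (Submodule.prodEquivOfIsCompl u.pos u.neg u.isCompl).symm (x + y) = (x, y) := by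
      rw [LinearEquiv.symm_apply_eq]; rfl
    simp only [c, LinearEquiv.trans_apply, this]
    ext i
    rcases i with i | i <;> rfl
  have hdec : ∀ x, ∃ (y : u.pos) (z : u.neg), x = (y : E) + z := fun x =>
    ⟨_, _, ((Submodule.prodEquivOfIsCompl u.pos u.neg u.isCompl).apply_symm_apply x).symm⟩
  have hp : ∀ (y : u.pos) (z : u.neg), u.projPos (y + z) = y := fun y z => by
    simp [Grassmannian.projPos]
  have hn : ∀ (y : u.pos) (z : u.neg), u.projNeg (y + z) = z := fun y z => by
    simp [Grassmannian.projNeg]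
  refine ⟨⟨Sum.elim (fun _ => 1) (fun _ => -1), ?_, c, fun x x' => ?_, fun x i => ?_,
    fun x i => ?_⟩⟩
  · rintro (i | i) <;> simp
  · obtain ⟨y, z, rfl⟩ := hdec x
    obtain ⟨y', z', rfl⟩ := hdec x'
    have h1 := hcp y y'
    have h2 := hcn z z'
    change β y y' = _ at h1
    change β z z' = _ at h2
    rw [hc, hc, map_add, map_add, LinearMap.add_apply, LinearMap.add_apply,
      u.ortho y y.2 z' z'.2, hs.eq z y', u.ortho y' y'.2 z z.2]
    simp only [signForm, Fintype.sum_sum_type, Sum.elim_inl, Sum.elim_inr] at h1 h2 ⊢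
    rw [← h1, ← h2]
    simp
  · obtain ⟨y, z, rfl⟩ := hdec x
    have h := hc y 0
    rw [Submodule.coe_zero, add_zero] at h
    rw [hp, h, hc]
    rcases i with i | i <;> norm_num
  · obtain ⟨y, z, rfl⟩ := hdec x
    have h := hc 0 z
    rw [Submodule.coe_zero, zero_add] at h
    rw [hn, h, hc]
    rcases i with i | i <;> norm_num

/-- The coordinates on `V` obtained from coordinates on `M_ℝ` and on its orthogonal complement. -/
noncomputable def sumCoord {ι κ : Type*} [Fintype ι] [Fintype κ]
    (hL : IsEvenLattice B L) (hM : IsPrimitiveSublattice B L M)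
    (c : realSpan M ≃ₗ[ℝ] (ι → ℝ)) (d : realPerp B M ≃ₗ[ℝ] (κ → ℝ)) : V ≃ₗ[ℝ] (ι ⊕ κ → ℝ) :=
  (Submodule.prodEquivOfIsCompl _ _ (isCompl_realSpan hL hM)).symm ≪≫ₗ (c.prodCongr d) ≪≫ₗ
    (LinearEquiv.sumArrowLequivProdArrow _ _ ℝ ℝ).symm

theorem eq_projSpan_add_projPerp (hL : IsEvenLattice B L) (hM : IsPrimitiveSublattice B L M)
    (x : V) : x = projSpan hL hM x + projPerp hL hM x :=
  (Submodule.projection_add_projection_eq_self (isCompl_realSpan hL hM) x).symm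

theorem sumCoord_apply {ι κ : Type*} [Fintype ι] [Fintype κ]
    (hL : IsEvenLattice B L) (hM : IsPrimitiveSublattice B L M)
    (c : realSpan M ≃ₗ[ℝ] (ι → ℝ)) (d : realPerp B M ≃ₗ[ℝ] (κ → ℝ)) (x : V) :
    sumCoord hL hM c d x = Sum.elim (c (projSpan hL hM x)) (d (projPerp hL hM x)) := by
  have : (Submodule.prodEquivOfIsCompl _ _ (isCompl_realSpan hL hM)).symm x =
      (projSpan hL hM x, projPerp hL hM x) := by
    rw [LinearEquiv.symm_apply_eq]; exact eq_projSpan_add_projPerp hL hM x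
  simp only [sumCoord, LinearEquiv.trans_apply, this]
  ext i
  rcases i with i | i <;> rfl

theorem form_projSpan_projPerp (hL : IsEvenLattice B L) (hM : IsPrimitiveSublattice B L M)
    (x y : V) : B x y = B (projSpan hL hM x) (projSpan hL hM y) +
      B (projPerp hL hM x) (projPerp hL hM y) := by
  have h : ∀ (x : realSpan M) (y : realPerp B M), B x y = 0 := fun x y =>
    LinearMap.BilinForm.mem_orthogonal_iff.1 y.2 x x.2
  conv_lhs => rw [eq_projSpan_add_projPerp hL hM x, eq_projSpan_add_projPerp hL hM y]
  rw [map_add, map_add, LinearMap.add_apply, LinearMap.add_apply, h,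
    hL.symm.eq (projPerp hL hM x : V), h]
  ring

/-- The frame of `L` obtained from a frame of `M` and coordinates on the orthogonal complement. -/
noncomputable def sumFrame {ι κ : Type*} [Fintype ι] [Fintype κ]
    (hL : IsEvenLattice B L) (hM : IsPrimitiveSublattice B L M) (F : LatticeFrame B M ι)
    {u : Grassmannian (B.restrict (realPerp B M))} (c : GrassmannianCoord u κ) :
    LatticeFrame B L (ι ⊕ κ) where
  ε := Sum.elim F.ε c.ε
  sign := by rintro (i | i) <;> simp [F.sign, c.sign]
  coord := (LinearEquiv.ofTop _ (realSpan_eq_top hL)) ≪≫ₗ sumCoord hL hM F.coord c.coord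
  form_eq x y := by
    have h1 := F.form_eq (projSpan hL hM x) (projSpan hL hM y)
    have h2 := c.form_eq (projPerp hL hM x) (projPerp hL hM y)
    change B (projPerp hL hM x) (projPerp hL hM y) = _ at h2
    rw [form_projSpan_projPerp hL hM]
    simp only [LinearEquiv.trans_apply, LinearEquiv.ofTop_apply, sumCoord_apply]
    simp only [signForm, Fintype.sum_sum_type, Sum.elim_inl, Sum.elim_inr] at h1 h2 ⊢
    rw [h1, h2]
  basis := (hL.exists_basis.choose.map (LinearEquiv.ofTop _ (realSpan_eq_top hL)).symm).reindex
    (Fintype.equivOfCardEq (card_fin_finrank_eq (sumCoord hL hM F.coord c.coord)))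
  span_eq := by
    conv_lhs => rw [hL.exists_basis.choose_spec]
    congr 1
    ext x
    constructor
    · rintro ⟨i, rfl⟩
      exact ⟨Fintype.equivOfCardEq (card_fin_finrank_eq (sumCoord hL hM F.coord c.coord)) i,
        by simp⟩
    · rintro ⟨i, rfl⟩
      exact ⟨(Fintype.equivOfCardEq (card_fin_finrank_eq (sumCoord hL hM F.coord c.coord))).symm i,
        by simp⟩
  even := hL.even

theorem sumFrame_dualCoord {ι κ : Type*} [Fintype ι] [Fintype κ]
    (hL : IsEvenLattice B L) (hM : IsPrimitiveSublattice B L M) (F : LatticeFrame B M ι)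
    {u : Grassmannian (B.restrict (realPerp B M))} (c : GrassmannianCoord u κ)
    (x : dualLattice B L) :
    (sumFrame hL hM F c).dualCoord x =
      Sum.elim (F.coord (projSpan hL hM x)) (c.coord (projPerp hL hM x)) :=
  sumCoord_apply hL hM F.coord c.coord x

end Existence

/-! ### Splitting the theta function of a lattice along a sub-lattice -/

section Splitting

theorem sum_elim_add {ι κ : Type*} (x x' : ι → ℝ) (y y' : κ → ℝ) :
    Sum.elim x y + Sum.elim x' y' = Sum.elim (x + x') (y + y') := by
  ext (i | i) <;> rfl

theorem smul_sum_elim {ι κ R : Type*} [SMul R ℝ] (r : R) (x : ι → ℝ) (y : κ → ℝ) :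
    r • Sum.elim x y = Sum.elim (r • x) (r • y) := by
  ext (i | i) <;> rfl

variable {ι κ : Type*} [Fintype ι] [Fintype κ]

theorem polyGaussian_sum (ε : ι → ℝ) (ε' : κ → ℝ) (q : MvPolynomial κ ℂ) (τ : ℂ) (x : ι → ℝ)
    (y : κ → ℝ) :
    polyGaussian (Sum.elim ε ε') (MvPolynomial.rename Sum.inr q) τ (Sum.elim x y) =
      polyGaussian ε 1 τ x * polyGaussian ε' q τ y := by
  have h1 : heat ι (heatTime τ) 1 = 1 := by
    rw [← MvPolynomial.C_1, heat_C]
  rw [polyGaussian, polyGaussian, polyGaussian, heat_rename _ Sum.inr_injective,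
    MvPolynomial.eval_rename, Fintype.prod_sum_type, h1, map_one]
  simp only [Sum.elim_inl, Sum.elim_inr, Function.comp_def]
  ring

theorem IsBihomogeneous.rename_inr (ε : ι → ℝ) {ε' : κ → ℝ} {q : MvPolynomial κ ℂ} {a b : ℕ}
    (hq : IsBihomogeneous ε' q a b) :
    IsBihomogeneous (Sum.elim ε ε') (MvPolynomial.rename Sum.inr q) a b := by
  classical
  intro k hk
  rw [MvPolynomial.support_rename_of_injective Sum.inr_injective, Finset.mem_image] at hk
  obtain ⟨k, hk, rfl⟩ := hk
  have h1 : ∀ i, Finsupp.mapDomain (Sum.inr : κ → ι ⊕ κ) k (Sum.inl i) = 0 := fun i =>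
    Finsupp.mapDomain_of_notMem_range _ _ (by simp)
  have h2 : ∀ i, Finsupp.mapDomain (Sum.inr : κ → ι ⊕ κ) k (Sum.inr i) = k i := fun i =>
    Finsupp.mapDomain_apply Sum.inr_injective _ _
  have h := hq k hk
  simp only [Finset.sum_filter, Fintype.sum_sum_type, Sum.elim_inl, Sum.elim_inr, h1, h2, ite_self,
    Finset.sum_const_zero, zero_add] at h ⊢
  exact h

theorem signForm_sum (ε : ι → ℝ) (ε' : κ → ℝ) (x x' : ι → ℝ) (y y' : κ → ℝ) :
    signForm (Sum.elim ε ε') (Sum.elim x y) (Sum.elim x' y') =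
      signForm ε x x' + signForm ε' y y' := by
  simp [signForm]

variable {V : Type*} [AddCommGroup V] [Module ℝ V] [FiniteDimensional ℝ V]
  {B : LinearMap.BilinForm ℝ V} {L M : Submodule ℤ V}
  (hL : IsEvenLattice B L) (hM : IsPrimitiveSublattice B L M)
  {u : Grassmannian (B.restrict (realPerp B M))} (c : GrassmannianCoord u κ)

theorem thetaTerm_eq (q : MvPolynomial κ ℂ) (ξ η : realPerp B M) (τ : ℍ) (l : DualMod B L M) :
    thetaTerm hL hM u (c.polyFun q) ξ η τ l =
      polyGaussian c.ε q τ (c.coord (perpMap hL hM l) + c.coord η) *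
        e ((-signForm c.ε (c.coord (perpMap hL hM l) + (1 / 2 : ℝ) • c.coord η)
          (c.coord ξ) : ℝ) : ℂ) := by
  rw [thetaTerm]
  set w := perpMap hL hM l
  have hform : ∀ x y : realPerp B M, B x y = signForm c.ε (c.coord x) (c.coord y) := c.form_eq
  have ht : (-1 / (8 * Real.pi * τ.im) : ℝ) = heatTime τ := by rw [heatTime]; rfl
  rw [ht, c.expLaplacian_polyFun, hform, hform, hform, sub_eq_add_neg, e_add, map_add c.coord w,
    map_smul, polyGaussian, GrassmannianCoord.polyFun, map_add, mul_assoc]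
  congr 2
  · rw [e, ← Complex.exp_sum]
    congr 1
    have h1 : ∀ z, signForm c.ε (c.coord (u.projPos z)) (c.coord (u.projPos z)) =
        ∑ i, if 0 < c.ε i then c.coord z i ^ 2 else 0 := fun z => by
      refine Finset.sum_congr rfl fun i _ => ?_
      rw [c.projPos_apply]
      rcases c.sign i with h | h <;> norm_num [h]
      ring
    have h2 : ∀ z, signForm c.ε (c.coord (u.projNeg z)) (c.coord (u.projNeg z)) =
        ∑ i, if 0 < c.ε i then 0 else -c.coord z i ^ 2 := fun z => by
      refine Finset.sum_congr rfl fun i _ => ?_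
      rw [c.projNeg_apply]
      rcases c.sign i with h | h <;> norm_num [h]
      ring
    rw [h1, h2]
    push_cast
    simp only [Finset.sum_div, Finset.mul_sum, ← Finset.sum_add_distrib]
    refine Finset.sum_congr rfl fun i _ => ?_
    rw [signParam, map_add]
    split_ifs <;> push_cast <;> ring
  · push_cast; rfl

/-- Orthogonality splits the quadratic form and the characters, and the polynomial involves only the
coordinates on `M_ℝ^⊥`, so the `M`-factor carries the polynomial `1`. -/
theorem thetaSummand_sumFrame (F : LatticeFrame B M ι) (q : MvPolynomial κ ℂ) (τ : ℍ)
    (ξ' η' : ι → ℝ) (ξ η : realPerp B M) (x : dualLattice B L) :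
    (sumFrame hL hM F c).thetaSummand (MvPolynomial.rename Sum.inr q) τ
        (Sum.elim ξ' (c.coord ξ)) (Sum.elim η' (c.coord η)) x =
      F.thetaSummand 1 τ ξ' η' (dualProj hL hM x) *
        thetaTerm hL hM u (c.polyFun q) ξ η τ (Submodule.Quotient.mk x) := by
  have h1 : (sumFrame hL hM F c).dualCoord x = Sum.elim (F.dualCoord (dualProj hL hM x))
      (c.coord (perpMap hL hM (Submodule.Quotient.mk x))) := sumFrame_dualCoord hL hM F c x
  have hε : (sumFrame hL hM F c).ε = Sum.elim F.ε c.ε := rfl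
  rw [thetaTerm_eq, LatticeFrame.thetaSummand, LatticeFrame.thetaSummand, h1, hε, smul_sum_elim,
    sum_elim_add, sum_elim_add, signForm_sum, polyGaussian_sum, neg_add]
  have h2 : ∀ a b : ℝ, e ((a + b : ℝ) : ℂ) = e a * e b := fun a b => by
    rw [Complex.ofReal_add, e_add]
  rw [h2]
  ring

/-- The fibre of `L* → L*/M` over `l` is mapped bijectively onto the coset `π_M(l)`. -/
theorem bijective_dualProj_fiber (hLd : L ≤ dualLattice B L) (l : DualMod B L M) :
    Function.Bijective
    fun x : {x : dualLattice B L // (Submodule.Quotient.mk x : DualMod B L M) = l} =>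
      (⟨dualProj hL hM x, congrArg (piM hL hM) x.2⟩ :
        {m : dualLattice B M // discMk B M m = piM hL hM l}) := by
  have hid : ∀ x : V, x ∈ M → (projSpan hL hM x : V) = x := fun x hx =>
    congrArg Subtype.val (Submodule.projectionOnto_apply_of_mem_left (isCompl_realSpan hL hM)
      (Submodule.subset_span hx : x ∈ realSpan M))
  constructor
  · rintro ⟨x, hx⟩ ⟨y, hy⟩ hxy
    have h1 : (projSpan hL hM x : V) = projSpan hL hM y :=
      congrArg (fun z : {m : dualLattice B M // discMk B M m = piM hL hM l} =>
        ((z : dualLattice B M) : V)) hxy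
    have h2 : ((x - y : dualLattice B L) : V) ∈ M :=
      (Submodule.Quotient.eq (M.submoduleOf (dualLattice B L))).1 (hx.trans hy.symm)
    have h3 := hid _ h2
    -- Two points of one fibre differ by an element of `M`, which equals its own projection; equal
    -- projections make it zero.
    rw [Submodule.coe_sub, map_sub, Submodule.coe_sub, h1, sub_self] at h3
    exact Subtype.ext (Subtype.ext (sub_eq_zero.1 h3.symm))
  · rintro ⟨m, hm⟩
    obtain ⟨x, rfl⟩ := Submodule.Quotient.mk_surjective _ l
    have h1 : ((m - dualProj hL hM x : dualLattice B M) : V) ∈ M := 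
      (Submodule.Quotient.eq (M.submoduleOf (dualLattice B M))).1 hm
    have h2 := hLd (hM.le h1)
    -- Adding the element `m - proj x` of `M` keeps the class in `L*/M` and moves the projection to
    -- `m`.
    refine ⟨⟨x + ⟨_, h2⟩, (Submodule.Quotient.eq (M.submoduleOf (dualLattice B L))).2 ?_⟩,
      Subtype.ext (Subtype.ext ?_)⟩
    · change ((x + ⟨_, h2⟩ - x : dualLattice B L) : V) ∈ M
      rw [add_sub_cancel_left]
      exact h1
    · have h3 : ((dualProj hL hM x : dualLattice B M) : V) = projSpan hL hM x := rfl
      change (projSpan hL hM ((x : V) + ((m - dualProj hL hM x : dualLattice B M) : V)) : V) = m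
      rw [map_add, Submodule.coe_add, hid _ h1, Submodule.coe_sub, h3]
      exact add_sub_cancel _ _

theorem tsum_subtype_fiber {X Y : Type*} {f : X → ℂ} (hf : Summable f) (π : X → Y) {P : X → Prop}
    {Q : Y → Prop} (h : ∀ x, P x ↔ Q (π x)) :
    ∑' x : {x // P x}, f x = ∑' y : {y // Q y}, ∑' x : {x // π x = y}, f x := by
  let E : (Σ y : {y // Q y}, {x // π x = y}) ≃ {x // P x} :=
    { toFun := fun z => ⟨z.2, (h _).2 (by rw [z.2.2]; exact z.1.2)⟩
      invFun := fun x => ⟨⟨π x, (h x).1 x.2⟩, ⟨x, rfl⟩⟩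
      left_inv := fun z => Sigma.subtype_ext (p := fun (y : {y // Q y}) x => π x = y)
        (Subtype.ext z.2.2) rfl
      right_inv := fun _ => rfl }
  have hs : Summable fun z : (Σ y : {y // Q y}, {x // π x = y}) => f z.2 :=
    E.summable_iff.2 (hf.comp_injective Subtype.val_injective)
  exact (E.tsum_eq fun x : {x // P x} => f x).symm.trans hs.tsum_sigma

end Splitting

/-! ### The transformation law of the modified theta function -/

section Transformation

section General

variable {V : Type*} [AddCommGroup V] [Module ℝ V] {B : LinearMap.BilinForm ℝ V}
  {L M : Submodule ℤ V} {ι : Type*} [Fintype ι]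

theorem thetaSummand_ne_zero (F : LatticeFrame B M ι) (τ : ℍ) (m : dualLattice B M) :
    F.thetaSummand 1 τ 0 0 m ≠ 0 := by
  rw [LatticeFrame.thetaSummand, polyGaussian, ← MvPolynomial.C_1, heat_C]
  refine mul_ne_zero ?_ (Complex.exp_ne_zero _)
  simp [Finset.prod_eq_zero_iff]

/-- The linear map associated with an element of `ℂ[D_L] ⊗ ℂ[D_M]^*`. -/
noncomputable def contraction (B : LinearMap.BilinForm ℝ V) (L M : Submodule ℤ V) :
    DiscSpace B L ⊗[ℂ] Module.Dual ℂ (DiscSpace B M) →ₗ[ℂ]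
      (DiscSpace B M →ₗ[ℂ] DiscSpace B L) :=
  dualTensorHom ℂ (DiscSpace B M) (DiscSpace B L) ∘ₗ (TensorProduct.comm ℂ _ _).toLinearMap

theorem contraction_tmul (a : DiscSpace B L) (f : Module.Dual ℂ (DiscSpace B M))
    (v : DiscSpace B M) : contraction B L M (a ⊗ₜ f) v = f v • a := by
  simp [contraction]

theorem contraction_injective [Finite (DiscGroup B M)] :
    Function.Injective (contraction B L M) := by
  classical
  have := Fintype.ofFinite (DiscGroup B M)
  have h := (dualTensorHomEquivOfBasis (N := DiscSpace B L)
    (Finsupp.basisSingleOne (R := ℂ) (ι := DiscGroup B M))).injective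
  intro x y hxy
  refine (TensorProduct.comm ℂ _ _).injective (h ?_)
  rw [dualTensorHomEquivOfBasis_apply, dualTensorHomEquivOfBasis_apply]
  exact hxy

/-- Read as a linear map from `ℂ[D_M]` to `ℂ[D_L]`, a tensor is acted on by conjugation. -/
theorem contraction_tprod (ρ : Representation ℂ Mp2Z (DiscSpace B L))
    (σ : Representation ℂ Mp2Z (DiscSpace B M)) (g : Mp2Z)
    (x : DiscSpace B L ⊗[ℂ] Module.Dual ℂ (DiscSpace B M)) (v : DiscSpace B M) :
    contraction B L M ((ρ.tprod σ.dual) g x) v = ρ g (contraction B L M x (σ g⁻¹ v)) := by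
  induction x using TensorProduct.induction_on with
  | zero => simp
  | tmul a f =>
    rw [Representation.tprod_apply, TensorProduct.map_tmul, contraction_tmul, contraction_tmul,
      map_smul, Representation.dual_apply]
    rfl
  | add x y hx hy =>
    simp only [map_add, LinearMap.add_apply, hx, hy]

end General

/-! ### Convergence of the modified theta series, and cancellation of the theta function of `M` -/

variable {V : Type*} [AddCommGroup V] [Module ℝ V] [FiniteDimensional ℝ V]
  {B : LinearMap.BilinForm ℝ V} {L M : Submodule ℤ V} {ι κ : Type*} [Fintype ι] [Fintype κ]
  (hL : IsEvenLattice B L) (hM : IsPrimitiveSublattice B L M)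
  {u : Grassmannian (B.restrict (realPerp B M))}

/-- Every class in `L*/M` is lifted to `L*` so that its projection lies in a fixed finite set of
representatives of `D_M`. On these lifts the summand of `Θ_L` is the desired term times one of
finitely many nonzero numbers, so convergence is inherited from `Θ_L`. -/
theorem summable_thetaTerm (F : LatticeFrame B M ι) (c : GrassmannianCoord u κ)
    (q : MvPolynomial κ ℂ) (ξ η : realPerp B M) (τ : ℍ) :
    Summable (thetaTerm hL hM u (c.polyFun q) ξ η τ) := by
  have := F.finite_discGroup
  have hLd := (sumFrame hL hM F c).le_dualLattice
  obtain ⟨r, hr⟩ : ∃ r : DiscGroup B M → dualLattice B M, ∀ δ, discMk B M (r δ) = δ :=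
    discMk_surjective.hasRightInverse
  have hex : ∀ l : DualMod B L M, ∃ x : dualLattice B L,
      (Submodule.Quotient.mk x : DualMod B L M) = l ∧ dualProj hL hM x = r (piM hL hM l) :=
    fun l => by
      obtain ⟨x, hx⟩ := (bijective_dualProj_fiber hL hM hLd l).2 ⟨r (piM hL hM l), hr _⟩
      exact ⟨x, x.2, congrArg Subtype.val hx⟩
  choose s hs hs' using hex
  have hinj : Function.Injective s := fun l l' h => by rw [← hs l, h, hs]
  have hsum := ((sumFrame hL hM F c).summable_thetaSummand (MvPolynomial.rename Sum.inr q)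
    (show 0 < (τ : ℂ).im from τ.im_pos) (Sum.elim 0 (c.coord ξ))
    (Sum.elim 0 (c.coord η))).comp_injective hinj
  obtain ⟨C, hC⟩ : ∃ C, ∀ δ : DiscGroup B M, ‖(F.thetaSummand 1 τ 0 0 (r δ))⁻¹‖ ≤ C :=
    (Set.finite_range fun δ : DiscGroup B M => ‖(F.thetaSummand 1 τ 0 0 (r δ))⁻¹‖).bddAbove.imp
      fun C hC δ => hC ⟨δ, rfl⟩
  refine Summable.of_norm_bounded (hsum.norm.mul_left C) fun l => ?_
  rw [Function.comp_apply, thetaSummand_sumFrame, hs, hs', norm_mul]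
  have h0 := norm_pos_iff.2 (thetaSummand_ne_zero F τ (r (piM hL hM l)))
  have h1 := hC (piM hL hM l)
  rw [norm_inv, inv_le_iff_one_le_mul₀ h0] at h1
  nlinarith [norm_nonneg (thetaTerm hL hM u (c.polyFun q) ξ η τ l)]

/-- The coefficients of the modified theta function. -/
noncomputable def thetaLMCoeff (u : Grassmannian (B.restrict (realPerp B M)))
    (p : realPerp B M → ℂ) (ξ η : realPerp B M) (τ : ℍ) (γ : DiscGroup B L)
    (δ : DiscGroup B M) : ℂ :=
  ∑' l : {l : DualMod B L M // toDisc hM l = γ ∧ piM hL hM l = δ}, thetaTerm hL hM u p ξ η τ l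

/-- Grouping `x` by its class in `L*/M` makes the inner sum a full coset sum of `Θ_M`, which depends
only on the image of the class in `D_M`; grouping by that image gives the pairing. -/
theorem tsum_thetaSummand_sumFrame (F : LatticeFrame B M ι) (c : GrassmannianCoord u κ)
    (q : MvPolynomial κ ℂ) (τ : ℍ) (ξ' η' : ι → ℝ) (ξ η : realPerp B M) (γ : DiscGroup B L) :
    ∑' x : {x : dualLattice B L // discMk B L x = γ},
        (sumFrame hL hM F c).thetaSummand (MvPolynomial.rename Sum.inr q) τ
          (Sum.elim ξ' (c.coord ξ)) (Sum.elim η' (c.coord η)) x =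
      ∑' δ : DiscGroup B M, thetaLMCoeff hL hM u (c.polyFun q) ξ η τ γ δ *
        ∑' m : {m : dualLattice B M // discMk B M m = δ}, F.thetaSummand 1 τ ξ' η' m := by
  have := F.finite_discGroup
  have hLd := (sumFrame hL hM F c).le_dualLattice
  have hτ : 0 < (τ : ℂ).im := τ.im_pos
  have hsum := summable_thetaTerm hL hM F c q ξ η τ
  set h := thetaTerm hL hM u (c.polyFun q) ξ η τ with hh
  set G : DiscGroup B M → ℂ := fun δ =>
    ∑' m : {m : dualLattice B M // discMk B M m = δ}, F.thetaSummand 1 τ ξ' η' m with hG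
  have h1 : ∀ l : DualMod B L M,
      ∑' x : {x : dualLattice B L // (Submodule.Quotient.mk x : DualMod B L M) = l},
        (sumFrame hL hM F c).thetaSummand (MvPolynomial.rename Sum.inr q) τ
          (Sum.elim ξ' (c.coord ξ)) (Sum.elim η' (c.coord η)) x = h l * G (piM hL hM l) :=
    fun l => by
      simp only [hG]
      rw [← (Equiv.ofBijective _ (bijective_dualProj_fiber hL hM hLd l)).tsum_eq, ← tsum_mul_left]
      refine tsum_congr fun x => ?_
      rw [thetaSummand_sumFrame, x.2, mul_comm]
      rfl
  obtain ⟨C, hC⟩ : ∃ C, ∀ δ : DiscGroup B M, ‖G δ‖ ≤ C :=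
    (Set.finite_range fun δ : DiscGroup B M => ‖G δ‖).bddAbove.imp fun C hC δ => hC ⟨δ, rfl⟩
  have hsum2 : Summable fun l : DualMod B L M => h l * G (piM hL hM l) :=
    Summable.of_norm_bounded (hsum.norm.mul_right C) fun l => by
      rw [norm_mul]
      exact mul_le_mul_of_nonneg_left (hC _) (norm_nonneg _)
  rw [tsum_subtype_fiber (P := fun x => discMk B L x = γ)
    ((sumFrame hL hM F c).summable_thetaSummand _ hτ _ _)
    (fun x => (Submodule.Quotient.mk x : DualMod B L M)) (Q := fun l => toDisc hM l = γ)
    (fun x => Iff.rfl)]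
  simp only [h1]
  refine (tsum_eq_tsum_fiber (hsum2.comp_injective Subtype.val_injective)
    (fun l : {l : DualMod B L M // toDisc hM l = γ} => piM hL hM l)).trans
    (tsum_congr fun δ => ?_)
  rw [thetaLMCoeff, ← tsum_mul_right,
    ← (Equiv.subtypeSubtypeEquivSubtypeInter (fun l : DualMod B L M => toDisc hM l = γ)
    (fun l => piM hL hM l = δ)).tsum_eq]
  refine tsum_congr fun l => ?_
  have h2 : piM hL hM l = δ := l.2
  change h l * G (piM hL hM l) = h l * G δ
  rw [h2]

theorem contraction_thetaLM [Finite (DiscGroup B L)] [Finite (DiscGroup B M)] (k : ℝ)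
    (p : realPerp B M → ℂ) (ξ η : realPerp B M) (τ : ℍ) (v : DiscSpace B M) (γ : DiscGroup B L) :
    contraction B L M (thetaLM hL hM k u p ξ η τ) v γ =
      ((τ.im ^ k : ℝ) : ℂ) * ∑' δ, thetaLMCoeff hL hM u p ξ η τ γ δ * v δ := by
  classical
  have := Fintype.ofFinite (DiscGroup B L)
  have := Fintype.ofFinite (DiscGroup B M)
  rw [thetaLM, finsum_eq_sum_of_fintype]
  simp only [finsum_eq_sum_of_fintype, tsum_fintype, map_smul, map_sum, LinearMap.smul_apply,
    LinearMap.sum_apply, contraction_tmul, Finsupp.smul_apply, Finsupp.finsetSum_apply, basisVec,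
    dualVec, Finsupp.lapply_apply, smul_eq_mul]
  congr 1
  rw [Finset.sum_eq_single γ]
  · simp [thetaLMCoeff]
  · intro γ' _ h
    simp [h]
  · simp

theorem negCount_sumFrame (F : LatticeFrame B M ι) (c : GrassmannianCoord u κ) :
    negCount (sumFrame hL hM F c).ε = negCount F.ε + negCount c.ε := by
  change negCount (Sum.elim F.ε c.ε) = _
  simp only [negCount, Finset.card_filter, Fintype.sum_sum_type, Sum.elim_inl, Sum.elim_inr]
  rfl

theorem contraction_thetaVec (F : LatticeFrame B M ι) (c : GrassmannianCoord u κ)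
    (q : MvPolynomial κ ℂ) (b : ℕ) {k : ℝ} (hk : k = (negCount c.ε : ℝ) / 2 + b) (τ : ℍ)
    (ξ' η' : ι → ℝ) (ξ η : realPerp B M) :
    contraction B L M (thetaLM hL hM k u (c.polyFun q) ξ η τ) (F.thetaVec 1 0 τ ξ' η') =
      (sumFrame hL hM F c).thetaVec (MvPolynomial.rename Sum.inr q) b τ
        (Sum.elim ξ' (c.coord ξ)) (Sum.elim η' (c.coord η)) := by
  have := F.finite_discGroup
  have := (sumFrame hL hM F c).finite_discGroup
  ext γ
  rw [contraction_thetaLM, LatticeFrame.thetaVec_apply, LatticeFrame.thetaCoeff,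
    tsum_thetaSummand_sumFrame]
  simp only [LatticeFrame.thetaVec_apply, LatticeFrame.thetaCoeff]
  rw [← tsum_mul_left, ← tsum_mul_left]
  refine tsum_congr fun δ => ?_
  -- Negative signs add up over the two summands and `Θ_M` has polynomial degree zero, so the powers
  -- of `y` match.
  have h1 : (((τ : ℂ).im ^ ((negCount (sumFrame hL hM F c).ε : ℝ) / 2 + b) : ℝ) : ℂ) =
      ((τ.im ^ k : ℝ) : ℂ) * (((τ : ℂ).im ^ ((negCount F.ε : ℝ) / 2 + (0 : ℕ)) : ℝ) : ℂ) := by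
    rw [← Complex.ofReal_mul]
    congr 1
    change τ.im ^ _ = τ.im ^ k * τ.im ^ _
    rw [← Real.rpow_add τ.im_pos, negCount_sumFrame, hk]
    congr 1
    push_cast
    ring
  rw [h1]
  ring

/-- Contracting with `Θ_M` at `gτ` gives `Θ_L` at `gτ`. The two known laws therefore give the claim
on the values of `Θ_M` at `τ`, and these span. -/
theorem thetaLM_transformation (F : LatticeFrame B M ι) (c : GrassmannianCoord u κ)
    {q : MvPolynomial κ ℂ} {a b : ℕ} (hq : IsBihomogeneous c.ε q a b) {k : ℝ}
    (hk : k = (negCount c.ε : ℝ) / 2 + b) (ξ η : realPerp B M) (τ : ℍ) (g : Mp2Z) :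
    thetaLM hL hM k u (c.polyFun q) (g.mat 0 0 • ξ + g.mat 0 1 • η)
        (g.mat 1 0 • ξ + g.mat 1 1 • η) (g.mat • τ) =
      g.phi τ ^ ((sumFrame hL hM F c).weight a b - F.weight 0 0) •
        ((weilRep B L).tprod (weilRep B M).dual) g (thetaLM hL hM k u (c.polyFun q) ξ η τ) := by
  have := F.finite_discGroup
  apply contraction_injective
  have hφ := g.phi_ne_zero τ
  have key : ∀ v, contraction B L M (thetaLM hL hM k u (c.polyFun q)
      (g.mat 0 0 • ξ + g.mat 0 1 • η) (g.mat 1 0 • ξ + g.mat 1 1 • η) (g.mat • τ))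
        (weilRep B M g v) = g.phi τ ^ ((sumFrame hL hM F c).weight a b - F.weight 0 0) •
          weilRep B L g (contraction B L M (thetaLM hL hM k u (c.polyFun q) ξ η τ) v) := by
    intro v
    have hv : v ∈ Submodule.span ℂ {v | ∃ ξ η, F.thetaVec 1 0 τ ξ η = v} := by
      rw [F.span_thetaVec]; trivial
    induction hv using Submodule.span_induction with
    | mem v hv =>
      obtain ⟨ξ', η', rfl⟩ := hv
      have h1 := (sumFrame hL hM F c).transforms_thetaVec (hq.rename_inr F.ε) g τ
        (Sum.elim ξ' (c.coord ξ)) (Sum.elim η' (c.coord η))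
      have h2 := F.transforms_thetaVec (LatticeFrame.isBihomogeneous_one F.ε) g τ ξ' η'
      rw [smul_sum_elim, smul_sum_elim, smul_sum_elim, smul_sum_elim, sum_elim_add, sum_elim_add,
        ← map_zsmul c.coord, ← map_zsmul c.coord, ← map_zsmul c.coord, ← map_zsmul c.coord,
        ← map_add, ← map_add, ← contraction_thetaVec hL hM F c q b hk,
        ← contraction_thetaVec hL hM F c q b hk, h2, map_smul] at h1
      rw [zpow_sub₀ hφ, div_eq_inv_mul, mul_smul, ← h1, inv_smul_smul₀ (zpow_ne_zero _ hφ)]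
    | zero => simp
    | add v w _ _ hv hw => simp only [map_add, hv, hw, smul_add]
    | smul t v _ hv => simp only [map_smul, hv]; rw [smul_comm]
  ext1 δ
  refine LinearMap.ext fun t => ?_
  simp only [LinearMap.comp_apply]
  -- The identity is used at `v = ρ_M(g⁻¹) δ`, which matches the conjugation action.
  rw [map_smul, LinearMap.smul_apply, contraction_tprod, ← key, ← Module.End.mul_apply, ← map_mul,
    mul_inv_cancel, map_one, Module.End.one_apply]

end Transformation

end ModifiedTheta

/-! ### The theorem, translated back from coordinates -/

open ModifiedTheta
theorem mainTheorem2 {V : Type*} [AddCommGroup V] [Module ℝ V] [FiniteDimensional ℝ V]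
    (B : LinearMap.BilinForm ℝ V) (L M : Submodule ℤ V)
    (hL : IsEvenLattice B L) (hM : IsPrimitiveSublattice B L M)
    (bp bm cp cm : ℕ) (hLsig : HasSignature B L bp bm) (hMsig : HasSignature B M cp cm)
    (u : Grassmannian (B.restrict (realPerp B M)))
    (mp mm np nm : ℕ) (hnp : np ≤ mp) (hnm : nm ≤ mm)
    (p : realPerp B M → ℂ) (hp : IsPolynomial p)
    (hhom : IsHomogeneousOfDegree u p (mp - np) (mm - nm)) :
    -- the Weil representations are given by the usual formulae on the generators
    (IsWeilRep B L (weilRep B L) ∧ IsWeilRep B M (weilRep B M)) ∧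
    -- the theta series converges absolutely
    (∀ (ξ η : realPerp B M) (τ : ℍ), Summable (thetaTerm hL hM u p ξ η τ)) ∧
    -- the transformation law
    ∀ (ξ η : realPerp B M) (τ : ℍ) (g : Mp2Z),
      thetaLM hL hM (((bm : ℝ) - cm) / 2 + ((mm : ℝ) - nm)) u p
          (g.mat 0 0 • ξ + g.mat 0 1 • η) (g.mat 1 0 • ξ + g.mat 1 1 • η) (g.mat • τ) =
        g.phi τ ^ ((bp : ℤ) - cp - bm + cm + 2 * mp - 2 * np - 2 * mm + 2 * nm) •
          ((weilRep B L).tprod (weilRep B M).dual) g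
            (thetaLM hL hM (((bm : ℝ) - cm) / 2 + ((mm : ℝ) - nm)) u p ξ η τ) := by
  obtain ⟨F⟩ := exists_latticeFrame hL hM
  obtain ⟨c⟩ := exists_grassmannianCoord (hL.symm.restrict _) u
  obtain ⟨q, rfl⟩ := c.exists_polyFun_eq hp
  have hbp : posCount (sumFrame hL hM F c).ε = bp := (sumFrame hL hM F c).sigPos_eq ▸ hLsig.1
  have hbm : negCount (sumFrame hL hM F c).ε = bm := (sumFrame hL hM F c).sigNeg_eq ▸ hLsig.2
  have hcp : posCount F.ε = cp := F.sigPos_eq ▸ hMsig.1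
  have hcm : negCount F.ε = cm := F.sigNeg_eq ▸ hMsig.2
  refine ⟨⟨(sumFrame hL hM F c).isWeilRep_weilRep, F.isWeilRep_weilRep⟩,
    fun ξ η τ => summable_thetaTerm hL hM F c q ξ η τ, fun ξ η τ g => ?_⟩
  rw [thetaLM_transformation hL hM F c (c.isBihomogeneous hhom)]
  · congr 2
    rw [LatticeFrame.weight, LatticeFrame.weight, hbp, hbm, hcp, hcm]
    -- The degrees are truncated differences of natural numbers; the two inequalities make them
    -- genuine differences.
    push_cast [hnp, hnm]
    ring
  -- The number of negative coordinates on `M_ℝ^⊥` is `b₋ - c₋`, which gives the exponent of `y`.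
  · rw [← hbm, ← hcm, negCount_sumFrame]
    push_cast [hnm]
    ring
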